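/- Let $n\ge 2$, $m\ge 1$, and let $\Omega\subset\mathbb R^n$ be a bounded Lipschitz domain, that is, a nonempty, open, bounded set whose boundary has a finite open cover such that, in each set of the cover, $\Omega$ coincides, after a rigid motion, with the region above the graph of a Lipschitz function $\mathbb R^{n-1}\to\mathbb R$. For $1\le j,k\le n$, $1\le\alpha,\beta\le m$, let $a_{j,k}^{\alpha,\beta}\in L^\infty(\Omega)$ be complex-valued coefficients such that, for a.e. $x\in\Omega$, $a_{j,k}^{\alpha,\beta}(x)=\overline{a_{k,j}^{\beta,\alpha}(x)}$ for all $j,k,\alpha,\beta$, and such that for some $a_0>0$ (independent of $x$) $$\operatorname{Re}\sum_{j,k=1}^n\sum_{\alpha,\beta=1}^m a_{j,k}^{\alpha,\beta}(x)\,\zeta_k^\beta\,\overline{\zeta_j^\alpha}\;\ge\; a_0\sum_{j,\alpha}|\zeta_j^\alpha|^2\qquad\text{for all }\zeta\in\mathbb C^{n\times m}.$$ For $u\in H^1(\Omega)^m$ let $Lu$ be the distribution $$Lu=-\Big(\sum_{j,k=1}^n\partial_j\Big(\sum_{\beta=1}^m a_{j,k}^{\alpha,\beta}\,\partial_k u_\beta\Big)\Big)_{1\le\alpha\le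 m}.$$ Let $H^1_0(\Omega)$ be the closure of $C_0^\infty(\Omega)$ in $H^1(\Omega)$, and let $\gamma_D$ be the Dirichlet trace operator, i.e. the bounded operator from $H^1(\Omega)^m$ to $L^2(\partial\Omega)^m$ (with range $H^{1/2}(\partial\Omega)^m$) that extends $u\mapsto u|_{\partial\Omega}$ from functions smooth up to the boundary. Then $$\{u\in H^1(\Omega)^m : Lu\in L^2(\Omega)^m,\ \gamma_D u=0\}=\{u\in H^1_0(\Omega)^m : Lu\in L^2(\Omega)^m\},$$ and the operator $L_{D,\Omega}$ in $L^2(\Omega)^m$ with this domain, acting as $L_{D,\Omega}u=Lu$, has the following properties. 1. $L_{D,\Omega}$ is densely defined, self-adjoint, and strictly positive, i.e. $L_{D,\Omega}\ge c\,I$ for some $c>0$. 2. $L_{D,\Omega}$ has a unique nonnegative self-adjoint square root, and $\operatorname{dom}\big((L_{D,\Omega})^{1/2}\big)=H^1_0(\Omega)^m$. 3. The spectrum of $L_{D,\Omega}$ is contained in $(0,\infty)$ and is purely discrete: every point of it is isolated and is an eigenvalue of finite multiplicity, i.e. $\sigma_{\rm ess}(L_{D,\Omega})=\emptyset$. 4.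 The sesquilinear form $$\mathfrak Q_{D,\Omega}(u,v)=\int_\Omega\sum_{j,k=1}^n\sum_{\alpha,\beta=1}^m a_{j,k}^{\alpha,\beta}\,\partial_k v_\beta\,\overline{\partial_j u_\alpha}\,d^nx,\qquad u,v\in H^1_0(\Omega)^m,$$ is densely defined, symmetric, bounded from below and closed in $L^2(\Omega)^m$, and $L_{D,\Omega}$ is the operator uniquely associated with it: $v\in\operatorname{dom}(L_{D,\Omega})$ and $L_{D,\Omega}v=f$ if and only if $v\in H^1_0(\Omega)^m$ and $\mathfrak Q_{D,\Omega}(w,v)=(w,f)_{L^2(\Omega)^m}$ for all $w\in H^1_0(\Omega)^m$ (scalar product antilinear in the first argument). Moreover, $\operatorname{dom}(L_{D,\Omega})$ is dense in $H^1_0(\Omega)^m$ with respect to the form norm. -/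

import Mathlib

open MeasureTheory Filter Topology
open scoped ENNReal NNReal Distributions ContDiff InnerProductSpace

noncomputable section

namespace DivForm

/-! ### Bounded Lipschitz domains -/

/-- A bounded Lipschitz domain in `ℝⁿ`: an open, nonempty, bounded set whose boundary has a finite
open cover such that in each member of the cover the set coincides with the over-graph of a
Lipschitz function `ℝⁿ⁻¹ → ℝ`, after a rigid motion of the coordinates. -/
structure IsBoundedLipschitzDomain {n : ℕ} (Ω : Set (EuclideanSpace ℝ (Fin n))) : Prop where
  isOpen : IsOpen Ω
  nonempty : Ω.Nonempty
  isBounded : Bornology.IsBounded Ω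
  exists_charts : ∃ (N : ℕ) (O : Fin N → Set (EuclideanSpace ℝ (Fin n))),
    (∀ i, IsOpen (O i)) ∧ frontier Ω ⊆ ⋃ i, O i ∧
    ∀ i, ∃ (T : EuclideanSpace ℝ (Fin n) ≃ᵢ WithLp 2 (EuclideanSpace ℝ (Fin (n - 1)) × ℝ))
      (g : EuclideanSpace ℝ (Fin (n - 1)) → ℝ) (K : ℝ≥0), LipschitzWith K g ∧
      O i ∩ Ω = O i ∩ {x | g (T x).fst < (T x).snd}

/-! ### Sobolev spaces -/

section Sobolev

variable {n m : ℕ} {Ω : TopologicalSpace.Opens (EuclideanSpace ℝ (Fin n))}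

/-- The Hilbert space `L²(Ω; dⁿx)ᵐ`. -/
abbrev VecL2 (m : ℕ) (Ω : TopologicalSpace.Opens (EuclideanSpace ℝ (Fin n))) : Type :=
  Lp (EuclideanSpace ℂ (Fin m)) 2 (volume.restrict (Ω : Set (EuclideanSpace ℝ (Fin n))))

/-- The (classical) partial derivative `∂ⱼ φ`. -/
def pderiv {F : Type*} [NormedAddCommGroup F] [NormedSpace ℝ F] (j : Fin n)
    (φ : EuclideanSpace ℝ (Fin n) → F) (x : EuclideanSpace ℝ (Fin n)) : F :=
  fderiv ℝ φ x (EuclideanSpace.single j 1)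

/-- `G j ∈ L²(Ω)ᵐ` is the `j`-th partial derivative of `u` in the sense of distributions,
for all `j`. -/
def IsWeakGrad (u : VecL2 m Ω) (G : Fin n → VecL2 m Ω) : Prop :=
  ∀ (φ : 𝓓(Ω, ℝ)) (j : Fin n),
    ∫ x in (Ω : Set (EuclideanSpace ℝ (Fin n))), pderiv j φ x • u x =
      -∫ x in (Ω : Set (EuclideanSpace ℝ (Fin n))), φ x • G j x

lemma continuous_pderiv (j : Fin n) (φ : 𝓓(Ω, ℝ)) : Continuous (pderiv j φ) :=
  (φ.contDiff.continuous_fderiv (by simp)).clm_apply continuous_const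

lemma hasCompactSupport_pderiv (j : Fin n) (φ : 𝓓(Ω, ℝ)) : HasCompactSupport (pderiv j φ) :=
  φ.hasCompactSupport.fderiv_apply ℝ _

lemma integrable_smul_of_memLp {F : Type*} [NormedAddCommGroup F] [NormedSpace ℝ F]
    {f : EuclideanSpace ℝ (Fin n) → F}
    (hf : MemLp f 2 (volume.restrict (Ω : Set (EuclideanSpace ℝ (Fin n)))))
    {φ : EuclideanSpace ℝ (Fin n) → ℝ} (hφ : Continuous φ) (hc : HasCompactSupport φ) :
    Integrable (fun x => φ x • f x) (volume.restrict (Ω : Set (EuclideanSpace ℝ (Fin n)))) :=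
  (hf.locallyIntegrable (by norm_num)).integrable_smul_left_of_hasCompactSupport hφ hc

lemma integrable_test_smul (φ : 𝓓(Ω, ℝ)) (u : VecL2 m Ω) :
    Integrable (fun x => φ x • u x) (volume.restrict (Ω : Set (EuclideanSpace ℝ (Fin n)))) :=
  integrable_smul_of_memLp (Lp.memLp u) φ.contDiff.continuous φ.hasCompactSupport

lemma integrable_pderiv_smul (φ : 𝓓(Ω, ℝ)) (j : Fin n) (u : VecL2 m Ω) :
    Integrable (fun x => pderiv j φ x • u x)
      (volume.restrict (Ω : Set (EuclideanSpace ℝ (Fin n)))) :=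
  integrable_smul_of_memLp (Lp.memLp u) (continuous_pderiv j φ) (hasCompactSupport_pderiv j φ)

lemma IsWeakGrad.add {u v : VecL2 m Ω} {G H : Fin n → VecL2 m Ω} (hu : IsWeakGrad u G)
    (hv : IsWeakGrad v H) : IsWeakGrad (u + v) (G + H) := by
  intro φ j
  have h1 : ∫ x in (Ω : Set (EuclideanSpace ℝ (Fin n))), pderiv j φ x • (u + v : VecL2 m Ω) x =
      ∫ x in (Ω : Set (EuclideanSpace ℝ (Fin n))),
        (pderiv j φ x • u x + pderiv j φ x • v x) := by
    refine integral_congr_ae ?_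
    filter_upwards [Lp.coeFn_add u v] with x hx
    rw [hx, Pi.add_apply, smul_add]
  have h2 : ∫ x in (Ω : Set (EuclideanSpace ℝ (Fin n))), φ x • (G j + H j : VecL2 m Ω) x =
      ∫ x in (Ω : Set (EuclideanSpace ℝ (Fin n))), (φ x • G j x + φ x • H j x) := by
    refine integral_congr_ae ?_
    filter_upwards [Lp.coeFn_add (G j) (H j)] with x hx
    rw [hx, Pi.add_apply, smul_add]
  rw [h1, Pi.add_apply, h2, integral_add (integrable_pderiv_smul φ j u)
    (integrable_pderiv_smul φ j v), integral_add (integrable_test_smul φ _)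
    (integrable_test_smul φ _), hu φ j, hv φ j, neg_add]

lemma IsWeakGrad.smul {u : VecL2 m Ω} {G : Fin n → VecL2 m Ω} (c : ℂ) (hu : IsWeakGrad u G) :
    IsWeakGrad (c • u) (c • G) := by
  intro φ j
  have h1 : ∫ x in (Ω : Set (EuclideanSpace ℝ (Fin n))), pderiv j φ x • (c • u : VecL2 m Ω) x =
      ∫ x in (Ω : Set (EuclideanSpace ℝ (Fin n))), c • (pderiv j φ x • u x) := by
    refine integral_congr_ae ?_
    filter_upwards [Lp.coeFn_smul c u] with x hx
    rw [hx, Pi.smul_apply, smul_comm]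
  have h2 : ∫ x in (Ω : Set (EuclideanSpace ℝ (Fin n))), φ x • (c • G j : VecL2 m Ω) x =
      ∫ x in (Ω : Set (EuclideanSpace ℝ (Fin n))), c • (φ x • G j x) := by
    refine integral_congr_ae ?_
    filter_upwards [Lp.coeFn_smul c (G j)] with x hx
    rw [hx, Pi.smul_apply, smul_comm]
  rw [h1, Pi.smul_apply, h2, integral_smul, integral_smul, hu φ j, smul_neg]

lemma IsWeakGrad.zero : IsWeakGrad (0 : VecL2 m Ω) (0 : Fin n → VecL2 m Ω) := by
  intro φ j
  have h1 : ∫ x in (Ω : Set (EuclideanSpace ℝ (Fin n))), pderiv j φ x • (0 : VecL2 m Ω) x = 0 := by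
    refine integral_eq_zero_of_ae ?_
    filter_upwards [Lp.coeFn_zero (EuclideanSpace ℂ (Fin m)) 2
      (volume.restrict (Ω : Set (EuclideanSpace ℝ (Fin n))))] with x hx
    rw [hx]
    simp
  have h2 : ∫ x in (Ω : Set (EuclideanSpace ℝ (Fin n))), φ x • (0 : VecL2 m Ω) x = 0 := by
    refine integral_eq_zero_of_ae ?_
    filter_upwards [Lp.coeFn_zero (EuclideanSpace ℂ (Fin m)) 2
      (volume.restrict (Ω : Set (EuclideanSpace ℝ (Fin n))))] with x hx
    rw [hx]
    simp
  rw [h1, Pi.zero_apply, h2, neg_zero]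

/-- The fundamental lemma of the calculus of variations in `L²(Ω)`. -/
lemma ae_eq_zero_of_test {F : Type*} [NormedAddCommGroup F] [NormedSpace ℝ F] [CompleteSpace F]
    {f : EuclideanSpace ℝ (Fin n) → F}
    (hf : MemLp f 2 (volume.restrict (Ω : Set (EuclideanSpace ℝ (Fin n)))))
    (h : ∀ φ : 𝓓(Ω, ℝ), ∫ x in (Ω : Set (EuclideanSpace ℝ (Fin n))), φ x • f x = 0) :
    f =ᵐ[volume.restrict (Ω : Set (EuclideanSpace ℝ (Fin n)))] 0 := by
  have key := Ω.isOpen.ae_eq_zero_of_integral_contDiff_smul_eq_zero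
    (μ := volume.restrict (Ω : Set (EuclideanSpace ℝ (Fin n))))
    ((hf.locallyIntegrable (by norm_num)).locallyIntegrableOn _)
    (fun g hg hc hs => h ⟨g, hg, hc, hs⟩)
  filter_upwards [key, ae_restrict_mem Ω.isOpen.measurableSet] with x hx hxΩ using hx hxΩ

lemma IsWeakGrad.unique {u : VecL2 m Ω} {G H : Fin n → VecL2 m Ω} (hG : IsWeakGrad u G)
    (hH : IsWeakGrad u H) : G = H := by
  funext j
  have h0 : ((G j - H j : VecL2 m Ω) : EuclideanSpace ℝ (Fin n) → EuclideanSpace ℂ (Fin m))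
      =ᵐ[volume.restrict (Ω : Set (EuclideanSpace ℝ (Fin n)))] 0 := by
    refine ae_eq_zero_of_test (Lp.memLp _) fun φ => ?_
    have h1 : ∫ x in (Ω : Set (EuclideanSpace ℝ (Fin n))), φ x • (G j - H j : VecL2 m Ω) x =
        ∫ x in (Ω : Set (EuclideanSpace ℝ (Fin n))), (φ x • G j x - φ x • H j x) := by
      refine integral_congr_ae ?_
      filter_upwards [Lp.coeFn_sub (G j) (H j)] with x hx
      rw [hx, Pi.sub_apply, smul_sub]
    rw [h1, integral_sub (integrable_test_smul φ _) (integrable_test_smul φ _)]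
    have h2 := (hG φ j).symm.trans (hH φ j)
    rw [neg_inj] at h2
    rw [h2, sub_self]
  exact sub_eq_zero.mp (Lp.eq_zero_iff_ae_eq_zero.mpr h0)

variable (m Ω) in
/-- The Sobolev space `H¹(Ω)ᵐ`, as a subspace of `L²(Ω)ᵐ`. -/
def H1 : Submodule ℂ (VecL2 m Ω) where
  carrier := {u | ∃ G, IsWeakGrad u G}
  add_mem' := fun ⟨_, hG⟩ ⟨_, hH⟩ => ⟨_, hG.add hH⟩
  zero_mem' := ⟨0, IsWeakGrad.zero⟩
  smul_mem' := fun c _ ⟨_, hG⟩ => ⟨_, hG.smul c⟩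

open Classical in
/-- The weak gradient `(∂ⱼ u)ⱼ` of `u ∈ H¹(Ω)ᵐ`; so `weakGrad u j x α = (∂ⱼ u_α)(x)`.
(The value is `0` if `u` is not in `H¹(Ω)ᵐ`.) -/
def weakGrad (u : VecL2 m Ω) : Fin n → VecL2 m Ω :=
  if h : ∃ G, IsWeakGrad u G then h.choose else 0

lemma isWeakGrad_weakGrad {u : VecL2 m Ω} (hu : u ∈ H1 m Ω) : IsWeakGrad u (weakGrad u) := by
  have h : ∃ G, IsWeakGrad u G := hu
  rw [weakGrad, dif_pos h]
  exact h.choose_spec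

lemma weakGrad_add {u v : VecL2 m Ω} (hu : u ∈ H1 m Ω) (hv : v ∈ H1 m Ω) :
    weakGrad (u + v) = weakGrad u + weakGrad v :=
  (isWeakGrad_weakGrad (add_mem hu hv)).unique
    ((isWeakGrad_weakGrad hu).add (isWeakGrad_weakGrad hv))

lemma weakGrad_smul {u : VecL2 m Ω} (c : ℂ) (hu : u ∈ H1 m Ω) :
    weakGrad (c • u) = c • weakGrad u :=
  (isWeakGrad_weakGrad (Submodule.smul_mem _ c hu)).unique ((isWeakGrad_weakGrad hu).smul c)

lemma weakGrad_zero : weakGrad (0 : VecL2 m Ω) = 0 :=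
  (isWeakGrad_weakGrad (zero_mem _)).unique IsWeakGrad.zero

/-- The classical functions `φ k` (with their classical derivatives) converge to `u` in the norm
of `H¹(Ω)ᵐ`. -/
def H1Tendsto (φ : ℕ → EuclideanSpace ℝ (Fin n) → EuclideanSpace ℂ (Fin m)) (u : VecL2 m Ω) :
    Prop :=
  Tendsto (fun k => eLpNorm (fun x => φ k x - u x) 2
      (volume.restrict (Ω : Set (EuclideanSpace ℝ (Fin n))))) atTop (𝓝 0) ∧
    ∀ j, Tendsto (fun k => eLpNorm (fun x => pderiv j (φ k) x - weakGrad u j x) 2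
      (volume.restrict (Ω : Set (EuclideanSpace ℝ (Fin n))))) atTop (𝓝 0)

lemma tendsto_eLpNorm_add {μ : Measure (EuclideanSpace ℝ (Fin n))}
    {f g : ℕ → EuclideanSpace ℝ (Fin n) → EuclideanSpace ℂ (Fin m)} {u v w : Lp _ 2 μ}
    (hfm : ∀ k, AEStronglyMeasurable (f k) μ) (hgm : ∀ k, AEStronglyMeasurable (g k) μ)
    (hf : Tendsto (fun k => eLpNorm (fun x => f k x - u x) 2 μ) atTop (𝓝 0))
    (hg : Tendsto (fun k => eLpNorm (fun x => g k x - v x) 2 μ) atTop (𝓝 0)) (hw : w = u + v) :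
    Tendsto (fun k => eLpNorm (fun x => (f k x + g k x) - w x) 2 μ) atTop (𝓝 0) := by
  subst hw
  refine tendsto_of_tendsto_of_tendsto_of_le_of_le tendsto_const_nhds
    (by simpa using hf.add hg) (fun _ => zero_le) (fun k => ?_)
  have h : (fun x => (f k x + g k x) - (u + v : Lp _ 2 μ) x) =ᵐ[μ]
      (fun x => f k x - u x) + (fun x => g k x - v x) := by
    filter_upwards [Lp.coeFn_add u v] with x hx
    simp only [hx, Pi.add_apply]
    abel
  rw [eLpNorm_congr_ae h]
  exact eLpNorm_add_le ((hfm k).sub (Lp.aestronglyMeasurable u))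
    ((hgm k).sub (Lp.aestronglyMeasurable v)) (by norm_num)

lemma tendsto_eLpNorm_smul {μ : Measure (EuclideanSpace ℝ (Fin n))} (c : ℂ)
    {f : ℕ → EuclideanSpace ℝ (Fin n) → EuclideanSpace ℂ (Fin m)} {u w : Lp _ 2 μ}
    (hf : Tendsto (fun k => eLpNorm (fun x => f k x - u x) 2 μ) atTop (𝓝 0)) (hw : w = c • u) :
    Tendsto (fun k => eLpNorm (fun x => c • f k x - w x) 2 μ) atTop (𝓝 0) := by
  subst hw
  have h : ∀ k, eLpNorm (fun x => c • f k x - (c • u : Lp _ 2 μ) x) 2 μ =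
      ‖c‖ₑ * eLpNorm (fun x => f k x - u x) 2 μ := by
    intro k
    rw [← eLpNorm_const_smul]
    refine eLpNorm_congr_ae ?_
    filter_upwards [Lp.coeFn_smul c u] with x hx
    simp [hx, smul_sub]
  simp_rw [h]
  simpa using ENNReal.Tendsto.const_mul hf (Or.inr enorm_ne_top)

lemma aesm_pderiv {μ : Measure (EuclideanSpace ℝ (Fin n))} (j : Fin n)
    (φ : 𝓓(Ω, EuclideanSpace ℂ (Fin m))) : AEStronglyMeasurable (pderiv j φ) μ :=
  ((φ.contDiff.continuous_fderiv (by simp)).clm_apply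
    continuous_const).aestronglyMeasurable

variable (m Ω) in
/-- `H¹₀(Ω)ᵐ`: the closure of `C₀^∞(Ω)ᵐ` in `H¹(Ω)ᵐ`. -/
def H10 : Submodule ℂ (VecL2 m Ω) where
  carrier := {u | u ∈ H1 m Ω ∧
    ∃ φ : ℕ → 𝓓(Ω, EuclideanSpace ℂ (Fin m)), H1Tendsto (fun k => ⇑(φ k)) u}
  add_mem' := by
    rintro u v ⟨hu, φ, hφ⟩ ⟨hv, ψ, hψ⟩
    refine ⟨add_mem hu hv, fun k => φ k + ψ k, ?_, fun j => ?_⟩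
    · exact tendsto_eLpNorm_add (fun k => (φ k).contDiff.continuous.aestronglyMeasurable)
        (fun k => (ψ k).contDiff.continuous.aestronglyMeasurable) hφ.1 hψ.1 rfl
    · have h : ∀ k x, pderiv j (⇑(φ k + ψ k)) x = pderiv j (φ k) x + pderiv j (ψ k) x := by
        intro k x
        have h1 : DifferentiableAt ℝ (φ k) x := (φ k).contDiff.differentiable (by simp) x
        have h2 : DifferentiableAt ℝ (ψ k) x := (ψ k).contDiff.differentiable (by simp) x
        simp only [pderiv]
        rw [show (⇑(φ k + ψ k) : EuclideanSpace ℝ (Fin n) → EuclideanSpace ℂ (Fin m)) =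
          ⇑(φ k) + ⇑(ψ k) from rfl, fderiv_add h1 h2]
        rfl
      simp_rw [h]
      exact tendsto_eLpNorm_add (fun k => aesm_pderiv j _) (fun k => aesm_pderiv j _)
        (hφ.2 j) (hψ.2 j) (by rw [weakGrad_add hu hv]; rfl)
  zero_mem' := by
    refine ⟨zero_mem _, fun _ => 0, ?_, fun j => ?_⟩
    · refine tendsto_const_nhds.congr fun k => ?_
      rw [eq_comm, eLpNorm_eq_zero_of_ae_zero]
      filter_upwards [Lp.coeFn_zero (EuclideanSpace ℂ (Fin m)) 2
        (volume.restrict (Ω : Set (EuclideanSpace ℝ (Fin n))))] with x hx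
      rw [hx]
      simp
    · refine tendsto_const_nhds.congr fun k => ?_
      rw [eq_comm, eLpNorm_eq_zero_of_ae_zero]
      filter_upwards [Lp.coeFn_zero (EuclideanSpace ℂ (Fin m)) 2
        (volume.restrict (Ω : Set (EuclideanSpace ℝ (Fin n))))] with x hx
      rw [weakGrad_zero, Pi.zero_apply, hx]
      simp [pderiv]
  smul_mem' := by
    rintro c u ⟨hu, φ, hφ⟩
    refine ⟨Submodule.smul_mem _ c hu, fun k => c • φ k, ?_, fun j => ?_⟩
    · exact tendsto_eLpNorm_smul c hφ.1 rfl
    · have h : ∀ k x, pderiv j (⇑(c • φ k)) x = c • pderiv j (φ k) x := by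
        intro k x
        have h1 : DifferentiableAt ℝ (φ k) x := (φ k).contDiff.differentiable (by simp) x
        simp only [pderiv]
        rw [show (⇑(c • φ k) : EuclideanSpace ℝ (Fin n) → EuclideanSpace ℂ (Fin m)) =
          c • ⇑(φ k) from rfl, fderiv_const_smul h1]
        rfl
      simp_rw [h]
      exact tendsto_eLpNorm_smul c (hφ.2 j) (by rw [weakGrad_smul c hu]; rfl)

/-- The surface measure on `∂Ω`, up to a positive constant factor. -/
def surfaceMeasure (Ω : TopologicalSpace.Opens (EuclideanSpace ℝ (Fin n))) :
    Measure (EuclideanSpace ℝ (Fin n)) :=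
  (Measure.hausdorffMeasure ((n : ℝ) - 1)).restrict
    (frontier (Ω : Set (EuclideanSpace ℝ (Fin n))))

/-- The graph of the Dirichlet trace operator `γ_D`, so that `HasTrace u g` means `γ_D u = g`:
the closure, in `H¹(Ω)ᵐ × L²(∂Ω)ᵐ`, of the graph of the restriction map `φ ↦ φ|_{∂Ω}` on functions
`φ` that are smooth up to the boundary. -/
def HasTrace (u : VecL2 m Ω) (g : Lp (EuclideanSpace ℂ (Fin m)) 2 (surfaceMeasure Ω)) : Prop :=
  u ∈ H1 m Ω ∧ ∃ φ : ℕ → EuclideanSpace ℝ (Fin n) → EuclideanSpace ℂ (Fin m),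
    (∀ k, ContDiff ℝ ∞ (φ k) ∧ HasCompactSupport (φ k)) ∧ H1Tendsto φ u ∧
    Tendsto (fun k => eLpNorm (fun x => φ k x - g x) 2 (surfaceMeasure Ω)) atTop (𝓝 0)

end Sobolev

/-! ### The divergence form system and its Dirichlet realization -/

section System

variable {n m : ℕ} {Ω : TopologicalSpace.Opens (EuclideanSpace ℝ (Fin n))}

/-- A tensor coefficient `A ∈ L^∞(Ω)`, with entries `A j k α β` standing for `a_{j,k}^{α,β}`. -/
abbrev Coeff (m : ℕ) (Ω : TopologicalSpace.Opens (EuclideanSpace ℝ (Fin n))) : Type :=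
  Fin n → Fin n → Fin m → Fin m →
    Lp ℂ ∞ (volume.restrict (Ω : Set (EuclideanSpace ℝ (Fin n))))

/-- `(A Du)_j^α = ∑_{k,β} a_{j,k}^{α,β} ∂_k u_β`. -/
def flux (A : Coeff m Ω) (u : VecL2 m Ω) (j : Fin n) (α : Fin m)
    (x : EuclideanSpace ℝ (Fin n)) : ℂ :=
  ∑ k, ∑ β, A j k α β x * weakGrad u k x β

/-- For `u ∈ H¹(Ω)ᵐ` and `f ∈ L²(Ω)ᵐ`: `Lu = f` in the sense of distributions on `Ω`, where
`(Lu)_α = -∑_j ∂_j (∑_{k,β} a_{j,k}^{α,β} ∂_k u_β)`. -/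
def IsDivForm (A : Coeff m Ω) (u f : VecL2 m Ω) : Prop :=
  ∀ (φ : 𝓓(Ω, ℝ)) (α : Fin m),
    ∑ j, ∫ x in (Ω : Set (EuclideanSpace ℝ (Fin n))), pderiv j φ x • flux A u j α x =
      ∫ x in (Ω : Set (EuclideanSpace ℝ (Fin n))), φ x • f x α

lemma memLp_coord (u : VecL2 m Ω) (α : Fin m) :
    MemLp (fun x => u x α) 2 (volume.restrict (Ω : Set (EuclideanSpace ℝ (Fin n)))) :=
  (Lp.memLp u).mono ((EuclideanSpace.proj (𝕜 := ℂ) α).continuous.comp_aestronglyMeasurable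
    (Lp.aestronglyMeasurable u)) (.of_forall fun _ => PiLp.norm_apply_le _ _)

lemma memLp_flux (A : Coeff m Ω) (u : VecL2 m Ω) (j : Fin n) (α : Fin m) :
    MemLp (flux A u j α) 2 (volume.restrict (Ω : Set (EuclideanSpace ℝ (Fin n)))) :=
  memLp_finsetSum _ fun k _ => memLp_finsetSum _ fun β _ =>
    (memLp_coord (weakGrad u k) β).mul (Lp.memLp (A j k α β))

lemma flux_add (A : Coeff m Ω) {u v : VecL2 m Ω} (hu : u ∈ H1 m Ω) (hv : v ∈ H1 m Ω) (j : Fin n)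
    (α : Fin m) : flux A (u + v) j α
      =ᵐ[volume.restrict (Ω : Set (EuclideanSpace ℝ (Fin n)))]
        fun x => flux A u j α x + flux A v j α x := by
  have h : ∀ᵐ x ∂(volume.restrict (Ω : Set (EuclideanSpace ℝ (Fin n)))), ∀ k,
      weakGrad (u + v) k x = weakGrad u k x + weakGrad v k x := by
    rw [ae_all_iff]
    intro k
    rw [weakGrad_add hu hv]
    exact Lp.coeFn_add _ _
  filter_upwards [h] with x hx
  simp [flux, hx, mul_add, Finset.sum_add_distrib]

lemma flux_smul (A : Coeff m Ω) {u : VecL2 m Ω} (c : ℂ) (hu : u ∈ H1 m Ω) (j : Fin n)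
    (α : Fin m) : flux A (c • u) j α
      =ᵐ[volume.restrict (Ω : Set (EuclideanSpace ℝ (Fin n)))]
        fun x => c • flux A u j α x := by
  have h : ∀ᵐ x ∂(volume.restrict (Ω : Set (EuclideanSpace ℝ (Fin n)))), ∀ k,
      weakGrad (c • u) k x = c • weakGrad u k x := by
    rw [ae_all_iff]
    intro k
    rw [weakGrad_smul c hu]
    exact Lp.coeFn_smul _ _
  filter_upwards [h] with x hx
  simp [flux, hx, mul_left_comm, Finset.mul_sum]

lemma IsDivForm.add {A : Coeff m Ω} {u v f g : VecL2 m Ω} (hu : u ∈ H1 m Ω) (hv : v ∈ H1 m Ω)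
    (hf : IsDivForm A u f) (hg : IsDivForm A v g) : IsDivForm A (u + v) (f + g) := by
  intro φ α
  have h1 : ∀ j, ∫ x in (Ω : Set (EuclideanSpace ℝ (Fin n))),
        pderiv j φ x • flux A (u + v) j α x =
      (∫ x in (Ω : Set (EuclideanSpace ℝ (Fin n))), pderiv j φ x • flux A u j α x) +
      ∫ x in (Ω : Set (EuclideanSpace ℝ (Fin n))), pderiv j φ x • flux A v j α x := by
    intro j
    rw [← integral_add
      (integrable_smul_of_memLp (memLp_flux A u j α) (continuous_pderiv j φ)
        (hasCompactSupport_pderiv j φ))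
      (integrable_smul_of_memLp (memLp_flux A v j α) (continuous_pderiv j φ)
        (hasCompactSupport_pderiv j φ))]
    refine integral_congr_ae ?_
    filter_upwards [flux_add A hu hv j α] with x hx
    rw [hx, smul_add]
  have h2 : ∫ x in (Ω : Set (EuclideanSpace ℝ (Fin n))), φ x • (f + g : VecL2 m Ω) x α =
      (∫ x in (Ω : Set (EuclideanSpace ℝ (Fin n))), φ x • f x α) +
      ∫ x in (Ω : Set (EuclideanSpace ℝ (Fin n))), φ x • g x α := by
    rw [← integral_add
      (integrable_smul_of_memLp (memLp_coord f α) φ.contDiff.continuous φ.hasCompactSupport)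
      (integrable_smul_of_memLp (memLp_coord g α) φ.contDiff.continuous φ.hasCompactSupport)]
    refine integral_congr_ae ?_
    filter_upwards [Lp.coeFn_add f g] with x hx
    rw [hx, Pi.add_apply, PiLp.add_apply, smul_add]
  simp_rw [h1]
  rw [Finset.sum_add_distrib, h2, hf φ α, hg φ α]

lemma IsDivForm.smul {A : Coeff m Ω} {u f : VecL2 m Ω} (c : ℂ) (hu : u ∈ H1 m Ω)
    (hf : IsDivForm A u f) : IsDivForm A (c • u) (c • f) := by
  intro φ α
  have h1 : ∀ j, ∫ x in (Ω : Set (EuclideanSpace ℝ (Fin n))),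
        pderiv j φ x • flux A (c • u) j α x =
      c • ∫ x in (Ω : Set (EuclideanSpace ℝ (Fin n))), pderiv j φ x • flux A u j α x := by
    intro j
    rw [← integral_smul]
    refine integral_congr_ae ?_
    filter_upwards [flux_smul A c hu j α] with x hx
    rw [hx, smul_comm]
  have h2 : ∫ x in (Ω : Set (EuclideanSpace ℝ (Fin n))), φ x • (c • f : VecL2 m Ω) x α =
      c • ∫ x in (Ω : Set (EuclideanSpace ℝ (Fin n))), φ x • f x α := by
    rw [← integral_smul]
    refine integral_congr_ae ?_
    filter_upwards [Lp.coeFn_smul c f] with x hx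
    simp [hx, mul_left_comm]
  simp_rw [h1]
  rw [← Finset.smul_sum, h2, hf φ α]

lemma IsDivForm.zero {A : Coeff m Ω} : IsDivForm A 0 0 := by
  intro φ α
  have h := Lp.coeFn_zero (EuclideanSpace ℂ (Fin m)) 2
    (volume.restrict (Ω : Set (EuclideanSpace ℝ (Fin n))))
  rw [Finset.sum_eq_zero, eq_comm]
  · refine integral_eq_zero_of_ae ?_
    filter_upwards [h] with x hx
    rw [hx]
    simp
  · intro j _
    refine integral_eq_zero_of_ae ?_
    filter_upwards [h] with x hx
    simp only [flux, weakGrad_zero, Pi.zero_apply (M := fun _ : Fin n => VecL2 m Ω), hx]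
    simp

lemma IsDivForm.unique {A : Coeff m Ω} {u f g : VecL2 m Ω} (hf : IsDivForm A u f)
    (hg : IsDivForm A u g) : f = g := by
  have h : ∀ᵐ x ∂(volume.restrict (Ω : Set (EuclideanSpace ℝ (Fin n)))), ∀ α,
      f x α - g x α = 0 := by
    rw [ae_all_iff]
    intro α
    refine ae_eq_zero_of_test ((memLp_coord f α).sub (memLp_coord g α)) fun φ => ?_
    have h1 := integral_sub
      (integrable_smul_of_memLp (memLp_coord f α) φ.contDiff.continuous φ.hasCompactSupport)
      (integrable_smul_of_memLp (memLp_coord g α) φ.contDiff.continuous φ.hasCompactSupport)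
    rw [← hf φ α, ← hg φ α, sub_self] at h1
    simpa only [Pi.sub_apply, smul_sub] using h1
  refine Lp.ext ?_
  filter_upwards [h] with x hx
  ext α
  exact sub_eq_zero.mp (hx α)

/-- The graph `{(u, Lu) | u ∈ H¹₀(Ω)ᵐ, Lu ∈ L²(Ω)ᵐ}`. -/
def dirichletGraph (A : Coeff m Ω) : Submodule ℂ (VecL2 m Ω × VecL2 m Ω) where
  carrier := {p | p.1 ∈ H10 m Ω ∧ IsDivForm A p.1 p.2}
  add_mem' := fun hp hq => ⟨add_mem hp.1 hq.1, hp.2.add hp.1.1 hq.1.1 hq.2⟩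
  zero_mem' := ⟨zero_mem _, IsDivForm.zero⟩
  smul_mem' := fun c _ hp => ⟨Submodule.smul_mem _ c hp.1, hp.2.smul c hp.1.1⟩

/-- The Dirichlet realization `L_{D,Ω}` of `L` in `L²(Ω)ᵐ`:
`dom L_{D,Ω} = {u ∈ H¹₀(Ω)ᵐ | Lu ∈ L²(Ω)ᵐ}` and `L_{D,Ω} u = Lu`. -/
def dirichletRealization (A : Coeff m Ω) : VecL2 m Ω →ₗ.[ℂ] VecL2 m Ω :=
  (dirichletGraph A).toLinearPMap

lemma mem_graph_dirichletRealization (A : Coeff m Ω) (u f : VecL2 m Ω) :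
    (u, f) ∈ (dirichletRealization A).graph ↔ u ∈ H10 m Ω ∧ IsDivForm A u f := by
  rw [dirichletRealization, Submodule.toLinearPMap_graph_eq]
  · rfl
  · rintro ⟨v, g⟩ ⟨-, hg⟩ (rfl : v = 0)
    exact hg.unique IsDivForm.zero

/-- The sesquilinear form `(u, v) ↦ ∫_Ω ⟨conj (Du), A Dv⟩`, antilinear in the first argument. -/
def dirichletForm (A : Coeff m Ω) (u v : VecL2 m Ω) : ℂ :=
  ∫ x in (Ω : Set (EuclideanSpace ℝ (Fin n))),
    ∑ j, ∑ k, ∑ α, ∑ β,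
      A j k α β x * weakGrad v k x β * (starRingEnd ℂ) (weakGrad u j x α)

/-- The strong Legendre ellipticity condition with constant `a₀`. -/
def StrongLegendre (A : Coeff m Ω) (a₀ : ℝ) : Prop :=
  ∀ᵐ x ∂(volume.restrict (Ω : Set (EuclideanSpace ℝ (Fin n)))), ∀ ζ : Fin n → Fin m → ℂ,
    a₀ * ∑ j, ∑ α, ‖ζ j α‖ ^ 2 ≤
      (∑ j, ∑ k, ∑ α, ∑ β, A j k α β x * ζ k β * (starRingEnd ℂ) (ζ j α)).re

/-- The symmetry condition `a_{j,k}^{α,β} = conj (a_{k,j}^{β,α})`. -/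
def SymmetricCoeff (A : Coeff m Ω) : Prop :=
  ∀ᵐ x ∂(volume.restrict (Ω : Set (EuclideanSpace ℝ (Fin n)))), ∀ j k α β,
    A j k α β x = (starRingEnd ℂ) (A k j β α x)

end System

/-! ### Unbounded operators and forms in a complex Hilbert space -/

section Operators

variable {H : Type*} [NormedAddCommGroup H] [InnerProductSpace ℂ H]

/-- `T ≥ c I` for some `c > 0`. -/
def IsStrictlyPositive (T : H →ₗ.[ℂ] H) : Prop :=
  ∃ c : ℝ, 0 < c ∧ ∀ u : T.domain, c * ‖(u : H)‖ ^ 2 ≤ (⟪(u : H), T u⟫_ℂ).re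

/-- `S` is the nonnegative self-adjoint square root `T^{1/2}` of `T`: it is self-adjoint,
nonnegative, and `S² = T` (including equality of the domains). -/
structure IsSqrt [CompleteSpace H] (S T : H →ₗ.[ℂ] H) : Prop where
  isSelfAdjoint : IsSelfAdjoint S
  nonneg : ∀ u : S.domain, 0 ≤ (⟪(u : H), S u⟫_ℂ).re
  sq_eq : ∀ u f : H, (u, f) ∈ T.graph ↔ ∃ w, (u, w) ∈ S.graph ∧ (w, f) ∈ S.graph

/-- The resolvent set: all `z` such that `T - z` is a bijection of `dom T` onto `H` with bounded
inverse `R`. -/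
def resolventSet (T : H →ₗ.[ℂ] H) : Set ℂ :=
  {z | ∃ R : H →L[ℂ] H, (∀ f, ∃ h : R f ∈ T.domain, T ⟨R f, h⟩ - z • R f = f) ∧
    ∀ u : T.domain, R (T u - z • (u : H)) = u}

/-- The spectrum. -/
def spectrum (T : H →ₗ.[ℂ] H) : Set ℂ := (resolventSet T)ᶜ

/-- The eigenspace `ker (T - z)`. -/
def eigenspace (T : H →ₗ.[ℂ] H) (z : ℂ) : Submodule ℂ T.domain :=
  LinearMap.ker (T.toFun - z • T.domain.subtype)

/-- The discrete spectrum of a self-adjoint operator: the isolated points of the spectrum that are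
eigenvalues of finite multiplicity. -/
def discreteSpectrum (T : H →ₗ.[ℂ] H) : Set ℂ :=
  {z | z ∈ spectrum T ∧ (∃ ε > 0, ∀ w ∈ spectrum T, dist w z < ε → w = z) ∧
    eigenspace T z ≠ ⊥ ∧ FiniteDimensional ℂ (eigenspace T z)}

/-- The essential spectrum of a self-adjoint operator. -/
def essentialSpectrum (T : H →ₗ.[ℂ] H) : Set ℂ := spectrum T \ discreteSpectrum T

/-- `b`, restricted to `V × V`, is antilinear in the first and linear in the second argument. -/
structure IsSesquilinearOn (V : Submodule ℂ H) (b : H → H → ℂ) : Prop where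
  add_left : ∀ u ∈ V, ∀ v ∈ V, ∀ w ∈ V, b (u + v) w = b u w + b v w
  smul_left : ∀ (c : ℂ), ∀ u ∈ V, ∀ v ∈ V, b (c • u) v = (starRingEnd ℂ) c * b u v
  add_right : ∀ u ∈ V, ∀ v ∈ V, ∀ w ∈ V, b u (v + w) = b u v + b u w
  smul_right : ∀ (c : ℂ), ∀ u ∈ V, ∀ v ∈ V, b u (c • v) = c * b u v

/-- `‖u‖²` for the norm `b(u,u) + (1 - c) ‖u‖²` of a form bounded from below by `c`. -/
def formNormSq (b : H → H → ℂ) (c : ℝ) (u : H) : ℝ := (b u u).re + (1 - c) * ‖u‖ ^ 2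

/-- `b` with domain `V` is a densely defined, symmetric, closed sesquilinear form in `H`, bounded
from below by `c`. -/
structure IsClosedFormBddBelow (V : Submodule ℂ H) (b : H → H → ℂ) (c : ℝ) : Prop where
  sesquilinear : IsSesquilinearOn V b
  dense : Dense (V : Set H)
  symmetric : ∀ u ∈ V, ∀ v ∈ V, b u v = (starRingEnd ℂ) (b v u)
  bddBelow : ∀ u ∈ V, c * ‖u‖ ^ 2 ≤ (b u u).re
  closed : ∀ s : ℕ → H, (∀ k, s k ∈ V) →
    (∀ ε > 0, ∃ N, ∀ k ≥ N, ∀ l ≥ N, formNormSq b c (s k - s l) < ε) →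
    ∃ u ∈ V, Tendsto (fun k => formNormSq b c (s k - u)) atTop (𝓝 0)

/-- `T` is the operator associated with the form `b` with domain `V`:
`dom T = {v ∈ V | ∃ f, ∀ w ∈ V, b(w,v) = (w,f)}`, `T v = f`. -/
def IsAssociatedOperator (V : Submodule ℂ H) (b : H → H → ℂ) (T : H →ₗ.[ℂ] H) : Prop :=
  ∀ v f : H, (v, f) ∈ T.graph ↔ v ∈ V ∧ ∀ w ∈ V, b w v = ⟪w, f⟫_ℂ

end Operators

end DivForm

end

/-! Everything is read off one bounded operator. Ellipticity and the Poincaré inequality make the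
Dirichlet form a scalar product on V = H¹₀(Ω)ᵐ that dominates a multiple of the L² scalar product,
and closedness makes V a Hilbert space. Let J : V → L² be the inclusion. The weak equation for v
with right-hand side f says ⟨w, v⟩_V = ⟨Jw, f⟩ for all w, that is, v = J*f. So the realization is
the inverse of the positive injective operator G = JJ* (`CoerciveForm.isInverseOf`, with
`isDivForm_iff` passing from the distributional to the weak equation).

The inverse of an injective bounded symmetric operator is self-adjoint, and since J is injective, J*
has dense range in V, which is density of the operator domain in the form norm. The inverse of a
nonnegative square root of the realization is a positive square root of G, hence equals G^{1/2};
this gives uniqueness. The identity ‖G^{1/2} f‖ = ‖J* f‖ forces G^{1/2} and J to have the same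
range, which is H¹₀ (`range_sqrt`). Finally J is compact by Rellich
(`isCompactOperator_of_gradNormSq_le`), so G is compact and the spectrum consists of reciprocals of
its eigenvalues.

Both Poincaré and Rellich rest on the translation estimate `lintegral_translate_sub_sq_le` for test
functions, extended to H¹₀ by closure. They need only that Ω is bounded.

The Lipschitz charts enter only in the identification of H¹₀ with the kernel of the trace
(`hasTrace_zero_iff`). Integrating along vertical segments from the boundary bounds the L² mass of a
smooth φ in a strip of width δ by δ times its boundary mass plus δ² times the gradient mass in a
comparable strip. This compensates the gradient of size 1/δ of a cutoff function, so approximants of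
u whose boundary values tend to zero can be cut off at a cost that vanishes in H¹. -/

namespace DivForm

/-! ### Unbounded inverses of bounded symmetric operators. -/

section InverseOperator

variable {H : Type*} [NormedAddCommGroup H] [InnerProductSpace ℂ H]

lemma dense_of_forall_inner_eq_zero [CompleteSpace H] (V : Submodule ℂ H)
    (h : ∀ x, (∀ v ∈ V, ⟪v, x⟫_ℂ = 0) → x = 0) : Dense (V : Set H) := by
  rw [Submodule.dense_iff_topologicalClosure_eq_top, Submodule.topologicalClosure_eq_top_iff,
    Submodule.eq_bot_iff]
  exact fun x hx => h x fun v hv => hx v hv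

/-- The orthogonal complement of the range of a symmetric operator is its kernel. -/
lemma denseRange_of_isSymmetric [CompleteSpace H] {G : H →L[ℂ] H} (hG : G.IsSymmetric)
    (hinj : Function.Injective G) : DenseRange G := by
  refine dense_of_forall_inner_eq_zero (LinearMap.range (G : H →ₗ[ℂ] H)) fun x hx => ?_
  refine hinj ((ext_inner_left ℂ fun v => ?_).trans (map_zero G).symm)
  rw [inner_zero_right]
  exact (hG v x).symm.trans (hx _ ⟨v, rfl⟩)

/-- `T` is the (unbounded) inverse `G⁻¹` of the bounded operator `G`. -/
def IsInverseOf (T : H →ₗ.[ℂ] H) (G : H →L[ℂ] H) : Prop :=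
  ∀ u f : H, (u, f) ∈ T.graph ↔ G f = u

namespace IsInverseOf

variable {T : H →ₗ.[ℂ] H} {G : H →L[ℂ] H}

lemma mem_domain (h : IsInverseOf T G) (f : H) : G f ∈ T.domain :=
  LinearPMap.mem_domain_of_mem_graph ((h _ f).2 rfl)

lemma apply_eq (h : IsInverseOf T G) (u : T.domain) : G (T u) = u :=
  (h _ _).1 (T.mem_graph u)

lemma injective (h : IsInverseOf T G) : Function.Injective G := by
  rw [injective_iff_map_eq_zero]
  intro f hf
  exact T.graph_fst_eq_zero_snd ((h 0 f).2 hf) rfl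

lemma apply_mk (h : IsInverseOf T G) (f : H) (hf : G f ∈ T.domain) : T ⟨G f, hf⟩ = f :=
  h.injective (h.apply_eq ⟨G f, hf⟩)

lemma mem_domain_iff (h : IsInverseOf T G) {u : H} : u ∈ T.domain ↔ ∃ f, G f = u :=
  ⟨fun hu => ⟨_, h.apply_eq ⟨u, hu⟩⟩, by rintro ⟨f, rfl⟩; exact h.mem_domain f⟩

lemma unique {T' : H →ₗ.[ℂ] H} (h : IsInverseOf T G) (h' : IsInverseOf T' G) : T = T' := by
  refine LinearPMap.eq_of_eq_graph (Submodule.ext ?_)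
  rintro ⟨u, f⟩
  rw [h, h']

/-- The flipped graph of G is single-valued exactly when G is injective. -/
lemma exists_of_injective (hG : Function.Injective G) : ∃ T : H →ₗ.[ℂ] H, IsInverseOf T G := by
  let g : Submodule ℂ (H × H) := LinearMap.range ((G : H →ₗ[ℂ] H).prod LinearMap.id)
  refine ⟨g.toLinearPMap, fun u f => ?_⟩
  rw [Submodule.toLinearPMap_graph_eq]
  · simp [g]
  · rintro ⟨u, f⟩ ⟨x, hx⟩ h0
    obtain ⟨rfl, rfl⟩ : G x = u ∧ x = f := by simpa using hx
    exact hG (by simpa using h0)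

variable [CompleteSpace H]

lemma dense_domain (h : IsInverseOf T G) (hG : G.IsSymmetric) : Dense (T.domain : Set H) := by
  have h1 : (T.domain : Set H) = Set.range G := Set.ext fun u => h.mem_domain_iff
  rw [h1]
  exact denseRange_of_isSymmetric hG h.injective

/-- A pair (y, z) lies in the adjoint graph when ⟨b, y⟩ = ⟨G b, z⟩ for all b. By symmetry of G this
says y = G z, which is the graph of T itself. -/
lemma isSelfAdjoint (h : IsInverseOf T G) (hG : G.IsSymmetric) : IsSelfAdjoint T := by
  rw [LinearPMap.isSelfAdjoint_def]
  refine LinearPMap.eq_of_eq_graph (Submodule.ext ?_)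
  rintro ⟨y, z⟩
  rw [LinearPMap.adjoint_graph_eq_graph_adjoint (h.dense_domain hG), Submodule.mem_adjoint_iff, h]
  constructor
  · intro hyz
    refine ext_inner_left ℂ fun b => ?_
    have := hyz (G b) b ((h _ _).2 rfl)
    rw [sub_eq_zero] at this
    exact (hG b z).symm.trans this.symm
  · rintro rfl a b hab
    rw [← (h a b).1 hab, sub_eq_zero]
    exact (hG b z).symm

end IsInverseOf

/-- A bijective self-adjoint operator has a bounded self-adjoint inverse. -/
lemma exists_isInverseOf_of_isSelfAdjoint [CompleteSpace H] {S : H →ₗ.[ℂ] H} (hS : IsSelfAdjoint S)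
    (hinj : ∀ u, (u, 0) ∈ S.graph → u = 0) (hsurj : ∀ f, ∃ u, (u, f) ∈ S.graph) :
    ∃ P : H →L[ℂ] H, P.IsSymmetric ∧ IsInverseOf S P := by
  choose p hp using hsurj
  have huniq : ∀ u v f, (u, f) ∈ S.graph → (v, f) ∈ S.graph → u = v := fun u v f hu hv =>
    sub_eq_zero.1 (hinj _ (by simpa using S.graph.sub_mem hu hv))
  let P : H →ₗ[ℂ] H :=
    { toFun := p
      map_add' := fun f g => huniq _ _ _ (hp _) (S.graph.add_mem (hp f) (hp g))
      map_smul' := fun c f => huniq _ _ _ (hp _) (S.graph.smul_mem c (hp f)) }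
  have hsym : P.IsSymmetric := by
    intro f g
    have h1 := hp f
    rw [← (LinearPMap.isSelfAdjoint_def.1 hS),
      LinearPMap.adjoint_graph_eq_graph_adjoint hS.dense_domain, Submodule.mem_adjoint_iff] at h1
    have h2 := sub_eq_zero.1 (h1 _ _ (hp g))
    simp only at h2
    have h3 := congrArg (starRingEnd ℂ) h2
    rwa [inner_conj_symm, inner_conj_symm] at h3
  -- Hellinger–Toeplitz: a symmetric operator defined on the whole Hilbert space is bounded.
  refine ⟨⟨P, hsym.continuous⟩, hsym, fun u f => ⟨fun h => huniq _ _ _ (hp f) h, ?_⟩⟩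
  rintro rfl
  exact hp f

/-! ### Spectrum of the inverse of a compact operator. -/

section Spectrum

open Module

variable {T : H →ₗ.[ℂ] H} {G : H →L[ℂ] H} [CompleteSpace H]

/-- For z = 0 the resolvent is G. For z ≠ 0 the identity (T - z) G = z (z⁻¹ - G) turns an inverse U
of z⁻¹ - G into the resolvent z⁻¹ G U of T, and the Fredholm alternative leaves an eigenvalue as the
only obstruction to U. -/
lemma IsInverseOf.hasEigenvalue_of_mem_spectrum (h : IsInverseOf T G) (hG : IsCompactOperator G)
    {z : ℂ} (hz : z ∈ spectrum T) : z ≠ 0 ∧ End.HasEigenvalue (G : End ℂ H) z⁻¹ := by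
  have hz0 : z ≠ 0 := by
    rintro rfl
    refine hz ⟨G, fun f => ⟨h.mem_domain f, ?_⟩, fun u => ?_⟩
    · rw [h.apply_mk, zero_smul, sub_zero]
    · rw [zero_smul, sub_zero, h.apply_eq]
  refine ⟨hz0, (hG.hasEigenvalue_or_mem_resolventSet (inv_ne_zero hz0)).resolve_right fun hr => ?_⟩
  rw [_root_.spectrum.mem_resolventSet_iff] at hr
  obtain ⟨⟨A, U, hAU, hUA⟩, rfl : A = _⟩ := hr
  have hAU' : ∀ f, z⁻¹ • U f - G (U f) = f := fun f => by
    simpa [Algebra.algebraMap_eq_smul_one] using DFunLike.congr_fun hAU f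
  have hUA' : ∀ f, U (z⁻¹ • f - G f) = f := fun f => by
    simpa [Algebra.algebraMap_eq_smul_one] using DFunLike.congr_fun hUA f
  refine hz ⟨G ∘L (z⁻¹ • U), fun f => ⟨h.mem_domain _, ?_⟩, fun u => ?_⟩
  · simp only [ContinuousLinearMap.comp_apply]
    rw [h.apply_mk]
    simp only [_root_.smul_apply, map_smul, smul_inv_smul₀ hz0]
    exact hAU' f
  · obtain ⟨f, hf⟩ := h.mem_domain_iff.1 u.2
    obtain rfl : u = ⟨G f, h.mem_domain f⟩ := Subtype.ext hf.symm
    rw [h.apply_mk]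
    simp only [ContinuousLinearMap.comp_apply, _root_.smul_apply, ← map_smul U]
    rw [smul_sub, inv_smul_smul₀ hz0, hUA']

-- Pairing the eigenvector equation with x gives z⁻¹ ‖x‖² = ⟨x, G x⟩ ≥ 0. Injectivity excludes z⁻¹ =
-- 0, so z⁻¹ and with it z is a positive real number.
open scoped ComplexOrder in
omit [CompleteSpace H] in
lemma re_pos_of_hasEigenvalue_inv (hG : G.IsPositive) (hinj : Function.Injective G) {z : ℂ}
    (hz : End.HasEigenvalue (G : End ℂ H) z⁻¹) : 0 < z.re ∧ z.im = 0 := by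
  obtain ⟨x, hx⟩ := hz.exists_hasEigenvector
  have hGx : G x = z⁻¹ • x := hx.apply_eq_smul
  have hz0 : z⁻¹ ≠ 0 := by
    intro h0
    rw [h0, zero_smul] at hGx
    exact hx.2 (hinj (hGx.trans (map_zero G).symm))
  have h1 := hG.inner_nonneg_right x
  rw [hGx, inner_smul_right, inner_self_eq_norm_sq_to_K] at h1
  have hx0 : 0 < ‖x‖ ^ 2 := by have := norm_pos_iff.2 hx.2; positivity
  have h2 : 0 ≤ z⁻¹ * ((‖x‖ ^ 2 : ℝ) : ℂ) := by push_cast; exact h1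
  rw [Complex.nonneg_iff, Complex.re_mul_ofReal, Complex.im_mul_ofReal] at h2
  have him : z⁻¹.im = 0 := by
    rcases mul_eq_zero.1 h2.2.symm with h | h
    · exact h
    · exact absurd h hx0.ne'
  have hre : 0 < z⁻¹.re := by
    refine lt_of_le_of_ne (nonneg_of_mul_nonneg_left h2.1 hx0) fun h0 => hz0 ?_
    exact Complex.ext h0.symm him
  have hn : 0 < Complex.normSq z := Complex.normSq_pos.2 (by simpa using hz0)
  rw [Complex.inv_re] at hre
  rw [Complex.inv_im, div_eq_zero_iff, neg_eq_zero] at him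
  exact ⟨(div_pos_iff_of_pos_right hn).1 hre, him.resolve_right hn.ne'⟩

/-- Infinitely many spectral points of modulus at most R would give orthonormal eigenvectors whose
images under G stay at distance at least 1/R from each other, which compactness of G forbids. -/
lemma IsInverseOf.finite_spectrum_inter_closedBall (h : IsInverseOf T G) (hG : IsCompactOperator G)
    (hs : G.IsSymmetric) (R : ℝ) : (spectrum T ∩ Metric.closedBall 0 R).Finite := by
  by_contra hinf
  let w := Set.Infinite.natEmbedding _ hinf
  have hw : ∀ k, ∃ x : H, G x = (w k : ℂ)⁻¹ • x ∧ ‖x‖ = 1 := by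
    intro k
    obtain ⟨x, hx⟩ := (h.hasEigenvalue_of_mem_spectrum hG (w k).2.1).2.exists_hasEigenvector
    have hGx : G x = (w k : ℂ)⁻¹ • x := hx.apply_eq_smul
    refine ⟨((‖x‖ : ℂ)⁻¹) • x, ?_, ?_⟩
    · rw [map_smul, hGx, smul_comm]
    · simp [norm_smul, inv_mul_cancel₀ (norm_ne_zero_iff.2 hx.2)]
  choose e he hen using hw
  have hw0 : ∀ k, (w k : ℂ) ≠ 0 := fun k => (h.hasEigenvalue_of_mem_spectrum hG (w k).2.1).1
  have horth : ∀ k l, k ≠ l → ⟪e k, e l⟫_ℂ = 0 := by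
    intro k l hkl
    have hne : (w k : ℂ)⁻¹ ≠ (w l : ℂ)⁻¹ := fun hh =>
      hkl (w.injective (Subtype.ext (inv_injective hh)))
    have := hs.orthogonalFamily_eigenspaces hne
      ⟨e k, Module.End.mem_eigenspace_iff.2 (he k)⟩ ⟨e l, Module.End.mem_eigenspace_iff.2 (he l)⟩
    simpa using this
  have hR : 0 < R := by
    have h1 : ‖(w 0 : ℂ)‖ ≤ R := by simpa using (w 0).2.2
    exact (norm_pos_iff.2 (hw0 0)).trans_le h1
  have hsep : ∀ k l, k ≠ l → R⁻¹ ≤ ‖G (e k) - G (e l)‖ := by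
    intro k l hkl
    have h1 : R⁻¹ ≤ ‖(w k : ℂ)⁻¹‖ := by
      rw [norm_inv]
      exact inv_anti₀ (norm_pos_iff.2 (hw0 k)) (by simpa using (w k).2.2)
    have h2 : ⟪e k, G (e k) - G (e l)⟫_ℂ = (w k : ℂ)⁻¹ := by
      rw [he, he, inner_sub_right, inner_smul_right, inner_smul_right, horth k l hkl,
        inner_self_eq_norm_sq_to_K, hen]
      simp
    calc R⁻¹ ≤ ‖⟪e k, G (e k) - G (e l)⟫_ℂ‖ := by rw [h2]; exact h1
      _ ≤ ‖e k‖ * ‖G (e k) - G (e l)‖ := norm_inner_le_norm _ _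
      _ = _ := by rw [hen, one_mul]
  obtain ⟨K, hK, hK'⟩ := hG.image_closedBall_subset_compact (f := (G : H →ₗ[ℂ] H)) 1
  obtain ⟨y, -, ψ, hψ, hψy⟩ := hK.tendsto_subseq
    (fun k => hK' ⟨e k, by simp [hen], rfl⟩)
  obtain ⟨N, hN⟩ := Metric.cauchySeq_iff'.1 hψy.cauchySeq R⁻¹ (by positivity)
  have h1 := hN (N + 1) (by lia)
  rw [dist_eq_norm] at h1
  exact (hsep _ _ (hψ.injective.ne (by lia))).not_gt h1

/-- Isolation follows from finiteness of the spectrum in balls. The kernel of T - z is nonzero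
because an eigenvector of G for z⁻¹ lies in it, and it embeds in that eigenspace of G, which is
finite-dimensional by compactness. -/
lemma IsInverseOf.essentialSpectrum_eq_empty (h : IsInverseOf T G) (hG : IsCompactOperator G)
    (hs : G.IsSymmetric) : essentialSpectrum T = ∅ := by
  rw [essentialSpectrum, Set.sdiff_eq_empty]
  intro z hz
  obtain ⟨hz0, hev⟩ := h.hasEigenvalue_of_mem_spectrum hG hz
  refine ⟨hz, ?_, ?_, ?_⟩
  · have hfin := (h.finite_spectrum_inter_closedBall hG hs (‖z‖ + 1)).subset
      (Set.sdiff_subset (t := {z}))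
    have hnhds := hfin.isClosed.isOpen_compl.mem_nhds (x := z) (by simp)
    obtain ⟨ε, hε, hball⟩ := Metric.mem_nhds_iff.1 hnhds
    -- The bound 1 keeps w in the ball of radius ‖z‖ + 1, where the spectrum is known to be finite.
    refine ⟨min ε 1, by positivity, fun w hw hwz => ?_⟩
    by_contra hne
    refine hball (Metric.mem_ball.2 (hwz.trans_le (min_le_left _ _))) ⟨⟨hw, ?_⟩, hne⟩
    have h1 := hwz.trans_le (min_le_right _ _)
    rw [dist_eq_norm] at h1
    have := norm_sub_norm_le w z
    simp only [mem_closedBall_zero_iff]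
    linarith
  · obtain ⟨x, hx⟩ := hev.exists_hasEigenvector
    have hGx : G x = z⁻¹ • x := hx.apply_eq_smul
    have hx' : G (z • x) = x := by rw [map_smul, hGx, smul_inv_smul₀ hz0]
    rw [Submodule.ne_bot_iff]
    refine ⟨⟨G (z • x), h.mem_domain _⟩, ?_, fun h0 => hx.2 ?_⟩
    · simp only [eigenspace, LinearMap.mem_ker, LinearMap.sub_apply, LinearMap.smul_apply,
        Submodule.subtype_apply, LinearPMap.toFun_eq_coe]
      rw [h.apply_mk, hx', sub_self]
    · rw [← hx']
      exact congrArg Subtype.val h0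
  · have := ContinuousLinearMap.finite_dimensional_eigenspace hG z⁻¹ (inv_ne_zero hz0)
    have hmem : ∀ x : eigenspace T z, (T.domain.subtype ∘ₗ (eigenspace T z).subtype) x ∈
        Module.End.eigenspace G.toLinearMap z⁻¹ := by
      rintro ⟨x, hx⟩
      simp only [eigenspace, LinearMap.mem_ker, LinearMap.sub_apply, LinearMap.smul_apply,
        Submodule.subtype_apply, LinearPMap.toFun_eq_coe, sub_eq_zero] at hx
      rw [Module.End.mem_eigenspace_iff]
      have h1 := h.apply_eq x
      rw [hx, map_smul] at h1
      simp only [LinearMap.comp_apply, Submodule.subtype_apply, ContinuousLinearMap.coe_coe]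
      rw [← h1, inv_smul_smul₀ hz0, h1]
    refine FiniteDimensional.of_injective
      ((T.domain.subtype ∘ₗ (eigenspace T z).subtype).codRestrict _ hmem) ?_
    intro x y hxy
    have h1 := congrArg Subtype.val hxy
    exact Subtype.ext (Subtype.ext h1)

end Spectrum

/-! ### Square roots of unbounded operators and their domains. -/

section SquareRoot

/-- The assignment A f ↦ B f is isometric and so extends to the closure of the range of A, which is
all of F. The value at v of this extension is the required y. Exchanging the roles of A and B later
gives the two inclusions between the ranges. -/
lemma exists_apply_eq_of_norm_eq {F F' K : Type*} [NormedAddCommGroup F] [NormedSpace ℂ F]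
    [NormedAddCommGroup F'] [NormedSpace ℂ F'] [CompleteSpace F'] [NormedAddCommGroup K]
    [NormedSpace ℂ K] {A : H →L[ℂ] F} {B : H →L[ℂ] F'} {A' : F →L[ℂ] K} {B' : F' →L[ℂ] K}
    (hnorm : ∀ f, ‖B f‖ = ‖A f‖) (hA : DenseRange A) (hAB : ∀ f, A' (A f) = B' (B f)) (v : F) :
    ∃ y, B' y = A' v := by
  obtain ⟨x, hx⟩ : ∃ x : ℕ → H, Tendsto (fun k => A (x k)) atTop (𝓝 v) := by
    obtain ⟨s, hs, hlim⟩ := mem_closure_iff_seq_limit.1 (hA v)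
    choose x hx using hs
    exact ⟨x, by simpa [hx] using hlim⟩
  have hc : CauchySeq fun k => B (x k) := by
    rw [Metric.cauchySeq_iff]
    intro ε hε
    obtain ⟨N, hN⟩ := Metric.cauchySeq_iff.1 hx.cauchySeq ε hε
    refine ⟨N, fun k hk l hl => ?_⟩
    rw [dist_eq_norm, ← map_sub, hnorm, map_sub, ← dist_eq_norm]
    exact hN k hk l hl
  obtain ⟨y, hy⟩ := cauchySeq_tendsto_of_complete hc
  refine ⟨y, tendsto_nhds_unique ((B'.continuous.tendsto y).comp hy) ?_⟩
  have := (A'.continuous.tendsto v).comp hx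
  simpa [Function.comp_def, hAB] using this

variable [CompleteSpace H] {T : H →ₗ.[ℂ] H} {G : H →L[ℂ] H}

lemma sqrt_isPositive (G : H →L[ℂ] H) : (CFC.sqrt G).IsPositive :=
  ContinuousLinearMap.nonneg_iff_isPositive _ |>.1 (CFC.sqrt_nonneg G)

lemma sqrt_sqrt_apply (hG : G.IsPositive) (f : H) : CFC.sqrt G (CFC.sqrt G f) = G f :=
  DFunLike.congr_fun (CFC.sqrt_mul_sqrt_self G
    ((ContinuousLinearMap.nonneg_iff_isPositive _).2 hG)) f

lemma IsInverseOf.isSqrt (h : IsInverseOf T G) (hG : G.IsPositive) {S : H →ₗ.[ℂ] H}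
    (hS : IsInverseOf S (CFC.sqrt G)) : IsSqrt S T where
  isSelfAdjoint := hS.isSelfAdjoint (sqrt_isPositive G).isSymmetric
  nonneg u := by
    rw [← hS.apply_eq u]
    exact (sqrt_isPositive G).re_inner_nonneg_left _
  sq_eq u f := by
    simp_rw [h u f, hS _ _, ← sqrt_sqrt_apply hG]
    simp

/-- S inherits bijectivity from T: if S u = 0 then T u = 0, and f = T (G f) lies in the range of S.
Its bounded inverse is positive and squares to G, so it must be the unique positive square root of
G. -/
lemma IsInverseOf.of_isSqrt (h : IsInverseOf T G) {S : H →ₗ.[ℂ] H}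
    (hS : IsSqrt S T) : IsInverseOf S (CFC.sqrt G) := by
  obtain ⟨P, hP, hSP⟩ := exists_isInverseOf_of_isSelfAdjoint hS.isSelfAdjoint
    (fun u hu => by
      have := (hS.sq_eq u 0).2 ⟨0, hu, zero_mem _⟩
      rw [h, map_zero] at this
      exact this.symm)
    (fun f => by
      obtain ⟨w, -, hw⟩ := (hS.sq_eq (G f) f).1 ((h _ _).2 rfl)
      exact ⟨w, hw⟩)
  have hPpos : P.IsPositive := by
    refine ⟨hP, fun f => ?_⟩
    have := hS.nonneg ⟨P f, hSP.mem_domain f⟩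
    rw [hSP.apply_mk] at this
    exact this
  have hPP : P * P = G := by
    ext f
    have := (hS.sq_eq (G f) f).1 ((h _ _).2 rfl)
    simp_rw [hSP _ _] at this
    obtain ⟨w, h1, h2⟩ := this
    rw [mul_apply_eq_comp, h2, h1]
  rwa [CFC.sqrt_unique hPP ((ContinuousLinearMap.nonneg_iff_isPositive _).2 hPpos)]

lemma IsInverseOf.existsUnique_isSqrt (h : IsInverseOf T G) (hG : G.IsPositive) :
    ∃! S, IsSqrt S T := by
  have hinj : Function.Injective ⇑(CFC.sqrt G : H →L[ℂ] H) := fun x y hxy =>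
    h.injective (by rw [← sqrt_sqrt_apply hG, hxy, sqrt_sqrt_apply hG])
  obtain ⟨S, hS⟩ := IsInverseOf.exists_of_injective hinj
  exact ⟨S, h.isSqrt hG hS, fun S' hS' => (h.of_isSqrt hS').unique hS⟩

variable {E : Type*} [NormedAddCommGroup E] [InnerProductSpace ℂ E] [CompleteSpace E]

/-- Both squared norms are the quadratic form of J J* at f. -/
lemma norm_sqrt_apply (J : E →L[ℂ] H) (f : H) :
    ‖CFC.sqrt (J ∘L J.adjoint) f‖ = ‖J.adjoint f‖ := by
  have hp : (J ∘L J.adjoint).IsPositive := J.isPositive_self_comp_adjoint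
  have h1 : ⟪CFC.sqrt (J ∘L J.adjoint) f, CFC.sqrt (J ∘L J.adjoint) f⟫_ℂ =
      ⟪J.adjoint f, J.adjoint f⟫_ℂ := by
    have := (sqrt_isPositive (J ∘L J.adjoint)).isSymmetric f (CFC.sqrt (J ∘L J.adjoint) f)
    simp only [ContinuousLinearMap.coe_coe] at this
    rw [this, sqrt_sqrt_apply hp, ContinuousLinearMap.adjoint_inner_left]
    rfl
  rw [inner_self_eq_norm_sq_to_K, inner_self_eq_norm_sq_to_K] at h1
  have h2 : ‖CFC.sqrt (J ∘L J.adjoint) f‖ ^ 2 = ‖J.adjoint f‖ ^ 2 := by exact_mod_cast h1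
  exact (sq_eq_sq₀ (norm_nonneg _) (norm_nonneg _)).1 h2

/-- This is the polar decomposition of J* in disguise: f ↦ (J J*)^{1/2} f and f ↦ J* f have equal
norms and dense ranges, and applying (J J*)^{1/2} and J respectively yields the same vector J J* f.
-/
lemma range_sqrt (J : E →L[ℂ] H) (hJ : DenseRange J.adjoint)
    (hd : DenseRange ⇑(CFC.sqrt (J ∘L J.adjoint) : H →L[ℂ] H)) :
    Set.range ⇑(CFC.sqrt (J ∘L J.adjoint) : H →L[ℂ] H) = Set.range J := by
  have hp : (J ∘L J.adjoint).IsPositive := J.isPositive_self_comp_adjoint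
  ext u
  constructor
  · rintro ⟨y, rfl⟩
    exact exists_apply_eq_of_norm_eq (A := CFC.sqrt (J ∘L J.adjoint)) (B := J.adjoint)
      (fun f => (norm_sqrt_apply J f).symm) hd (fun f => sqrt_sqrt_apply hp f) y
  · rintro ⟨v, rfl⟩
    exact exists_apply_eq_of_norm_eq (A := J.adjoint) (B := CFC.sqrt (J ∘L J.adjoint))
      (norm_sqrt_apply J) hJ (fun f => (sqrt_sqrt_apply hp f).symm) v

end SquareRoot

end InverseOperator

/-! ### Coercive closed forms and their associated operators. -/

section CoerciveForms

/-- A densely defined, symmetric, closed sesquilinear form that is bounded from below by a positive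
constant. -/
structure CoerciveForm (H : Type*) [NormedAddCommGroup H] [InnerProductSpace ℂ H] where
  dom : Submodule ℂ H
  form : H → H → ℂ
  const : ℝ
  closed : IsClosedFormBddBelow dom form 0
  const_pos : 0 < const
  coercive : ∀ u ∈ dom, const * ‖u‖ ^ 2 ≤ (form u u).re

variable {H : Type*} [NormedAddCommGroup H] [InnerProductSpace ℂ H]

namespace CoerciveForm

/-- The domain of a coercive form, as a Hilbert space whose scalar product is the form. -/
def Space (F : CoerciveForm H) : Type _ := F.dom

variable (F : CoerciveForm H)

instance : AddCommGroup F.Space := inferInstanceAs (AddCommGroup F.dom)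

instance : Module ℂ F.Space := inferInstanceAs (Module ℂ F.dom)

/-- The inclusion of the form domain as a linear map. -/
def incl : F.Space →ₗ[ℂ] H := F.dom.subtype

lemma incl_mem (u : F.Space) : F.incl u ∈ F.dom := u.2

lemma incl_injective : Function.Injective F.incl := Subtype.val_injective

lemma exists_incl_eq {u : H} (hu : u ∈ F.dom) : ∃ v : F.Space, F.incl v = u := ⟨⟨u, hu⟩, rfl⟩

/-- The scalar product given by the form. -/
abbrev core : InnerProductSpace.Core ℂ F.Space where
  inner u v := F.form (F.incl u) (F.incl v)
  conj_inner_symm u v := (F.closed.symmetric _ (F.incl_mem u) _ (F.incl_mem v)).symm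
  re_inner_nonneg u := le_trans (by have := F.const_pos; positivity)
    (F.coercive _ (F.incl_mem u))
  add_left u v w := by
    rw [map_add]
    exact F.closed.sesquilinear.add_left _ (F.incl_mem u) _ (F.incl_mem v) _ (F.incl_mem w)
  smul_left u v r := by
    rw [map_smul]
    exact F.closed.sesquilinear.smul_left r _ (F.incl_mem u) _ (F.incl_mem v)
  definite u hu := by
    have h1 := F.coercive _ (F.incl_mem u)
    rw [hu, Complex.zero_re] at h1
    have h2 : ‖F.incl u‖ ^ 2 ≤ 0 := nonpos_of_mul_nonpos_right h1 F.const_pos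
    have h3 : F.incl u = 0 := by
      rw [← norm_eq_zero]
      exact pow_eq_zero_iff (two_ne_zero) |>.1 (le_antisymm h2 (sq_nonneg _))
    exact F.incl_injective (h3.trans (map_zero _).symm)

noncomputable instance : NormedAddCommGroup F.Space :=
  @InnerProductSpace.Core.toNormedAddCommGroup ℂ F.Space _ _ _ F.core

noncomputable instance : InnerProductSpace ℂ F.Space := InnerProductSpace.ofCore F.core.toCore

lemma inner_eq (u v : F.Space) : ⟪u, v⟫_ℂ = F.form (F.incl u) (F.incl v) := rfl

lemma norm_sq_eq (u : F.Space) : ‖u‖ ^ 2 = (F.form (F.incl u) (F.incl u)).re := by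
  rw [← F.inner_eq, inner_self_eq_norm_sq_to_K]
  norm_cast

lemma norm_incl_sq_le (u : F.Space) : F.const * ‖F.incl u‖ ^ 2 ≤ ‖u‖ ^ 2 := by
  rw [F.norm_sq_eq]
  exact F.coercive _ (F.incl_mem u)

lemma formNormSq_incl (u : F.Space) :
    formNormSq F.form 0 (F.incl u) = ‖u‖ ^ 2 + ‖F.incl u‖ ^ 2 := by
  rw [formNormSq, F.norm_sq_eq]
  ring

/-- Coercivity lets the Hilbert norm of the form absorb the additional term ‖u‖² in the form norm
for the lower bound 0; the two norms are therefore equivalent. -/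
lemma formNormSq_incl_le (u : F.Space) :
    formNormSq F.form 0 (F.incl u) ≤ (1 + F.const⁻¹) * ‖u‖ ^ 2 := by
  have h1 : ‖F.incl u‖ ^ 2 ≤ F.const⁻¹ * ‖u‖ ^ 2 := by
    rw [← div_eq_inv_mul, le_div_iff₀' F.const_pos]
    exact F.norm_incl_sq_le u
  rw [F.formNormSq_incl]
  linarith

/-- The inclusion of the form domain as a bounded operator. -/
noncomputable def embed : F.Space →L[ℂ] H :=
  F.incl.mkContinuous (Real.sqrt F.const⁻¹) fun u => by
    rw [← abs_norm u, ← Real.sqrt_sq_eq_abs, ← Real.sqrt_mul (inv_nonneg.2 F.const_pos.le)]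
    refine Real.le_sqrt_of_sq_le ?_
    rw [← div_eq_inv_mul, le_div_iff₀' F.const_pos]
    exact F.norm_incl_sq_le u

lemma embed_apply (u : F.Space) : F.embed u = F.incl u := rfl

lemma range_embed : Set.range F.embed = F.dom :=
  Set.ext fun u => ⟨by rintro ⟨v, rfl⟩; exact F.incl_mem v, fun hu => F.exists_incl_eq hu⟩

/-- Closedness is a statement about the form norm, so it transfers through the equivalence of that
norm with the norm of the space. -/
instance : CompleteSpace F.Space := by
  refine Metric.complete_of_cauchySeq_tendsto fun s hs => ?_
  have hK : 0 < 1 + F.const⁻¹ := by have := F.const_pos; positivity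
  obtain ⟨u, hu, hlim⟩ := F.closed.closed (fun k => F.incl (s k)) (fun k => F.incl_mem _) (by
    intro ε hε
    obtain ⟨N, hN⟩ := Metric.cauchySeq_iff.1 hs (Real.sqrt (ε / (1 + F.const⁻¹))) (by positivity)
    refine ⟨N, fun k hk l hl => ?_⟩
    have h1 := hN k hk l hl
    rw [dist_eq_norm, Real.lt_sqrt (norm_nonneg _), lt_div_iff₀' hK] at h1
    rw [← map_sub]
    exact (F.formNormSq_incl_le _).trans_lt h1)
  obtain ⟨v, rfl⟩ := F.exists_incl_eq hu
  refine ⟨v, tendsto_iff_norm_sub_tendsto_zero.2 ?_⟩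
  have h1 : Tendsto (fun k => ‖s k - v‖ ^ 2) atTop (𝓝 0) := by
    refine squeeze_zero (fun _ => sq_nonneg _) (fun k => ?_) hlim
    rw [← map_sub, F.formNormSq_incl]
    exact le_add_of_nonneg_right (sq_nonneg _)
  have h2 := h1.sqrt
  simpa [Real.sqrt_sq] using h2

variable [CompleteSpace H] {T : H →ₗ.[ℂ] H}

/-- The weak equation is the defining property of the adjoint of the inclusion: its solution for the
right-hand side f is `F.embed.adjoint f`. -/
lemma isInverseOf (hT : IsAssociatedOperator F.dom F.form T) :
    IsInverseOf T (F.embed ∘L F.embed.adjoint) := by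
  intro v f
  rw [hT]
  constructor
  · rintro ⟨hv, hf⟩
    obtain ⟨v, rfl⟩ := F.exists_incl_eq hv
    have h1 : F.embed.adjoint f = v := by
      refine ext_inner_left ℂ fun w => ?_
      rw [ContinuousLinearMap.adjoint_inner_right, F.inner_eq]
      exact (hf _ (F.incl_mem w)).symm
    rw [ContinuousLinearMap.comp_apply, h1]
    rfl
  · rintro rfl
    refine ⟨F.incl_mem _, fun w hw => ?_⟩
    obtain ⟨w, rfl⟩ := F.exists_incl_eq hw
    exact (F.inner_eq _ _).symm.trans (F.embed.adjoint_inner_right w f)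

/-- A vector orthogonal to the range of the adjoint is killed by the inclusion, which is injective.
-/
lemma denseRange_adjoint_embed : DenseRange F.embed.adjoint := by
  refine dense_of_forall_inner_eq_zero
    (LinearMap.range (F.embed.adjoint : H →ₗ[ℂ] F.Space)) fun x hx => F.incl_injective ?_
  rw [map_zero, ← F.embed_apply, ← inner_self_eq_zero (𝕜 := ℂ),
    ← ContinuousLinearMap.adjoint_inner_left]
  exact hx _ ⟨_, rfl⟩

lemma isPositive : (F.embed ∘L F.embed.adjoint).IsPositive := F.embed.isPositive_self_comp_adjoint

lemma dense_domain_formNorm (hT : IsAssociatedOperator F.dom F.form T) {u : H} (hu : u ∈ F.dom)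
    {ε : ℝ} (hε : 0 < ε) : ∃ v ∈ T.domain, formNormSq F.form 0 (u - v) < ε := by
  have hK : 0 < 1 + F.const⁻¹ := by have := F.const_pos; positivity
  obtain ⟨u, rfl⟩ := F.exists_incl_eq hu
  obtain ⟨f, hf⟩ := F.denseRange_adjoint_embed.exists_dist_lt u
    (ε := Real.sqrt (ε / (1 + F.const⁻¹))) (by positivity)
  refine ⟨F.incl (F.embed.adjoint f), (F.isInverseOf hT).mem_domain f, ?_⟩
  rw [dist_eq_norm, Real.lt_sqrt (norm_nonneg _), lt_div_iff₀' hK] at hf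
  rw [← map_sub]
  exact (F.formNormSq_incl_le _).trans_lt hf

lemma isSelfAdjoint (hT : IsAssociatedOperator F.dom F.form T) : IsSelfAdjoint T :=
  (F.isInverseOf hT).isSelfAdjoint F.isPositive.isSymmetric

omit [CompleteSpace H] in
lemma isStrictlyPositive (hT : IsAssociatedOperator F.dom F.form T) : IsStrictlyPositive T := by
  refine ⟨F.const, F.const_pos, fun u => ?_⟩
  obtain ⟨hu, h1⟩ := (hT _ _).1 (T.mem_graph u)
  rw [← h1 _ hu]
  exact F.coercive _ hu

lemma existsUnique_isSqrt (hT : IsAssociatedOperator F.dom F.form T) : ∃! S, IsSqrt S T :=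
  (F.isInverseOf hT).existsUnique_isSqrt F.isPositive

/-- Since S is the inverse of (J J*)^{1/2}, its domain is the range of that operator, hence the
range of J. -/
lemma domain_sqrt (hT : IsAssociatedOperator F.dom F.form T) {S : H →ₗ.[ℂ] H} (hS : IsSqrt S T) :
    S.domain = F.dom := by
  have h1 := (F.isInverseOf hT).of_isSqrt hS
  refine SetLike.coe_injective ?_
  rw [← F.range_embed, ← range_sqrt F.embed F.denseRange_adjoint_embed
    (denseRange_of_isSymmetric (sqrt_isPositive _).isSymmetric h1.injective)]
  exact Set.ext fun u => h1.mem_domain_iff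

lemma isCompactOperator_comp_adjoint (hc : IsCompactOperator F.embed) :
    IsCompactOperator (F.embed ∘L F.embed.adjoint) :=
  hc.comp_clm F.embed.adjoint

lemma spectrum_subset (hT : IsAssociatedOperator F.dom F.form T) (hc : IsCompactOperator F.embed) :
    spectrum T ⊆ {z : ℂ | 0 < z.re ∧ z.im = 0} := fun _ hz =>
  re_pos_of_hasEigenvalue_inv F.isPositive (F.isInverseOf hT).injective
    ((F.isInverseOf hT).hasEigenvalue_of_mem_spectrum (F.isCompactOperator_comp_adjoint hc) hz).2

lemma essentialSpectrum_eq_empty (hT : IsAssociatedOperator F.dom F.form T)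
    (hc : IsCompactOperator F.embed) : essentialSpectrum T = ∅ :=
  (F.isInverseOf hT).essentialSpectrum_eq_empty (F.isCompactOperator_comp_adjoint hc)
    F.isPositive.isSymmetric

end CoerciveForm

/-- The operator associated with a form is unique. -/
lemma IsAssociatedOperator.unique {V : Submodule ℂ H} {b : H → H → ℂ} {T T' : H →ₗ.[ℂ] H}
    (hT : IsAssociatedOperator V b T) (hT' : IsAssociatedOperator V b T') : T = T' :=
  LinearPMap.eq_of_eq_graph (Submodule.ext fun ⟨v, f⟩ => (hT v f).trans (hT' v f).symm)

end CoerciveForms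

/-! ### H¹₀ as a closure of test functions. -/

section SobolevClosure

variable {n m : ℕ} {Ω : TopologicalSpace.Opens (EuclideanSpace ℝ (Fin n))}

lemma continuous_integral_smul {ψ : EuclideanSpace ℝ (Fin n) → ℝ} (hψ : Continuous ψ)
    (hc : HasCompactSupport ψ) : Continuous fun u : VecL2 m Ω =>
      ∫ x in (Ω : Set (EuclideanSpace ℝ (Fin n))), ψ x • u x := by
  have hm : MemLp ψ 2 (volume.restrict (Ω : Set (EuclideanSpace ℝ (Fin n)))) :=
    hψ.memLp_of_hasCompactSupport hc
  let B := ContinuousLinearMap.lsmul ℝ ℝ (E := EuclideanSpace ℂ (Fin m))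
  have h : (fun u : VecL2 m Ω => ∫ x in (Ω : Set (EuclideanSpace ℝ (Fin n))), ψ x • u x) =
      B.lpPairing (volume.restrict (Ω : Set (EuclideanSpace ℝ (Fin n)))) 2 2 (hm.toLp ψ) := by
    funext u
    rw [ContinuousLinearMap.lpPairing_eq_integral]
    refine integral_congr_ae ?_
    filter_upwards [hm.coeFn_toLp] with x hx
    rw [hx]
    rfl
  rw [h]
  exact ContinuousLinearMap.continuous _

/-- Each integral identity in the definition is an equality between continuous functions of the pair
in L². -/
lemma isClosed_isWeakGrad :
    IsClosed {p : VecL2 m Ω × (Fin n → VecL2 m Ω) | IsWeakGrad p.1 p.2} := by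
  simp only [IsWeakGrad, Set.ofPred_forall]
  refine isClosed_iInter fun φ => isClosed_iInter fun j => isClosed_eq ?_ ?_
  · exact (continuous_integral_smul (continuous_pderiv j φ)
      (hasCompactSupport_pderiv j φ)).comp continuous_fst
  · exact ((continuous_integral_smul φ.contDiff.continuous φ.hasCompactSupport).comp
      ((continuous_apply j).comp continuous_snd)).neg

lemma continuous_pderiv_of_contDiff {F : Type*} [NormedAddCommGroup F] [NormedSpace ℝ F]
    {φ : EuclideanSpace ℝ (Fin n) → F} (hφ : ContDiff ℝ ∞ φ) (j : Fin n) :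
    Continuous (pderiv j φ) :=
  (hφ.continuous_fderiv (by simp)).clm_apply continuous_const

lemma hasCompactSupport_pderiv_of_hasCompactSupport {F : Type*} [NormedAddCommGroup F]
    [NormedSpace ℝ F] {φ : EuclideanSpace ℝ (Fin n) → F} (hφ : HasCompactSupport φ) (j : Fin n) :
    HasCompactSupport (pderiv j φ) :=
  hφ.fderiv_apply ℝ _

lemma memLp_pderiv {F : Type*} [NormedAddCommGroup F] [NormedSpace ℝ F]
    {φ : EuclideanSpace ℝ (Fin n) → F} (hφ : ContDiff ℝ ∞ φ) (hc : HasCompactSupport φ)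
    (j : Fin n) (μ : Measure (EuclideanSpace ℝ (Fin n))) [IsFiniteMeasureOnCompacts μ] :
    MemLp (pderiv j φ) 2 μ :=
  (continuous_pderiv_of_contDiff hφ j).memLp_of_hasCompactSupport
    (hasCompactSupport_pderiv_of_hasCompactSupport hc j)

lemma setIntegral_smul_of_tsupport_subset {F : Type*} [NormedAddCommGroup F] [NormedSpace ℝ F]
    {ψ : EuclideanSpace ℝ (Fin n) → ℝ} (hψ : tsupport ψ ⊆ Ω) (f : EuclideanSpace ℝ (Fin n) → F) :
    ∫ x in (Ω : Set (EuclideanSpace ℝ (Fin n))), ψ x • f x = ∫ x, ψ x • f x :=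
  setIntegral_eq_integral_of_forall_compl_eq_zero fun x hx => by
    rw [image_eq_zero_of_notMem_tsupport fun h => hx (hψ h), zero_smul]

/-- The test function is supported in Ω, so the integrals extend to the whole space, where
integration by parts has no boundary term. -/
lemma isWeakGrad_toLp {φ : EuclideanSpace ℝ (Fin n) → EuclideanSpace ℂ (Fin m)}
    (hφ : ContDiff ℝ ∞ φ)
    (h0 : MemLp φ 2 (volume.restrict (Ω : Set (EuclideanSpace ℝ (Fin n)))))
    (h1 : ∀ j, MemLp (pderiv j φ) 2 (volume.restrict (Ω : Set (EuclideanSpace ℝ (Fin n))))) :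
    IsWeakGrad (h0.toLp φ) fun j => (h1 j).toLp (pderiv j φ) := by
  intro ψ j
  have e1 : ∫ x in (Ω : Set (EuclideanSpace ℝ (Fin n))), pderiv j ψ x • (h0.toLp φ) x =
      ∫ x in (Ω : Set (EuclideanSpace ℝ (Fin n))), pderiv j ψ x • φ x :=
    integral_congr_ae (h0.coeFn_toLp.mono fun x hx => by simp only [hx])
  have e2 : ∫ x in (Ω : Set (EuclideanSpace ℝ (Fin n))), ψ x • ((h1 j).toLp (pderiv j φ)) x =
      ∫ x in (Ω : Set (EuclideanSpace ℝ (Fin n))), ψ x • pderiv j φ x :=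
    integral_congr_ae ((h1 j).coeFn_toLp.mono fun x hx => by simp only [hx])
  have hts : tsupport (pderiv j ψ) ⊆ Ω :=
    (tsupport_fderiv_apply_subset ℝ _).trans ψ.tsupport_subset
  rw [e1, e2, setIntegral_smul_of_tsupport_subset hts,
    setIntegral_smul_of_tsupport_subset ψ.tsupport_subset, eq_comm, neg_eq_iff_eq_neg]
  have hψc := ψ.contDiff.continuous
  have hcφ := continuous_pderiv_of_contDiff hφ j
  refine integral_smul_fderiv_eq_neg_fderiv_smul_of_integrable (𝕜 := ℝ) ?_ ?_ ?_
    (fun x _ => ψ.contDiff.differentiable (by simp) x) (fun x _ => hφ.differentiable (by simp) x)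
  · exact ((continuous_pderiv j ψ).smul hφ.continuous).integrable_of_hasCompactSupport
      (hasCompactSupport_pderiv j ψ).smul_right
  · exact (hψc.smul hcφ).integrable_of_hasCompactSupport ψ.hasCompactSupport.smul_right
  · exact (hψc.smul hφ.continuous).integrable_of_hasCompactSupport ψ.hasCompactSupport.smul_right

lemma memLp_test (φ : 𝓓(Ω, EuclideanSpace ℂ (Fin m))) (μ : Measure (EuclideanSpace ℝ (Fin n)))
    [IsFiniteMeasureOnCompacts μ] : MemLp φ 2 μ :=
  φ.contDiff.continuous.memLp_of_hasCompactSupport φ.hasCompactSupport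

/-- A test function, as an element of `L²(Ω)ᵐ`. -/
noncomputable def testLp (φ : 𝓓(Ω, EuclideanSpace ℂ (Fin m))) : VecL2 m Ω :=
  (memLp_test φ _).toLp φ

/-- The gradient of a test function, as an element of `L²(Ω)ᵐ`. -/
noncomputable def testGrad (φ : 𝓓(Ω, EuclideanSpace ℂ (Fin m))) (j : Fin n) : VecL2 m Ω :=
  (memLp_pderiv φ.contDiff φ.hasCompactSupport j _).toLp (pderiv j φ)

lemma coeFn_testLp (φ : 𝓓(Ω, EuclideanSpace ℂ (Fin m))) :
    testLp φ =ᵐ[volume.restrict (Ω : Set (EuclideanSpace ℝ (Fin n)))] φ :=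
  MemLp.coeFn_toLp _

lemma coeFn_testGrad (φ : 𝓓(Ω, EuclideanSpace ℂ (Fin m))) (j : Fin n) :
    testGrad φ j =ᵐ[volume.restrict (Ω : Set (EuclideanSpace ℝ (Fin n)))] pderiv j φ :=
  MemLp.coeFn_toLp _

lemma isWeakGrad_testGrad (φ : 𝓓(Ω, EuclideanSpace ℂ (Fin m))) :
    IsWeakGrad (testLp φ) (testGrad φ) :=
  isWeakGrad_toLp φ.contDiff _ _

lemma tendsto_toLp_iff {μ : Measure (EuclideanSpace ℝ (Fin n))}
    {φ : ℕ → EuclideanSpace ℝ (Fin n) → EuclideanSpace ℂ (Fin m)} (hφ : ∀ k, MemLp (φ k) 2 μ)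
    (u : Lp (EuclideanSpace ℂ (Fin m)) 2 μ) :
    Tendsto (fun k => (hφ k).toLp (φ k)) atTop (𝓝 u) ↔
      Tendsto (fun k => eLpNorm (fun x => φ k x - u x) 2 μ) atTop (𝓝 0) := by
  conv_lhs => rw [← Lp.toLp_coeFn u (Lp.memLp u)]
  exact Lp.tendsto_Lp_iff_tendsto_eLpNorm'' φ hφ u (Lp.memLp u)

lemma h1Tendsto_iff {φ : ℕ → EuclideanSpace ℝ (Fin n) → EuclideanSpace ℂ (Fin m)}
    (h0 : ∀ k, MemLp (φ k) 2 (volume.restrict (Ω : Set (EuclideanSpace ℝ (Fin n)))))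
    (h1 : ∀ k j, MemLp (pderiv j (φ k)) 2 (volume.restrict (Ω : Set (EuclideanSpace ℝ (Fin n)))))
    (u : VecL2 m Ω) : H1Tendsto φ u ↔
      Tendsto (fun k => ((h0 k).toLp (φ k), fun j => (h1 k j).toLp (pderiv j (φ k)))) atTop
        (𝓝 (u, weakGrad u)) := by
  rw [Prod.tendsto_iff, tendsto_pi_nhds, tendsto_toLp_iff]
  simp_rw [tendsto_toLp_iff (fun k => h1 k _)]
  rfl

lemma IsWeakGrad.weakGrad_eq {u : VecL2 m Ω} {G : Fin n → VecL2 m Ω} (h : IsWeakGrad u G) :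
    weakGrad u = G :=
  (isWeakGrad_weakGrad ⟨G, h⟩).unique h

/-- This turns the sequential definition of H¹₀ into a topological closure in L² × (L²)ⁿ. The second
component of a limit is again the weak gradient of the first because the weak gradient relation is
closed. -/
lemma mem_closure_range_test_iff {p : VecL2 m Ω × (Fin n → VecL2 m Ω)} :
    p ∈ closure (Set.range fun φ : 𝓓(Ω, EuclideanSpace ℂ (Fin m)) => (testLp φ, testGrad φ)) ↔
      p.1 ∈ H10 m Ω ∧ weakGrad p.1 = p.2 := by
  constructor
  · intro hp
    have hw : IsWeakGrad p.1 p.2 := by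
      refine closure_minimal ?_ isClosed_isWeakGrad hp
      rintro _ ⟨φ, rfl⟩
      exact isWeakGrad_testGrad φ
    refine ⟨⟨⟨_, hw⟩, ?_⟩, hw.weakGrad_eq⟩
    obtain ⟨s, hs, hlim⟩ := mem_closure_iff_seq_limit.1 hp
    choose φ hφ using hs
    refine ⟨φ, (h1Tendsto_iff (fun k => memLp_test _ _)
      (fun k j => memLp_pderiv (φ k).contDiff (φ k).hasCompactSupport j _) _).2 ?_⟩
    rw [hw.weakGrad_eq]
    exact hlim.congr fun k => (hφ k).symm
  · rintro ⟨⟨-, φ, hφ⟩, hp⟩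
    have := (h1Tendsto_iff (fun k => memLp_test _ _)
      (fun k j => memLp_pderiv (φ k).contDiff (φ k).hasCompactSupport j _) _).1 hφ
    rw [hp] at this
    exact mem_closure_of_tendsto this (.of_forall fun k => ⟨φ k, rfl⟩)

lemma H10_le_H1 : H10 m Ω ≤ H1 m Ω := fun _ hu => hu.1

lemma testLp_mem_H10 (φ : 𝓓(Ω, EuclideanSpace ℂ (Fin m))) : testLp φ ∈ H10 m Ω :=
  (mem_closure_range_test_iff.1 (subset_closure ⟨φ, rfl⟩)).1

lemma weakGrad_testLp (φ : 𝓓(Ω, EuclideanSpace ℂ (Fin m))) : weakGrad (testLp φ) = testGrad φ :=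
  (mem_closure_range_test_iff.1 (subset_closure ⟨φ, rfl⟩)).2

/-- A closed property of `(u, ∇u)` that holds for test functions holds in `H¹₀(Ω)ᵐ`. -/
lemma H10_induction {s : Set (VecL2 m Ω × (Fin n → VecL2 m Ω))} (hs : IsClosed s)
    (h : ∀ φ : 𝓓(Ω, EuclideanSpace ℂ (Fin m)), (testLp φ, testGrad φ) ∈ s) {u : VecL2 m Ω}
    (hu : u ∈ H10 m Ω) : (u, weakGrad u) ∈ s := by
  refine closure_minimal ?_ hs (mem_closure_range_test_iff (p := (u, weakGrad u)).2 ⟨hu, rfl⟩)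
  rintro _ ⟨φ, rfl⟩
  exact h φ

lemma H10_complete {s : ℕ → VecL2 m Ω} (hs : ∀ k, s k ∈ H10 m Ω) (h0 : CauchySeq s)
    (h1 : ∀ j, CauchySeq fun k => weakGrad (s k) j) :
    ∃ u ∈ H10 m Ω, Tendsto s atTop (𝓝 u) ∧
      ∀ j, Tendsto (fun k => weakGrad (s k) j) atTop (𝓝 (weakGrad u j)) := by
  obtain ⟨u, hu⟩ := cauchySeq_tendsto_of_complete h0
  choose G hG using fun j => cauchySeq_tendsto_of_complete (h1 j)
  have hlim : Tendsto (fun k => (s k, weakGrad (s k))) atTop (𝓝 (u, G)) :=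
    hu.prodMk_nhds (tendsto_pi_nhds.2 hG)
  have hmem := isClosed_closure.mem_of_tendsto hlim
    (.of_forall fun k => mem_closure_range_test_iff.2 ⟨hs k, rfl⟩)
  obtain ⟨h2, h3⟩ := mem_closure_range_test_iff.1 hmem
  simp only at h2 h3
  refine ⟨u, h2, hu, fun j => ?_⟩
  rw [h3]
  exact hG j

lemma weakGrad_sub {u v : VecL2 m Ω} (hu : u ∈ H1 m Ω) (hv : v ∈ H1 m Ω) :
    weakGrad (u - v) = weakGrad u - weakGrad v := by
  rw [sub_eq_add_neg, ← neg_one_smul ℂ v, weakGrad_add hu (Submodule.smul_mem _ _ hv),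
    weakGrad_smul _ hv, neg_one_smul, ← sub_eq_add_neg]

/-- The test function `φ e_α`. -/
noncomputable def testCoord (φ : 𝓓(Ω, ℝ)) (α : Fin m) : 𝓓(Ω, EuclideanSpace ℂ (Fin m)) where
  toFun x := φ x • EuclideanSpace.single α (1 : ℂ)
  contDiff' := φ.contDiff.smul contDiff_const
  hasCompactSupport' := φ.hasCompactSupport.smul_right
  tsupport_subset' := (tsupport_smul_subset_left _ _).trans φ.tsupport_subset

lemma testCoord_apply (φ : 𝓓(Ω, ℝ)) (α : Fin m) (x : EuclideanSpace ℝ (Fin n)) :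
    testCoord φ α x = φ x • EuclideanSpace.single α (1 : ℂ) := rfl

lemma pderiv_testCoord (φ : 𝓓(Ω, ℝ)) (α : Fin m) (j : Fin n) (x : EuclideanSpace ℝ (Fin n)) :
    pderiv j (testCoord φ α) x = pderiv j φ x • EuclideanSpace.single α (1 : ℂ) := by
  have hd : DifferentiableAt ℝ φ x := φ.contDiff.differentiable (by simp) x
  have h1 := fderiv_smul_const hd (EuclideanSpace.single α (1 : ℂ))
  exact DFunLike.congr_fun h1 _

/-- A function orthogonal to every φ e_α has components that vanish as distributions. -/
lemma dense_H10 : Dense (H10 m Ω : Set (VecL2 m Ω)) := by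
  refine dense_of_forall_inner_eq_zero _ fun f hf => ?_
  have h : ∀ᵐ x ∂(volume.restrict (Ω : Set (EuclideanSpace ℝ (Fin n)))), ∀ α, f x α = 0 := by
    rw [ae_all_iff]
    intro α
    refine ae_eq_zero_of_test (memLp_coord f α) fun φ => ?_
    rw [← hf _ (testLp_mem_H10 (testCoord φ α)), L2.inner_def]
    refine integral_congr_ae ?_
    filter_upwards [coeFn_testLp (testCoord φ α)] with x hx
    rw [hx, testCoord_apply, inner_smul_left_eq_smul, EuclideanSpace.inner_single_left]
    simp
  refine Lp.eq_zero_iff_ae_eq_zero.2 ?_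
  filter_upwards [h] with x hx
  ext α
  exact hx α

end SobolevClosure

/-! ### The Dirichlet form and the weak formulation. -/

section DirichletForm

variable {n m : ℕ} {Ω : TopologicalSpace.Opens (EuclideanSpace ℝ (Fin n))} {A : Coeff m Ω}

lemma memLp_fluxVec (A : Coeff m Ω) (v : VecL2 m Ω) (j : Fin n) :
    MemLp (fun x => (WithLp.toLp 2 fun α => flux A v j α x : EuclideanSpace ℂ (Fin m))) 2
      (volume.restrict (Ω : Set (EuclideanSpace ℝ (Fin n)))) :=
  memLp_piLp_iff.2 fun α => memLp_flux A v j α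

/-- The flux `(A Dv)_j` as an element of `L²(Ω)ᵐ`. -/
noncomputable def fluxLp (A : Coeff m Ω) (v : VecL2 m Ω) (j : Fin n) : VecL2 m Ω :=
  (memLp_fluxVec A v j).toLp _

lemma fluxLp_apply (A : Coeff m Ω) (v : VecL2 m Ω) (j : Fin n) :
    ∀ᵐ x ∂(volume.restrict (Ω : Set (EuclideanSpace ℝ (Fin n)))), ∀ α,
      fluxLp A v j x α = flux A v j α x := by
  filter_upwards [(memLp_fluxVec A v j).coeFn_toLp] with x hx α
  rw [fluxLp, hx]

lemma fluxLp_add (A : Coeff m Ω) {u v : VecL2 m Ω} (hu : u ∈ H1 m Ω) (hv : v ∈ H1 m Ω)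
    (j : Fin n) : fluxLp A (u + v) j = fluxLp A u j + fluxLp A v j := by
  refine Lp.ext ?_
  filter_upwards [fluxLp_apply A (u + v) j, fluxLp_apply A u j, fluxLp_apply A v j,
    Lp.coeFn_add (fluxLp A u j) (fluxLp A v j), ae_all_iff.2 (flux_add A hu hv j)]
    with x h1 h2 h3 h4 h5
  ext α
  rw [h1, h4, h5, Pi.add_apply, PiLp.add_apply, h2, h3]

lemma fluxLp_smul (A : Coeff m Ω) {u : VecL2 m Ω} (c : ℂ) (hu : u ∈ H1 m Ω)
    (j : Fin n) : fluxLp A (c • u) j = c • fluxLp A u j := by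
  refine Lp.ext ?_
  filter_upwards [fluxLp_apply A (c • u) j, fluxLp_apply A u j,
    Lp.coeFn_smul c (fluxLp A u j), ae_all_iff.2 (flux_smul A c hu j)]
    with x h1 h2 h4 h5
  ext α
  rw [h1, h4, h5, Pi.smul_apply, PiLp.smul_apply, h2]

lemma integrand_eq_sum_inner (A : Coeff m Ω) (u v : VecL2 m Ω) :
    ∀ᵐ x ∂(volume.restrict (Ω : Set (EuclideanSpace ℝ (Fin n)))),
      ∑ j, ∑ k, ∑ α, ∑ β, A j k α β x * weakGrad v k x β * (starRingEnd ℂ) (weakGrad u j x α) =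
        ∑ j, ⟪weakGrad u j x, fluxLp A v j x⟫_ℂ := by
  filter_upwards [ae_all_iff.2 (fluxLp_apply A v)] with x hx
  refine Finset.sum_congr rfl fun j _ => ?_
  rw [PiLp.inner_apply, Finset.sum_comm]
  refine Finset.sum_congr rfl fun α _ => ?_
  rw [RCLike.inner_apply, hx, flux, Finset.sum_mul]
  refine Finset.sum_congr rfl fun k _ => ?_
  rw [Finset.sum_mul]

/-- As a sum of L² scalar products of gradients with fluxes, the form is visibly sesquilinear on H¹
and continuous in the gradient of its first argument. -/
lemma dirichletForm_eq_sum_inner (A : Coeff m Ω) (u v : VecL2 m Ω) :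
    dirichletForm A u v = ∑ j, ⟪weakGrad u j, fluxLp A v j⟫_ℂ := by
  rw [dirichletForm, integral_congr_ae (integrand_eq_sum_inner A u v),
    integral_finsetSum _ fun j _ => L2.integrable_inner _ _]
  rfl

lemma integrable_dirichletForm (A : Coeff m Ω) (u v : VecL2 m Ω) :
    Integrable (fun x => ∑ j, ∑ k, ∑ α, ∑ β,
      A j k α β x * weakGrad v k x β * (starRingEnd ℂ) (weakGrad u j x α))
      (volume.restrict (Ω : Set (EuclideanSpace ℝ (Fin n)))) :=
  (integrable_finsetSum Finset.univ fun j _ =>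
    L2.integrable_inner (weakGrad u j) (fluxLp A v j)).congr
    ((integrand_eq_sum_inner A u v).mono fun _ h => h.symm)

lemma re_dirichletForm (A : Coeff m Ω) (u v : VecL2 m Ω) :
    (dirichletForm A u v).re = ∫ x in (Ω : Set (EuclideanSpace ℝ (Fin n))),
      (∑ j, ∑ k, ∑ α, ∑ β,
        A j k α β x * weakGrad v k x β * (starRingEnd ℂ) (weakGrad u j x α)).re :=
  (Complex.reCLM.integral_comp_comm (integrable_dirichletForm A u v)).symm

lemma isSesquilinearOn_dirichletForm (A : Coeff m Ω) :
    IsSesquilinearOn (H1 m Ω) (dirichletForm A) where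
  add_left u hu v hv w _ := by
    simp_rw [dirichletForm_eq_sum_inner, weakGrad_add hu hv, Pi.add_apply, inner_add_left,
      Finset.sum_add_distrib]
  smul_left c u hu v _ := by
    simp_rw [dirichletForm_eq_sum_inner, weakGrad_smul c hu, Pi.smul_apply, inner_smul_left,
      Finset.mul_sum]
  add_right u _ v hv w hw := by
    simp_rw [dirichletForm_eq_sum_inner, fluxLp_add A hv hw, inner_add_right,
      Finset.sum_add_distrib]
  smul_right c u _ v hv := by
    simp_rw [dirichletForm_eq_sum_inner, fluxLp_smul A c hv, inner_smul_right, Finset.mul_sum]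

lemma IsSesquilinearOn.mono {H : Type*} [NormedAddCommGroup H] [InnerProductSpace ℂ H]
    {V W : Submodule ℂ H} {b : H → H → ℂ} (h : IsSesquilinearOn W b) (hVW : V ≤ W) :
    IsSesquilinearOn V b where
  add_left u hu v hv w hw := h.add_left u (hVW hu) v (hVW hv) w (hVW hw)
  smul_left c u hu v hv := h.smul_left c u (hVW hu) v (hVW hv)
  add_right u hu v hv w hw := h.add_right u (hVW hu) v (hVW hv) w (hVW hw)
  smul_right c u hu v hv := h.smul_right c u (hVW hu) v (hVW hv)

lemma dirichletForm_conj_symm (hA : SymmetricCoeff A) (u v : VecL2 m Ω) :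
    dirichletForm A u v = (starRingEnd ℂ) (dirichletForm A v u) := by
  rw [dirichletForm, dirichletForm, ← integral_conj]
  refine integral_congr_ae ?_
  filter_upwards [hA] with x hx
  simp only [map_sum, map_mul, starRingEnd_self_apply]
  rw [Finset.sum_comm]
  refine Finset.sum_congr rfl fun k _ => Finset.sum_congr rfl fun j _ => ?_
  rw [Finset.sum_comm]
  refine Finset.sum_congr rfl fun β _ => Finset.sum_congr rfl fun α _ => ?_
  rw [hx j k α β]
  ring

lemma norm_sq_eq_integral (w : VecL2 m Ω) :
    ‖w‖ ^ 2 = ∫ x in (Ω : Set (EuclideanSpace ℝ (Fin n))), ‖w x‖ ^ 2 := by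
  have h1 : ((‖w‖ ^ 2 : ℝ) : ℂ) = ∫ x in (Ω : Set (EuclideanSpace ℝ (Fin n))), ⟪w x, w x⟫_ℂ := by
    rw [← L2.inner_def, inner_self_eq_norm_sq_to_K]
    norm_cast
  have h2 : ∀ x, ⟪w x, w x⟫_ℂ = ((‖w x‖ ^ 2 : ℝ) : ℂ) := fun x => by
    rw [inner_self_eq_norm_sq_to_K]
    norm_cast
  simp_rw [h2] at h1
  rw [integral_complex_ofReal] at h1
  exact_mod_cast h1

lemma integrable_norm_sq (w : VecL2 m Ω) :
    Integrable (fun x => ‖w x‖ ^ 2) (volume.restrict (Ω : Set (EuclideanSpace ℝ (Fin n)))) :=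
  (Lp.memLp w).integrable_norm_pow (by norm_num)

/-- `‖∇u‖²`. -/
noncomputable def gradNormSq (u : VecL2 m Ω) : ℝ := ∑ j, ‖weakGrad u j‖ ^ 2

lemma gradNormSq_nonneg (u : VecL2 m Ω) : 0 ≤ gradNormSq u :=
  Finset.sum_nonneg fun _ _ => sq_nonneg _

lemma gradNormSq_eq_integral (u : VecL2 m Ω) :
    gradNormSq u = ∫ x in (Ω : Set (EuclideanSpace ℝ (Fin n))), ∑ j, ‖weakGrad u j x‖ ^ 2 := by
  rw [integral_finsetSum _ fun _ _ => integrable_norm_sq _]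
  exact Finset.sum_congr rfl fun j _ => norm_sq_eq_integral _

lemma integrable_grad_norm_sq (u : VecL2 m Ω) : Integrable (fun x => ∑ j, ‖weakGrad u j x‖ ^ 2)
    (volume.restrict (Ω : Set (EuclideanSpace ℝ (Fin n)))) :=
  integrable_finsetSum _ fun _ _ => integrable_norm_sq _

lemma dirichletForm_coercive {a₀ : ℝ} (hA : StrongLegendre A a₀) (u : VecL2 m Ω) :
    a₀ * gradNormSq u ≤ (dirichletForm A u u).re := by
  rw [re_dirichletForm, gradNormSq_eq_integral, ← integral_const_mul]
  refine integral_mono_ae ((integrable_grad_norm_sq u).const_mul _)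
    (Complex.reCLM.integrable_comp (integrable_dirichletForm A u u)) ?_
  filter_upwards [hA] with x hx
  simpa only [EuclideanSpace.norm_sq_eq] using hx fun j α => weakGrad u j x α

lemma ae_norm_le_norm {μ : Measure (EuclideanSpace ℝ (Fin n))} (a : Lp ℂ ∞ μ) :
    ∀ᵐ x ∂μ, ‖a x‖ ≤ ‖a‖ := by
  filter_upwards [ae_le_eLpNormEssSup (f := a) (μ := μ)] with x hx
  rw [Lp.norm_def, eLpNorm_exponent_top, ← toReal_enorm]
  exact ENNReal.toReal_mono (by rw [← eLpNorm_exponent_top]; exact Lp.eLpNorm_ne_top a) hx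

lemma dirichletForm_bounded (A : Coeff m Ω) (u : VecL2 m Ω) :
    (dirichletForm A u u).re ≤ (∑ j, ∑ k, ∑ α, ∑ β, ‖A j k α β‖) * gradNormSq u := by
  rw [re_dirichletForm, gradNormSq_eq_integral, ← integral_const_mul]
  refine integral_mono_ae (Complex.reCLM.integrable_comp (integrable_dirichletForm A u u))
    ((integrable_grad_norm_sq u).const_mul _) ?_
  have hA : ∀ᵐ x ∂(volume.restrict (Ω : Set (EuclideanSpace ℝ (Fin n)))), ∀ j k α β,
      ‖A j k α β x‖ ≤ ‖A j k α β‖ := by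
    simp_rw [ae_all_iff]
    exact fun j k α β => ae_norm_le_norm _
  filter_upwards [hA] with x hx
  refine (Complex.re_le_norm _).trans ?_
  simp_rw [Finset.sum_mul]
  refine norm_sum_le_of_le _ fun j _ => norm_sum_le_of_le _ fun k _ => norm_sum_le_of_le _
    fun α _ => norm_sum_le_of_le _ fun β _ => ?_
  -- Each entry of the gradient is bounded by its full Euclidean norm; the resulting constant, a sum
  -- over all entries of A, is crude but sufficient.
  have hS : ∀ l γ, ‖weakGrad u l x γ‖ ≤ Real.sqrt (∑ j, ‖weakGrad u j x‖ ^ 2) := fun l γ =>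
    (PiLp.norm_apply_le _ _).trans (Real.le_sqrt_of_sq_le
      (Finset.single_le_sum (f := fun j => ‖weakGrad u j x‖ ^ 2) (fun _ _ => sq_nonneg _)
        (Finset.mem_univ l)))
  rw [norm_mul, norm_mul, RCLike.norm_conj, mul_assoc]
  calc ‖A j k α β x‖ * (‖weakGrad u k x β‖ * ‖weakGrad u j x α‖)
      ≤ ‖A j k α β‖ * (Real.sqrt (∑ j, ‖weakGrad u j x‖ ^ 2) *
        Real.sqrt (∑ j, ‖weakGrad u j x‖ ^ 2)) := by
        gcongr
        · exact hx j k α β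
        · exact hS k β
        · exact hS j α
    _ = _ := by rw [Real.mul_self_sqrt (Finset.sum_nonneg fun _ _ => sq_nonneg _)]

lemma gradNormSq_sub {u v : VecL2 m Ω} (hu : u ∈ H1 m Ω) (hv : v ∈ H1 m Ω) :
    gradNormSq (u - v) = ∑ j, ‖weakGrad u j - weakGrad v j‖ ^ 2 := by
  rw [gradNormSq, weakGrad_sub hu hv]
  rfl

/-- The form norm lies between multiples of the H¹ norm: ellipticity bounds it from below, so
form-Cauchy sequences converge in H¹₀, and boundedness of the coefficients bounds it from above, so
they converge in the form norm as well. -/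
lemma isClosedFormBddBelow_dirichletForm {a₀ : ℝ} (ha₀ : 0 < a₀) (hell : StrongLegendre A a₀)
    (hsymm : SymmetricCoeff A) : IsClosedFormBddBelow (H10 m Ω) (dirichletForm A) 0 where
  sesquilinear := (isSesquilinearOn_dirichletForm A).mono H10_le_H1
  dense := dense_H10
  symmetric u _ v _ := dirichletForm_conj_symm hsymm u v
  bddBelow u _ := by
    rw [zero_mul]
    exact (mul_nonneg ha₀.le (gradNormSq_nonneg u)).trans (dirichletForm_coercive hell u)
  closed s hs hcauchy := by
    have hle : ∀ u : VecL2 m Ω, a₀ * gradNormSq u + ‖u‖ ^ 2 ≤ formNormSq (dirichletForm A) 0 u :=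
      fun u => by
        have := dirichletForm_coercive hell u
        rw [formNormSq]
        linarith
    have h0 : CauchySeq s := by
      rw [Metric.cauchySeq_iff]
      intro ε hε
      obtain ⟨N, hN⟩ := hcauchy (ε ^ 2) (by positivity)
      refine ⟨N, fun k hk l hl => ?_⟩
      have h1 := (hle _).trans_lt (hN k hk l hl)
      have h2 := mul_nonneg ha₀.le (gradNormSq_nonneg (s k - s l))
      rw [dist_eq_norm]
      exact lt_of_pow_lt_pow_left₀ 2 hε.le (by linarith)
    have h1 : ∀ j, CauchySeq fun k => weakGrad (s k) j := by
      intro j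
      rw [Metric.cauchySeq_iff]
      intro ε hε
      obtain ⟨N, hN⟩ := hcauchy (a₀ * ε ^ 2) (by positivity)
      refine ⟨N, fun k hk l hl => ?_⟩
      have h1 := (hle _).trans_lt (hN k hk l hl)
      rw [gradNormSq_sub (H10_le_H1 (hs k)) (H10_le_H1 (hs l))] at h1
      have h2 : ‖weakGrad (s k) j - weakGrad (s l) j‖ ^ 2 ≤
          ∑ j, ‖weakGrad (s k) j - weakGrad (s l) j‖ ^ 2 :=
        Finset.single_le_sum (f := fun j => ‖weakGrad (s k) j - weakGrad (s l) j‖ ^ 2)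
          (fun _ _ => sq_nonneg _) (Finset.mem_univ j)
      have h3 : a₀ * ∑ j, ‖weakGrad (s k) j - weakGrad (s l) j‖ ^ 2 < a₀ * ε ^ 2 := by
        have := sq_nonneg ‖s k - s l‖
        linarith
      rw [dist_eq_norm]
      exact lt_of_pow_lt_pow_left₀ 2 hε.le (h2.trans_lt (lt_of_mul_lt_mul_left h3 ha₀.le))
    obtain ⟨u, hu, hlim, hlim'⟩ := H10_complete hs h0 h1
    refine ⟨u, hu, ?_⟩
    have hz : Tendsto (fun k => (∑ j, ∑ k, ∑ α, ∑ β, ‖A j k α β‖) *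
        (∑ j, ‖weakGrad (s k) j - weakGrad u j‖ ^ 2) + ‖s k - u‖ ^ 2) atTop (𝓝 0) := by
      have e1 : Tendsto (fun k => ∑ j, ‖weakGrad (s k) j - weakGrad u j‖ ^ 2) atTop (𝓝 0) := by
        rw [← Finset.sum_const_zero (s := (Finset.univ : Finset (Fin n)))]
        refine tendsto_finsetSum _ fun j _ => ?_
        simpa using (tendsto_iff_norm_sub_tendsto_zero.1 (hlim' j)).pow 2
      have e2 : Tendsto (fun k => ‖s k - u‖ ^ 2) atTop (𝓝 0) := by
        simpa using (tendsto_iff_norm_sub_tendsto_zero.1 hlim).pow 2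
      simpa using (e1.const_mul _).add e2
    refine squeeze_zero (fun k => ?_) (fun k => ?_) hz
    · exact (add_nonneg (mul_nonneg ha₀.le (gradNormSq_nonneg _)) (sq_nonneg _)).trans (hle _)
    · rw [← gradNormSq_sub (H10_le_H1 (hs k)) (H10_le_H1 hu), formNormSq, sub_zero, one_mul]
      gcongr
      exact dirichletForm_bounded A _

/-- The real part of a component of a test function. -/
noncomputable def testRe (φ : 𝓓(Ω, EuclideanSpace ℂ (Fin m))) (α : Fin m) : 𝓓(Ω, ℝ) where
  toFun x := (φ x α).re
  contDiff' := (Complex.reCLM.contDiff.comp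
    ((EuclideanSpace.proj (𝕜 := ℂ) α).restrictScalars ℝ).contDiff).comp φ.contDiff
  hasCompactSupport' := φ.hasCompactSupport.comp_left (g := fun z : EuclideanSpace ℂ (Fin m) => (z α).re) (by simp)
  tsupport_subset' := (tsupport_comp_subset (g := fun z : EuclideanSpace ℂ (Fin m) => (z α).re) (by simp) φ).trans
    φ.tsupport_subset

/-- The imaginary part of a component of a test function. -/
noncomputable def testIm (φ : 𝓓(Ω, EuclideanSpace ℂ (Fin m))) (α : Fin m) : 𝓓(Ω, ℝ) where
  toFun x := (φ x α).im
  contDiff' := (Complex.imCLM.contDiff.comp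
    ((EuclideanSpace.proj (𝕜 := ℂ) α).restrictScalars ℝ).contDiff).comp φ.contDiff
  hasCompactSupport' := φ.hasCompactSupport.comp_left (g := fun z : EuclideanSpace ℂ (Fin m) => (z α).im) (by simp)
  tsupport_subset' := (tsupport_comp_subset (g := fun z : EuclideanSpace ℂ (Fin m) => (z α).im) (by simp) φ).trans
    φ.tsupport_subset

/-- The distributional equation is tested only with real scalar functions, one component at a time.
This decomposition carries it over to complex vector-valued test functions. -/
lemma testLp_eq_sum (φ : 𝓓(Ω, EuclideanSpace ℂ (Fin m))) :
    testLp φ = ∑ α, (testLp (testCoord (testRe φ α) α) +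
      Complex.I • testLp (testCoord (testIm φ α) α)) := by
  refine Lp.ext ?_
  have h1 := ae_all_iff.2 fun α => coeFn_testLp (testCoord (testRe φ α) α)
  have h2 := ae_all_iff.2 fun α => coeFn_testLp (testCoord (testIm φ α) α)
  have h3 := ae_all_iff.2 fun α => Lp.coeFn_smul Complex.I (testLp (testCoord (testIm φ α) α))
  have h4 := ae_all_iff.2 fun α => Lp.coeFn_add (testLp (testCoord (testRe φ α) α))
    (Complex.I • testLp (testCoord (testIm φ α) α))
  filter_upwards [coeFn_testLp φ, h1, h2, h3, h4, Lp.coeFn_finsetSum Finset.univ fun α =>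
    (testLp (testCoord (testRe φ α) α) + Complex.I • testLp (testCoord (testIm φ α) α))]
    with x e0 e1 e2 e3 e4 e5
  rw [e0, e5, Finset.sum_apply]
  simp_rw [e4, Pi.add_apply, e3, Pi.smul_apply, e1, e2, testCoord_apply]
  ext γ
  simp only [WithLp.ofLp_sum, WithLp.ofLp_add, WithLp.ofLp_smul, Finset.sum_apply, Pi.add_apply,
    Pi.smul_apply, PiLp.single_apply, smul_eq_mul, Complex.real_smul]
  simp only [mul_ite, mul_one, mul_zero, Finset.sum_add_distrib, Finset.sum_ite_eq,
    Finset.mem_univ, if_true]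
  rw [mul_comm]
  exact (Complex.re_add_im _).symm

lemma dirichletForm_testCoord (A : Coeff m Ω) (φ : 𝓓(Ω, ℝ)) (α : Fin m) (u : VecL2 m Ω) :
    dirichletForm A (testLp (testCoord φ α)) u =
      ∑ j, ∫ x in (Ω : Set (EuclideanSpace ℝ (Fin n))), pderiv j φ x • flux A u j α x := by
  rw [dirichletForm_eq_sum_inner, weakGrad_testLp]
  refine Finset.sum_congr rfl fun j _ => ?_
  rw [L2.inner_def]
  refine integral_congr_ae ?_
  filter_upwards [coeFn_testGrad (testCoord φ α) j, fluxLp_apply A u j] with x hx hx'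
  rw [hx, pderiv_testCoord, inner_smul_left_eq_smul, EuclideanSpace.inner_single_left, hx']
  simp

lemma inner_testCoord (φ : 𝓓(Ω, ℝ)) (α : Fin m) (f : VecL2 m Ω) :
    ⟪testLp (testCoord φ α), f⟫_ℂ =
      ∫ x in (Ω : Set (EuclideanSpace ℝ (Fin n))), φ x • f x α := by
  rw [L2.inner_def]
  refine integral_congr_ae ?_
  filter_upwards [coeFn_testLp (testCoord φ α)] with x hx
  rw [hx, testCoord_apply, inner_smul_left_eq_smul, EuclideanSpace.inner_single_left]
  simp

/-- `Lu = f` in the sense of distributions if and only if `u` is a weak solution. -/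
lemma isDivForm_iff {u f : VecL2 m Ω} (hu : u ∈ H1 m Ω) :
    IsDivForm A u f ↔ ∀ w ∈ H10 m Ω, dirichletForm A w u = ⟪w, f⟫_ℂ := by
  constructor
  · intro h w hw
    -- Both sides of the weak equation are antilinear in w, so its solutions w form a subspace, and
    -- the functions φ e_α suffice to capture all test functions.
    let K : Submodule ℂ (VecL2 m Ω) :=
      { carrier := {w | w ∈ H1 m Ω ∧ dirichletForm A w u = ⟪w, f⟫_ℂ}
        add_mem' := fun {v w} hv hw => ⟨add_mem hv.1 hw.1, by
          rw [(isSesquilinearOn_dirichletForm A).add_left v hv.1 w hw.1 u hu, hv.2, hw.2,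
            inner_add_left]⟩
        zero_mem' := ⟨zero_mem _, by
          rw [dirichletForm_eq_sum_inner, weakGrad_zero]
          simp⟩
        smul_mem' := fun c w hw => ⟨Submodule.smul_mem _ c hw.1, by
          rw [(isSesquilinearOn_dirichletForm A).smul_left c w hw.1 u hu, hw.2,
            inner_smul_left]⟩ }
    have hcoord : ∀ (φ : 𝓓(Ω, ℝ)) (α : Fin m), testLp (testCoord φ α) ∈ K := fun φ α =>
      ⟨H10_le_H1 (testLp_mem_H10 _), by
        rw [dirichletForm_testCoord, inner_testCoord]
        exact h φ α⟩
    have htest : ∀ φ : 𝓓(Ω, EuclideanSpace ℂ (Fin m)), testLp φ ∈ K := fun φ => by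
      rw [testLp_eq_sum]
      exact sum_mem fun α _ => add_mem (hcoord _ _) (Submodule.smul_mem _ _ (hcoord _ _))
    -- For fixed u the weak equation is a closed condition on w and its gradient, so it passes from
    -- test functions to H¹₀.
    have hcl : IsClosed {p : VecL2 m Ω × (Fin n → VecL2 m Ω) |
        ∑ j, ⟪p.2 j, fluxLp A u j⟫_ℂ = ⟪p.1, f⟫_ℂ} :=
      isClosed_eq (by fun_prop) (by fun_prop)
    have h1 := H10_induction hcl (fun φ => by
      have h2 := (htest φ).2
      rwa [dirichletForm_eq_sum_inner, weakGrad_testLp] at h2) hw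
    rw [dirichletForm_eq_sum_inner]
    exact h1
  · intro h φ α
    rw [← dirichletForm_testCoord, h _ (testLp_mem_H10 _), inner_testCoord]

lemma isAssociatedOperator_dirichletRealization (A : Coeff m Ω) :
    IsAssociatedOperator (H10 m Ω) (dirichletForm A) (dirichletRealization A) := by
  intro v f
  rw [mem_graph_dirichletRealization]
  exact and_congr_right fun hv => isDivForm_iff (H10_le_H1 hv)

end DirichletForm

/-! ### The translation estimate and the Poincaré inequality. -/

section Translation

lemma lintegral_sq_le {α : Type*} [MeasurableSpace α] {μ : Measure α} {f : α → ℝ≥0∞}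
    (hf : AEMeasurable f μ) : (∫⁻ x, f x ∂μ) ^ 2 ≤ μ Set.univ * ∫⁻ x, f x ^ 2 ∂μ := by
  have h := ENNReal.lintegral_mul_le_Lp_mul_Lq μ (Real.HolderConjugate.two_two) hf
    (aemeasurable_const (b := (1 : ℝ≥0∞)))
  simp only [Pi.mul_apply, mul_one, ENNReal.one_rpow, lintegral_const, one_mul] at h
  have h2 := pow_le_pow_left' h 2
  rw [mul_pow, ← ENNReal.rpow_two, ← ENNReal.rpow_two (_ ^ _), ← ENNReal.rpow_two (_ ^ _),
    ← ENNReal.rpow_mul, ← ENNReal.rpow_mul] at h2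
  norm_num at h2
  rw [mul_comm]
  exact h2

lemma enorm_sub_sq_le {F : Type*} [NormedAddCommGroup F] [NormedSpace ℝ F] [CompleteSpace F]
    {f f' : ℝ → F} (hf : ∀ t, HasDerivAt f (f' t) t) (hc : Continuous f') {a b : ℝ} (hab : a ≤ b) :
    ‖f b - f a‖ₑ ^ 2 ≤ ENNReal.ofReal (b - a) * ∫⁻ t in Set.Ioc a b, ‖f' t‖ₑ ^ 2 := by
  rw [← intervalIntegral.integral_eq_sub_of_hasDerivAt (fun t _ => hf t)
    (hc.intervalIntegrable a b), intervalIntegral.integral_of_le hab]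
  calc ‖∫ t in Set.Ioc a b, f' t‖ₑ ^ 2 ≤ (∫⁻ t in Set.Ioc a b, ‖f' t‖ₑ) ^ 2 :=
        pow_le_pow_left' (enorm_integral_le_lintegral_enorm _) 2
    _ ≤ _ := by
        refine (lintegral_sq_le hc.enorm.aemeasurable).trans_eq ?_
        rw [Measure.restrict_apply_univ, Real.volume_Ioc]

lemma eLpNorm_two_sq {α F : Type*} [MeasurableSpace α] {μ : Measure α} [NormedAddCommGroup F]
    (f : α → F) : eLpNorm f 2 μ ^ 2 = ∫⁻ x, ‖f x‖ₑ ^ 2 ∂μ := by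
  have h := eLpNorm_nnreal_pow_eq_lintegral (f := f) (μ := μ) (p := 2) two_ne_zero
  simpa using h

variable {n m : ℕ} {Ω : TopologicalSpace.Opens (EuclideanSpace ℝ (Fin n))}

lemma norm_sq_le_sum_norm_sq {F : Type*} [NormedAddCommGroup F] [NormedSpace ℝ F]
    (L : EuclideanSpace ℝ (Fin n) →L[ℝ] F) :
    ‖L‖ ^ 2 ≤ ∑ j, ‖L (EuclideanSpace.single j 1)‖ ^ 2 := by
  have h0 : 0 ≤ ∑ j, ‖L (EuclideanSpace.single j 1)‖ ^ 2 := Finset.sum_nonneg fun _ _ => sq_nonneg _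
  refine Real.le_sqrt (norm_nonneg _) h0 |>.1 (L.opNorm_le_bound (Real.sqrt_nonneg _) fun z => ?_)
  have hz : z = ∑ j, z j • EuclideanSpace.single j (1 : ℝ) := by
    ext i
    simp [Pi.single_apply]
  calc ‖L z‖ = ‖∑ j, z j • L (EuclideanSpace.single j 1)‖ := by
        conv_lhs => rw [hz, map_sum]
        simp_rw [map_smul]
    _ ≤ ∑ j, |z j| * ‖L (EuclideanSpace.single j 1)‖ :=
        norm_sum_le_of_le _ fun j _ => by rw [norm_smul, Real.norm_eq_abs]
    _ ≤ Real.sqrt ((∑ j, ‖L (EuclideanSpace.single j 1)‖ ^ 2) * ‖z‖ ^ 2) := by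
        refine Real.le_sqrt_of_sq_le ((Finset.sum_mul_sq_le_sq_mul_sq _ _ _).trans_eq ?_)
        simp only [sq_abs, EuclideanSpace.norm_sq_eq, Real.norm_eq_abs]
        rw [mul_comm]
    _ = _ := by rw [Real.sqrt_mul h0, Real.sqrt_sq (norm_nonneg _)]

lemma enorm_fderiv_sq_le {F : Type*} [NormedAddCommGroup F] [NormedSpace ℝ F]
    (φ : EuclideanSpace ℝ (Fin n) → F) (x : EuclideanSpace ℝ (Fin n)) :
    ‖fderiv ℝ φ x‖ₑ ^ 2 ≤ ∑ j, ‖pderiv j φ x‖ₑ ^ 2 := by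
  have h := ENNReal.ofReal_le_ofReal (norm_sq_le_sum_norm_sq (fderiv ℝ φ x))
  rw [ENNReal.ofReal_sum_of_nonneg fun _ _ => sq_nonneg _] at h
  simp_rw [ENNReal.ofReal_pow (norm_nonneg _), ofReal_norm] at h
  exact h

/-- Write the difference as the integral of the derivative along the segment from x to x + z, apply
Cauchy–Schwarz, exchange the integrals and use translation invariance. -/
lemma lintegral_translate_sub_sq_le {F : Type*} [NormedAddCommGroup F] [NormedSpace ℝ F]
    [CompleteSpace F] {φ : EuclideanSpace ℝ (Fin n) → F} (hφ : ContDiff ℝ ∞ φ)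
    (z : EuclideanSpace ℝ (Fin n)) :
    ∫⁻ x, ‖φ (x + z) - φ x‖ₑ ^ 2 ≤ ‖z‖ₑ ^ 2 * ∫⁻ x, ‖fderiv ℝ φ x‖ₑ ^ 2 := by
  have hcf : Continuous (fderiv ℝ φ) := hφ.continuous_fderiv (by simp)
  have hpt : ∀ x, ‖φ (x + z) - φ x‖ₑ ^ 2 ≤
      ∫⁻ t in Set.Ioc (0 : ℝ) 1, ‖z‖ₑ ^ 2 * ‖fderiv ℝ φ (x + t • z)‖ₑ ^ 2 := by
    intro x
    have h1 : ∀ t : ℝ, HasDerivAt (fun t : ℝ => φ (x + t • z)) (fderiv ℝ φ (x + t • z) z) t := by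
      intro t
      have h2 : HasDerivAt (fun t : ℝ => x + t • z) z t := by
        simpa using ((hasDerivAt_id t).smul_const z).const_add x
      exact (hφ.differentiable (by simp) _).hasFDerivAt.comp_hasDerivAt t h2
    have h3 := enorm_sub_sq_le h1 (by fun_prop) zero_le_one
    simp only [one_smul, zero_smul, add_zero, sub_zero, ENNReal.ofReal_one, one_mul] at h3
    refine h3.trans (lintegral_mono fun t => ?_)
    rw [mul_comm, ← mul_pow]
    exact pow_le_pow_left' (ContinuousLinearMap.le_opENorm _ _) 2
  calc ∫⁻ x, ‖φ (x + z) - φ x‖ₑ ^ 2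
      ≤ ∫⁻ x, ∫⁻ t in Set.Ioc (0 : ℝ) 1, ‖z‖ₑ ^ 2 * ‖fderiv ℝ φ (x + t • z)‖ₑ ^ 2 :=
        lintegral_mono hpt
    _ = ∫⁻ t in Set.Ioc (0 : ℝ) 1, ∫⁻ x, ‖z‖ₑ ^ 2 * ‖fderiv ℝ φ (x + t • z)‖ₑ ^ 2 := by
        refine lintegral_lintegral_swap (Continuous.aemeasurable ?_)
        have : Continuous fun p : EuclideanSpace ℝ (Fin n) × ℝ => ‖fderiv ℝ φ (p.1 + p.2 • z)‖ₑ :=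
          (hcf.comp (by fun_prop)).enorm
        exact (ENNReal.continuous_const_mul (by simp)).comp ((ENNReal.continuous_pow 2).comp this)
    _ = ∫⁻ t in Set.Ioc (0 : ℝ) 1, ‖z‖ₑ ^ 2 * ∫⁻ x, ‖fderiv ℝ φ x‖ₑ ^ 2 := by
        refine lintegral_congr fun t => ?_
        rw [lintegral_const_mul' _ _ (by simp),
          lintegral_add_right_eq_self (fun x => ‖fderiv ℝ φ x‖ₑ ^ 2) (t • z)]
    _ = _ := by simp

lemma enorm_sq_eq_lintegral (w : VecL2 m Ω) :
    ‖w‖ₑ ^ 2 = ∫⁻ x in (Ω : Set (EuclideanSpace ℝ (Fin n))), ‖w x‖ₑ ^ 2 := by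
  rw [Lp.enorm_def, eLpNorm_two_sq]

lemma ofReal_norm_sq {F : Type*} [SeminormedAddCommGroup F] (w : F) :
    ENNReal.ofReal (‖w‖ ^ 2) = ‖w‖ₑ ^ 2 := by
  rw [ENNReal.ofReal_pow (norm_nonneg _), ofReal_norm]

lemma enorm_testLp_sq (φ : 𝓓(Ω, EuclideanSpace ℂ (Fin m))) :
    ‖testLp φ‖ₑ ^ 2 = ∫⁻ x in (Ω : Set (EuclideanSpace ℝ (Fin n))), ‖φ x‖ₑ ^ 2 := by
  rw [enorm_sq_eq_lintegral]
  exact lintegral_congr_ae ((coeFn_testLp φ).mono fun x hx => by simp only [hx])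

lemma lintegral_enorm_fderiv_sq_le (φ : 𝓓(Ω, EuclideanSpace ℂ (Fin m))) :
    ∫⁻ x, ‖fderiv ℝ φ x‖ₑ ^ 2 ≤ ENNReal.ofReal (∑ j, ‖testGrad φ j‖ ^ 2) := by
  have h1 : ∫⁻ x, ‖fderiv ℝ φ x‖ₑ ^ 2 =
      ∫⁻ x in (Ω : Set (EuclideanSpace ℝ (Fin n))), ‖fderiv ℝ φ x‖ₑ ^ 2 := by
    rw [← lintegral_indicator Ω.isOpen.measurableSet]
    refine lintegral_congr fun x => ?_
    by_cases hx : x ∈ (Ω : Set (EuclideanSpace ℝ (Fin n)))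
    · rw [Set.indicator_of_mem hx]
    · have h0 : ‖fderiv ℝ φ x‖ = 0 := by
        rw [fderiv_of_notMem_tsupport ℝ fun h => hx (φ.tsupport_subset h)]
        exact norm_zero
      rw [Set.indicator_of_notMem hx, ← ofReal_norm, h0, ENNReal.ofReal_zero, zero_pow two_ne_zero]
  rw [h1, ENNReal.ofReal_sum_of_nonneg fun _ _ => sq_nonneg _]
  refine (lintegral_mono fun x => enorm_fderiv_sq_le φ x).trans_eq ?_
  rw [lintegral_finsetSum' _ fun j _ =>
    ((continuous_pderiv_of_contDiff φ.contDiff j).enorm.aemeasurable.pow_const 2)]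
  refine Finset.sum_congr rfl fun j _ => ?_
  rw [ofReal_norm_sq, enorm_sq_eq_lintegral]
  exact lintegral_congr_ae ((coeFn_testGrad φ j).mono fun x hx => by simp only [hx])

/-- A translation longer than the diameter of Ω moves Ω off itself, so on Ω a test function equals,
up to sign, its own translation difference. -/
lemma poincare_inequality (hn : n ≠ 0)
    (hb : Bornology.IsBounded (Ω : Set (EuclideanSpace ℝ (Fin n)))) :
    ∃ C : ℝ, 0 < C ∧ ∀ u ∈ H10 m Ω, ‖u‖ ^ 2 ≤ C * gradNormSq u := by
  obtain ⟨R, hR, hΩ⟩ := hb.subset_ball_lt 0 0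
  have : NeZero n := ⟨hn⟩
  -- Ω lies in the open ball of radius R about 0, so a shift by 2R takes every point of Ω out of Ω.
  let z : EuclideanSpace ℝ (Fin n) := EuclideanSpace.single 0 (2 * R)
  have hz : ‖z‖ = 2 * R := by simp [z, abs_of_pos hR]
  refine ⟨‖z‖ ^ 2, by rw [hz]; positivity, fun u hu => ?_⟩
  refine H10_induction (s := {p | ‖p.1‖ ^ 2 ≤ ‖z‖ ^ 2 * ∑ j, ‖p.2 j‖ ^ 2})
    (isClosed_le (by fun_prop) (by fun_prop)) (fun φ => ?_) hu
  have h0 : 0 ≤ ∑ j, ‖testGrad φ j‖ ^ 2 := Finset.sum_nonneg fun _ _ => sq_nonneg _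
  have h1 : ∀ x ∈ (Ω : Set (EuclideanSpace ℝ (Fin n))),
      ‖φ x‖ₑ ^ 2 ≤ ‖φ (x + z) - φ x‖ₑ ^ 2 := by
    intro x hx
    have hxz : x + z ∉ tsupport φ := by
      intro h
      have h2 := mem_ball_zero_iff.1 (hΩ (φ.tsupport_subset h))
      have h3 := mem_ball_zero_iff.1 (hΩ hx)
      have h4 : ‖z‖ ≤ ‖x + z‖ + ‖x‖ := by
        calc ‖z‖ = ‖(x + z) - x‖ := by rw [add_sub_cancel_left]
          _ ≤ _ := norm_sub_le _ _
      linarith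
    rw [image_eq_zero_of_notMem_tsupport hxz, zero_sub, enorm_neg]
  refine (ENNReal.ofReal_le_ofReal_iff (by positivity)).1 ?_
  rw [ofReal_norm_sq, ENNReal.ofReal_mul (sq_nonneg _), ofReal_norm_sq]
  calc ‖testLp φ‖ₑ ^ 2 = ∫⁻ x in (Ω : Set (EuclideanSpace ℝ (Fin n))), ‖φ x‖ₑ ^ 2 :=
        enorm_testLp_sq φ
    _ ≤ ∫⁻ x in (Ω : Set (EuclideanSpace ℝ (Fin n))), ‖φ (x + z) - φ x‖ₑ ^ 2 :=
        setLIntegral_mono' Ω.isOpen.measurableSet h1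
    _ ≤ ∫⁻ x, ‖φ (x + z) - φ x‖ₑ ^ 2 := setLIntegral_le_lintegral _ _
    _ ≤ ‖z‖ₑ ^ 2 * ∫⁻ x, ‖fderiv ℝ φ x‖ₑ ^ 2 := lintegral_translate_sub_sq_le φ.contDiff z
    _ ≤ _ := by gcongr; exact lintegral_enorm_fderiv_sq_le φ

end Translation

/-! ### Rellich compactness by averaging over cubes. -/

section Rellich

variable {n m : ℕ} {Ω : TopologicalSpace.Opens (EuclideanSpace ℝ (Fin n))}

/-- The box in `ℝⁿ` with the given sides. -/
def box (s : Fin n → Set ℝ) : Set (EuclideanSpace ℝ (Fin n)) := {x | ∀ i, x i ∈ s i}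

lemma box_eq_preimage (s : Fin n → Set ℝ) : box s = WithLp.ofLp ⁻¹' (Set.univ.pi s) := by
  ext x
  simp [box]

lemma measurableSet_box {s : Fin n → Set ℝ} (hs : ∀ i, MeasurableSet (s i)) :
    MeasurableSet (box s) := by
  rw [box_eq_preimage]
  exact (PiLp.volume_preserving_ofLp (Fin n)).measurable (MeasurableSet.univ_pi hs)

lemma volume_box {s : Fin n → Set ℝ} (hs : ∀ i, MeasurableSet (s i)) :
    volume (box s) = ∏ i, volume (s i) := by
  rw [box_eq_preimage, (PiLp.volume_preserving_ofLp (Fin n)).measure_preimage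
    (MeasurableSet.univ_pi hs).nullMeasurableSet, volume_pi_pi]

/-- The half-open cube with side `h` and index `k`. -/
def cell (h : ℝ) (k : Fin n → ℤ) : Set (EuclideanSpace ℝ (Fin n)) :=
  box fun i => Set.Ico (h * k i) (h * k i + h)

lemma measurableSet_cell (h : ℝ) (k : Fin n → ℤ) : MeasurableSet (cell h k) :=
  measurableSet_box fun _ => measurableSet_Ico

lemma volume_cell (h : ℝ) (k : Fin n → ℤ) : volume (cell h k) = ENNReal.ofReal h ^ n := by
  rw [cell, volume_box fun _ => measurableSet_Ico]
  simp

lemma mem_cell_iff {h : ℝ} (hh : 0 < h) {k : Fin n → ℤ} {x : EuclideanSpace ℝ (Fin n)} :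
    x ∈ cell h k ↔ k = fun i => ⌊x i / h⌋ := by
  rw [funext_iff]
  refine forall_congr' fun i => ?_
  rw [eq_comm (a := k i), Int.floor_eq_iff, le_div_iff₀ hh, div_lt_iff₀ hh, Set.mem_Ico]
  rw [mul_comm h, add_mul, one_mul]

lemma finite_cells {h : ℝ} (hh : 0 < h) (hb : Bornology.IsBounded (Ω : Set (EuclideanSpace ℝ (Fin n)))) :
    {k : Fin n → ℤ | (cell h k ∩ (Ω : Set (EuclideanSpace ℝ (Fin n)))).Nonempty}.Finite := by
  obtain ⟨R, -, hΩ⟩ := hb.subset_ball_lt 0 0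
  refine (Set.finite_Icc (fun _ : Fin n => ⌊-R / h⌋) (fun _ => ⌊R / h⌋)).subset ?_
  rintro k ⟨x, hxk, hx⟩
  rw [mem_cell_iff hh] at hxk
  subst hxk
  have h1 : ∀ i, |x i| ≤ R := fun i =>
    (PiLp.norm_apply_le x i).trans (mem_ball_zero_iff.1 (hΩ hx)).le
  refine ⟨fun i => Int.floor_mono ?_, fun i => Int.floor_mono ?_⟩
  · exact div_le_div_of_nonneg_right (abs_le.1 (h1 i)).1 hh.le
  · exact div_le_div_of_nonneg_right (abs_le.1 (h1 i)).2 hh.le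

/-- The cube of differences of points in the same cell. -/
def diffCube (n : ℕ) (h : ℝ) : Set (EuclideanSpace ℝ (Fin n)) := box fun _ => Set.Icc (-h) h

lemma measurableSet_diffCube (h : ℝ) : MeasurableSet (diffCube n h) :=
  measurableSet_box fun _ => measurableSet_Icc

lemma volume_diffCube (h : ℝ) :
    volume (diffCube n h) = 2 ^ n * ENNReal.ofReal h ^ n := by
  rw [diffCube, volume_box fun _ => measurableSet_Icc]
  simp only [Real.volume_Icc, Finset.prod_const, Finset.card_univ, Fintype.card_fin, ← mul_pow]
  rw [sub_neg_eq_add, ← two_mul, ENNReal.ofReal_mul zero_le_two]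
  simp

lemma enorm_sq_le_of_mem_diffCube {h : ℝ} {z : EuclideanSpace ℝ (Fin n)}
    (hz : z ∈ diffCube n h) : ‖z‖ₑ ^ 2 ≤ ENNReal.ofReal (n * h ^ 2) := by
  rw [← ofReal_norm_sq, EuclideanSpace.norm_sq_eq]
  refine ENNReal.ofReal_le_ofReal ?_
  calc ∑ i, ‖z i‖ ^ 2 ≤ ∑ _i : Fin n, h ^ 2 := by
        refine Finset.sum_le_sum fun i _ => ?_
        rw [Real.norm_eq_abs, sq_abs]
        exact sq_le_sq' (hz i).1 (hz i).2
    _ = n * h ^ 2 := by simp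

/-- The cell averages of a function. -/
noncomputable def cellAverage (h : ℝ) (φ : EuclideanSpace ℝ (Fin n) → EuclideanSpace ℂ (Fin m))
    (k : Fin n → ℤ) : EuclideanSpace ℂ (Fin m) :=
  ∫ y, φ y ∂(ProbabilityTheory.cond volume (cell h k))

/-- By Cauchy–Schwarz the squared deviation from the mean is at most the mean of |φ(x) - φ(y)|² over
y in the cell. Putting y = x + z, the difference z runs within a cube that does not depend on x or
the cell, so the translation estimate applies after integration in x. -/
lemma enorm_sub_cellAverage_sq_le {h : ℝ} (hh : 0 < h)
    {φ : EuclideanSpace ℝ (Fin n) → EuclideanSpace ℂ (Fin m)} (hφ : Continuous φ)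
    (hc : HasCompactSupport φ) {k : Fin n → ℤ} {x : EuclideanSpace ℝ (Fin n)}
    (hx : x ∈ cell h k) : ‖φ x - cellAverage h φ k‖ₑ ^ 2 ≤
      (ENNReal.ofReal h ^ n)⁻¹ * ∫⁻ z in diffCube n h, ‖φ (x + z) - φ x‖ₑ ^ 2 := by
  have hV : volume (cell h k) ≠ 0 := by
    rw [volume_cell]
    exact pow_ne_zero _ (by simpa using hh)
  have hV' : volume (cell h k) ≠ ⊤ := by
    rw [volume_cell]
    exact ENNReal.pow_ne_top ENNReal.ofReal_ne_top
  have hprob : IsProbabilityMeasure (ProbabilityTheory.cond volume (cell h k)) :=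
    ProbabilityTheory.cond_isProbabilityMeasure_of_finite hV hV'
  have hint : Integrable φ (ProbabilityTheory.cond volume (cell h k)) :=
    ((hφ.integrable_of_hasCompactSupport hc).restrict).smul_measure (ENNReal.inv_ne_top.2 hV)
  have h1 : φ x - cellAverage h φ k =
      ∫ y, (φ x - φ y) ∂(ProbabilityTheory.cond volume (cell h k)) := by
    rw [integral_sub (integrable_const _) hint, integral_const, probReal_univ, one_smul]
    rfl
  calc ‖φ x - cellAverage h φ k‖ₑ ^ 2
      ≤ (∫⁻ y, ‖φ x - φ y‖ₑ ∂(ProbabilityTheory.cond volume (cell h k))) ^ 2 := by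
        rw [h1]
        exact pow_le_pow_left' (enorm_integral_le_lintegral_enorm _) 2
    _ ≤ ∫⁻ y, ‖φ x - φ y‖ₑ ^ 2 ∂(ProbabilityTheory.cond volume (cell h k)) := by
        refine (lintegral_sq_le (continuous_const.sub hφ).enorm.aemeasurable).trans_eq ?_
        rw [measure_univ, one_mul]
        rfl
    _ = (ENNReal.ofReal h ^ n)⁻¹ * ∫⁻ y in cell h k, ‖φ x - φ y‖ₑ ^ 2 := by
        rw [ProbabilityTheory.cond, lintegral_smul_measure, volume_cell, smul_eq_mul]
    _ ≤ _ := by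
        refine mul_le_mul_right ?_ _
        rw [← lintegral_indicator (measurableSet_cell h k), ← lintegral_indicator
          (measurableSet_diffCube h),
          ← lintegral_add_left_eq_self _ x]
        refine lintegral_mono fun z => ?_
        by_cases hz : x + z ∈ cell h k
        · have hz' : z ∈ diffCube n h := fun i => by
            have e1 := hz i
            have e2 := hx i
            simp only [PiLp.add_apply, Set.mem_Ico] at e1 e2
            constructor <;> linarith
          rw [Set.indicator_of_mem hz, Set.indicator_of_mem hz', enorm_sub_rev]
        · rw [Set.indicator_of_notMem hz]
          exact zero_le

/-- The space consists of functions constant on the finitely many grid cells that meet Ω.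
Integrating the cellwise bound and using the translation estimate for each z, the volume (2h)ⁿ of
the difference cube cancels h⁻ⁿ and leaves 2ⁿ. -/
lemma exists_finiteDimensional_approx {h : ℝ} (hh : 0 < h)
    (hb : Bornology.IsBounded (Ω : Set (EuclideanSpace ℝ (Fin n)))) :
    ∃ W : Submodule ℂ (VecL2 m Ω), FiniteDimensional ℂ W ∧
      ∀ φ : 𝓓(Ω, EuclideanSpace ℂ (Fin m)), ∃ w ∈ W,
        ‖testLp φ - w‖ ^ 2 ≤ 2 ^ n * (n * h ^ 2) * ∑ j, ‖testGrad φ j‖ ^ 2 := by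
  let ν := volume.restrict (Ω : Set (EuclideanSpace ℝ (Fin n)))
  have hν : ∀ k : Fin n → ℤ, ν (cell h k) ≠ ⊤ := fun k => by
    refine ((Measure.restrict_apply_le _ _).trans_lt ?_).ne
    rw [volume_cell]
    exact ENNReal.pow_lt_top ENNReal.ofReal_lt_top
  have hfin := finite_cells (Ω := Ω) hh hb
  let K := hfin.toFinset
  let L : (Fin n → ℤ) → EuclideanSpace ℂ (Fin m) → VecL2 m Ω := fun k c =>
    indicatorConstLp 2 (measurableSet_cell h k) (hν k) c
  have hL : ∀ k c, L k c = ∑ α, c α • L k (EuclideanSpace.single α 1) := by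
    intro k c
    refine Lp.ext ?_
    filter_upwards [indicatorConstLp_coeFn (p := 2) (hs := measurableSet_cell h k) (hμs := hν k)
        (c := c), Lp.coeFn_finsetSum Finset.univ fun α => c α • L k (EuclideanSpace.single α 1),
      ae_all_iff.2 fun α => Lp.coeFn_smul (c α) (L k (EuclideanSpace.single α 1)),
      ae_all_iff.2 fun α => indicatorConstLp_coeFn (p := 2) (hs := measurableSet_cell h k)
        (hμs := hν k) (c := (EuclideanSpace.single α 1 : EuclideanSpace ℂ (Fin m)))]
      with x h1 h2 h3 h4
    rw [h1, h2, Finset.sum_apply]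
    simp_rw [h3, Pi.smul_apply, L, h4]
    by_cases hx : x ∈ cell h k
    · simp only [Set.indicator_of_mem hx]
      ext γ
      simp [Pi.single_apply]
    · simp [Set.indicator_of_notMem hx]
  let W : Submodule ℂ (VecL2 m Ω) := Submodule.span ℂ
    (Set.range fun p : K × Fin m => L p.1 (EuclideanSpace.single p.2 1))
  refine ⟨W, FiniteDimensional.span_of_finite ℂ (Set.finite_range _), fun φ => ?_⟩
  refine ⟨∑ k ∈ K, L k (cellAverage h φ k), sum_mem fun k hk => ?_, ?_⟩
  · rw [hL]
    exact sum_mem fun α _ => Submodule.smul_mem _ _ (Submodule.subset_span ⟨(⟨k, hk⟩, α), rfl⟩)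
  · refine (ENNReal.ofReal_le_ofReal_iff
      (by have : 0 ≤ ∑ j, ‖testGrad φ j‖ ^ 2 := Finset.sum_nonneg fun _ _ => sq_nonneg _
          positivity)).1 ?_
    rw [ofReal_norm_sq, enorm_sq_eq_lintegral, ENNReal.ofReal_mul (by positivity),
      ENNReal.ofReal_mul (by positivity)]
    have hw : ∀ᵐ x ∂ν, ‖(testLp φ - ∑ k ∈ K, L k (cellAverage h φ k) : VecL2 m Ω) x‖ₑ ^ 2 ≤
        (ENNReal.ofReal h ^ n)⁻¹ * ∫⁻ z in diffCube n h, ‖φ (x + z) - φ x‖ₑ ^ 2 := by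
      filter_upwards [Lp.coeFn_sub (testLp φ) (∑ k ∈ K, L k (cellAverage h φ k)),
        Lp.coeFn_finsetSum K fun k => L k (cellAverage h φ k),
        ae_all_iff.2 fun k => indicatorConstLp_coeFn (p := 2) (hs := measurableSet_cell h k)
          (hμs := hν k) (c := cellAverage h φ k), coeFn_testLp φ,
        ae_restrict_mem Ω.isOpen.measurableSet] with x h1 h2 h3 h4 hx
      have hmem : x ∈ cell h fun i => ⌊x i / h⌋ := (mem_cell_iff hh).2 rfl
      have hK : (fun i => ⌊x i / h⌋) ∈ K := hfin.mem_toFinset.2 ⟨x, hmem, hx⟩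
      rw [h1, Pi.sub_apply, h2, h4, Finset.sum_apply]
      simp_rw [L, h3]
      rw [Finset.sum_eq_single_of_mem _ hK fun k _ hk => Set.indicator_of_notMem
        (fun hxk => hk ((mem_cell_iff hh).1 hxk)) _, Set.indicator_of_mem hmem]
      exact enorm_sub_cellAverage_sq_le hh φ.contDiff.continuous φ.hasCompactSupport hmem
    have hne : (ENNReal.ofReal h ^ n) ≠ 0 := pow_ne_zero _ (by simpa using hh)
    have hnt : (ENNReal.ofReal h ^ n) ≠ ⊤ := ENNReal.pow_ne_top ENNReal.ofReal_ne_top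
    calc ∫⁻ x, ‖(testLp φ - ∑ k ∈ K, L k (cellAverage h φ k) : VecL2 m Ω) x‖ₑ ^ 2 ∂ν
        ≤ ∫⁻ x, (ENNReal.ofReal h ^ n)⁻¹ *
            (∫⁻ z in diffCube n h, ‖φ (x + z) - φ x‖ₑ ^ 2) ∂ν := lintegral_mono_ae hw
      _ ≤ ∫⁻ x, (ENNReal.ofReal h ^ n)⁻¹ *
            ∫⁻ z in diffCube n h, ‖φ (x + z) - φ x‖ₑ ^ 2 := setLIntegral_le_lintegral _ _
      _ = (ENNReal.ofReal h ^ n)⁻¹ *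
            ∫⁻ z in diffCube n h, ∫⁻ x, ‖φ (x + z) - φ x‖ₑ ^ 2 := by
          rw [lintegral_const_mul' _ _ (ENNReal.inv_ne_top.2 hne), lintegral_lintegral_swap]
          have hcφ := φ.contDiff.continuous
          refine Continuous.aemeasurable ?_
          have : Continuous fun p : EuclideanSpace ℝ (Fin n) × EuclideanSpace ℝ (Fin n) =>
            ‖φ (p.1 + p.2) - φ p.1‖ₑ := by fun_prop
          exact (ENNReal.continuous_pow 2).comp this
      _ ≤ (ENNReal.ofReal h ^ n)⁻¹ * ∫⁻ z in diffCube n h, ENNReal.ofReal (n * h ^ 2) *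
            ENNReal.ofReal (∑ j, ‖testGrad φ j‖ ^ 2) := by
          refine mul_le_mul_right (setLIntegral_mono' (measurableSet_diffCube h) fun z hz => ?_) _
          refine (lintegral_translate_sub_sq_le φ.contDiff z).trans ?_
          gcongr
          · exact enorm_sq_le_of_mem_diffCube hz
          · exact lintegral_enorm_fderiv_sq_le φ
      _ = _ := by
          rw [setLIntegral_const, volume_diffCube h, ENNReal.ofReal_pow zero_le_two]
          simp only [ENNReal.ofReal_ofNat]
          have hcancel := ENNReal.inv_mul_cancel hne hnt
          generalize ENNReal.ofReal h ^ n = V at hcancel ⊢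
          generalize ENNReal.ofReal (n * h ^ 2) = a
          generalize ENNReal.ofReal (∑ j, ‖testGrad φ j‖ ^ 2) = b
          calc V⁻¹ * (a * b * (2 ^ n * V)) = (V⁻¹ * V) * (2 ^ n * a * b) := by ring
            _ = _ := by rw [hcancel, one_mul]

/-- The Rellich compactness theorem. -/
lemma isCompactOperator_of_gradNormSq_le
    (hb : Bornology.IsBounded (Ω : Set (EuclideanSpace ℝ (Fin n)))) {E : Type*}
    [NormedAddCommGroup E] [NormedSpace ℂ E] (J : E →L[ℂ] VecL2 m Ω) (hJ : ∀ u, J u ∈ H10 m Ω)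
    {a : ℝ} (ha : 0 < a) (hgrad : ∀ u, a * gradNormSq (J u) ≤ ‖u‖ ^ 2) : IsCompactOperator J := by
  have hpos : ∀ k : ℕ, (0 : ℝ) < 1 / ((k : ℝ) + 1) := fun k => Nat.one_div_pos_of_nat
  choose W hW hWφ using fun k : ℕ => exists_finiteDimensional_approx (m := m) (hpos k) hb
  -- The orthogonal projection is at least as good as the cell averages. Unlike them, it is here a
  -- continuous operator on all of L², so the estimate extends to H¹₀ by closure.
  have happrox : ∀ k, ∀ u ∈ H10 m Ω, ‖u - (W k).starProjection u‖ ^ 2 ≤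
      2 ^ n * (n * (1 / ((k : ℝ) + 1)) ^ 2) * gradNormSq u := by
    intro k u hu
    refine H10_induction (s := {p | ‖p.1 - (W k).starProjection p.1‖ ^ 2 ≤
      2 ^ n * (n * (1 / ((k : ℝ) + 1)) ^ 2) * ∑ j, ‖p.2 j‖ ^ 2})
      (isClosed_le (by fun_prop) (by fun_prop)) (fun φ => ?_) hu
    obtain ⟨w, hw, h1⟩ := hWφ k φ
    refine le_trans (pow_le_pow_left₀ (norm_nonneg _) ?_ 2) h1
    rw [Submodule.starProjection_minimal]
    exact ciInf_le ⟨0, Set.forall_mem_range.mpr fun _ => norm_nonneg _⟩ (⟨w, hw⟩ : W k)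
  -- J is the norm limit of the finite-rank operators obtained by projecting to the spaces of grid
  -- size 1/(k + 1).
  refine isCompactOperator_of_tendsto (l := atTop)
    (F := fun k : ℕ => (W k).subtypeL ∘L ((W k).orthogonalProjectionOnto ∘L J)) ?_
    (.of_forall fun k => ?_)
  · rw [tendsto_iff_norm_sub_tendsto_zero]
    refine squeeze_zero (fun _ => norm_nonneg _) (g := fun k : ℕ =>
      Real.sqrt (2 ^ n * n / a) * (1 / ((k : ℝ) + 1))) (fun k => ?_) ?_
    · refine ContinuousLinearMap.opNorm_le_bound _ (by have := hpos k; positivity) fun u => ?_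
      rw [_root_.sub_apply, norm_sub_rev]
      refine abs_le_of_sq_le_sq' ?_ (by have := hpos k; positivity) |>.2
      refine (happrox k _ (hJ u)).trans ?_
      rw [mul_pow, mul_pow, Real.sq_sqrt (by positivity), div_mul_eq_mul_div, div_mul_eq_mul_div,
        le_div_iff₀ ha]
      have := mul_le_mul_of_nonneg_left (hgrad u)
        (by positivity : (0:ℝ) ≤ 2 ^ n * n * (1 / ((k : ℝ) + 1)) ^ 2)
      linarith
    · simpa using tendsto_one_div_add_atTop_nhds_zero_nat.const_mul (Real.sqrt (2 ^ n * n / a))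
  · have := hW k
    exact (isCompactOperator_id.comp_clm ((W k).orthogonalProjectionOnto ∘L J)).clm_comp (W k).subtypeL

end Rellich

/-! ### Mass of a smooth function near a Lipschitz boundary. -/

section StripEstimate

variable {n : ℕ}

/-- The point with coordinates `(y, s)` in the coordinate system given by the rigid motion `T`. -/
noncomputable def chartPoint (T : EuclideanSpace ℝ (Fin n) ≃ᵢ WithLp 2 (EuclideanSpace ℝ (Fin (n - 1)) × ℝ))
    (p : EuclideanSpace ℝ (Fin (n - 1)) × ℝ) : EuclideanSpace ℝ (Fin n) :=
  T.symm (WithLp.toLp 2 p)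

variable (T : EuclideanSpace ℝ (Fin n) ≃ᵢ WithLp 2 (EuclideanSpace ℝ (Fin (n - 1)) × ℝ))

lemma apply_chartPoint (p : EuclideanSpace ℝ (Fin (n - 1)) × ℝ) :
    T (chartPoint T p) = WithLp.toLp 2 p :=
  T.apply_symm_apply _

lemma continuous_chartPoint : Continuous (chartPoint T) :=
  T.symm.continuous.comp (WithLp.prod_continuous_toLp 2 _ _)

lemma measurePreserving_chartPoint :
    MeasurePreserving (chartPoint T) (volume.prod volume) volume := by
  have h1 : MeasurePreserving T.symm := by
    have h2 : (T.symm : _ → EuclideanSpace ℝ (Fin n)) =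
        (fun x => x + T.symm 0) ∘ T.symm.toRealLinearIsometryEquiv := by
      funext x
      simp
    rw [h2]
    exact (measurePreserving_add_right volume (T.symm 0)).comp
      (LinearIsometryEquiv.measurePreserving _)
  exact h1.comp (WithLp.volume_preserving_toLp _ _)

/-- The vertical direction. -/
noncomputable def vertical : EuclideanSpace ℝ (Fin n) :=
  T.symm.toRealLinearIsometryEquiv (WithLp.toLp 2 (0, 1))

lemma norm_vertical : ‖vertical T‖ = 1 := by
  rw [vertical, LinearIsometryEquiv.norm_map, WithLp.prod_norm_eq_of_L2]
  simp

lemma chartPoint_eq_add (y : EuclideanSpace ℝ (Fin (n - 1))) (s t : ℝ) :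
    chartPoint T (y, t) = chartPoint T (y, s) + (t - s) • vertical T := by
  have h1 : ∀ p, chartPoint T p = T.symm.toRealLinearIsometryEquiv (WithLp.toLp 2 p) + T.symm 0 :=
    fun p => by simp [chartPoint]
  have h2 : (WithLp.toLp 2 (y, t) : WithLp 2 (EuclideanSpace ℝ (Fin (n - 1)) × ℝ)) =
      WithLp.toLp 2 (y, s) + (t - s) • WithLp.toLp 2 (0, 1) := by
    rw [← WithLp.toLp_smul, ← WithLp.toLp_add]
    simp
  rw [h1, h1, h2, map_add, map_smul, vertical]
  abel

lemma dist_chartPoint (y : EuclideanSpace ℝ (Fin (n - 1))) (s t : ℝ) :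
    dist (chartPoint T (y, t)) (chartPoint T (y, s)) = |t - s| := by
  rw [chartPoint_eq_add T y s t, dist_eq_norm, add_sub_cancel_left, norm_smul, norm_vertical,
    mul_one, Real.norm_eq_abs]

lemma dist_fst_le (x z : EuclideanSpace ℝ (Fin n)) : dist (T x).fst (T z).fst ≤ dist x z := by
  rw [← T.dist_eq x z, WithLp.prod_dist_eq_of_L2]
  exact Real.le_sqrt_of_sq_le (le_add_of_nonneg_right (sq_nonneg _))

lemma dist_snd_le (x z : EuclideanSpace ℝ (Fin n)) : dist (T x).snd (T z).snd ≤ dist x z := by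
  rw [← T.dist_eq x z, WithLp.prod_dist_eq_of_L2]
  exact Real.le_sqrt_of_sq_le (le_add_of_nonneg_left (sq_nonneg _))

/-- The points of `Ω` at distance less than `δ` from the complement. -/
def strip (Ω : Set (EuclideanSpace ℝ (Fin n))) (δ : ℝ) : Set (EuclideanSpace ℝ (Fin n)) :=
  Ω ∩ {x | Metric.infDist x Ωᶜ < δ}

lemma measurableSet_strip {Ω : Set (EuclideanSpace ℝ (Fin n))} (hΩ : IsOpen Ω) (δ : ℝ) :
    MeasurableSet (strip Ω δ) :=
  (hΩ.inter (isOpen_lt (Metric.continuous_infDist_pt _) continuous_const)).measurableSet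

/-- The points of `Ω` near the part of the boundary that is well inside of `O`. -/
def localStrip (Ω O : Set (EuclideanSpace ℝ (Fin n))) (ρ δ : ℝ) :
    Set (EuclideanSpace ℝ (Fin n)) :=
  Ω ∩ ⋃ z ∈ {z | z ∈ frontier Ω ∧ Metric.ball z ρ ⊆ O}, Metric.ball z δ

lemma measurableSet_localStrip {Ω O : Set (EuclideanSpace ℝ (Fin n))} (hΩ : IsOpen Ω) (ρ δ : ℝ) :
    MeasurableSet (localStrip Ω O ρ δ) :=
  (hΩ.inter (isOpen_biUnion fun _ _ => Metric.isOpen_ball)).measurableSet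

variable {T}

/-- A point x of Ω within δ of a boundary point z lies above the graph at height less than (1 + K)δ:
z is not above the graph, and moving from z to x costs δ vertically and Kδ through the slope. The
segment down to the graph therefore stays within (2 + K)δ of z, hence in the chart. -/
lemma mem_localStrip_chart {Ω O : Set (EuclideanSpace ℝ (Fin n))} (hΩ : IsOpen Ω)
    {g : EuclideanSpace ℝ (Fin (n - 1)) → ℝ} {K : ℝ≥0} (hg : LipschitzWith K g)
    (hO : O ∩ Ω = O ∩ {x | g (T x).fst < (T x).snd}) {ρ δ : ℝ} (hρ : (2 + K) * δ ≤ ρ)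
    {y : EuclideanSpace ℝ (Fin (n - 1))} {t : ℝ}
    (hx : chartPoint T (y, t) ∈ localStrip Ω O ρ δ) :
    g y < t ∧ t < g y + (1 + K) * δ ∧
      (∀ s ∈ Set.Ioc (g y) t, chartPoint T (y, s) ∈ strip Ω ((2 + K) * δ)) ∧
      chartPoint T (y, g y) ∈ frontier Ω := by
  obtain ⟨hxΩ, hx⟩ := hx
  simp only [Set.mem_iUnion, Set.mem_ofPred_eq, exists_prop] at hx
  obtain ⟨z, ⟨hz, hball⟩, hxz⟩ := hx
  rw [Metric.mem_ball] at hxz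
  have hδ : 0 < δ := dist_nonneg.trans_lt hxz
  have hK : (0 : ℝ) ≤ K := K.2
  have hzΩ : z ∉ Ω := fun h => by
    rw [frontier, hΩ.interior_eq] at hz
    exact hz.2 h
  have hiff : ∀ w ∈ O, (w ∈ Ω ↔ g (T w).fst < (T w).snd) := fun w hw => by
    have := Set.ext_iff.1 hO w
    simpa [hw] using this
  have hmemO : ∀ w, dist w z < (2 + K) * δ → w ∈ O := fun w hw =>
    hball (Metric.mem_ball.2 (hw.trans_le hρ))
  have h2 : δ ≤ (2 + K) * δ := by nlinarith
  have hxO : chartPoint T (y, t) ∈ O := hmemO _ (hxz.trans_le h2)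
  have hzO : z ∈ O := hmemO _ (by rw [dist_self]; positivity)
  have h3 : g y < t := by
    have := (hiff _ hxO).1 hxΩ
    rwa [apply_chartPoint] at this
  have h4 : (T z).snd ≤ g (T z).fst := not_lt.1 fun h => hzΩ ((hiff z hzO).2 h)
  have h5 := dist_fst_le T (chartPoint T (y, t)) z
  have h6 := dist_snd_le T (chartPoint T (y, t)) z
  rw [apply_chartPoint] at h5 h6
  have h7 : t < g y + (1 + K) * δ := by
    have e1 := hg.dist_le_mul (T z).fst y
    rw [dist_comm (T z).fst] at e1
    have e2 : (K : ℝ) * dist y (T z).fst ≤ K * δ :=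
      mul_le_mul_of_nonneg_left (h5.trans hxz.le) hK
    rw [Real.dist_eq] at e1 h6
    have e3 := (abs_le.1 h6).2
    have e4 := (abs_le.1 e1).2
    change t - (T z).snd ≤ _ at e3
    linarith
  have hdist : ∀ s ∈ Set.Icc (g y) t, dist (chartPoint T (y, s)) z < (2 + K) * δ := by
    intro s hs
    have e1 := dist_triangle (chartPoint T (y, s)) (chartPoint T (y, t)) z
    rw [dist_chartPoint, abs_of_nonpos (by linarith [hs.2])] at e1
    have := hs.1
    linarith
  have hmem : ∀ s ∈ Set.Ioc (g y) t, chartPoint T (y, s) ∈ Ω := fun s hs => by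
    rw [hiff _ (hmemO _ (hdist s ⟨hs.1.le, hs.2⟩)), apply_chartPoint]
    exact hs.1
  refine ⟨h3, h7, fun s hs => ⟨hmem s hs, ?_⟩, ?_⟩
  · exact (Metric.infDist_le_dist_of_mem hzΩ).trans_lt (hdist s ⟨hs.1.le, hs.2⟩)
  -- The foot of the segment is a limit of points of Ω, yet not in Ω, since the chart requires
  -- strict inequality.
  · rw [frontier, hΩ.interior_eq]
    refine ⟨?_, fun h => ?_⟩
    · have hlim : Tendsto (fun s => chartPoint T (y, s)) (𝓝[>] (g y))
          (𝓝 (chartPoint T (y, g y))) :=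
        (((continuous_chartPoint T).comp (by fun_prop : Continuous fun s : ℝ => (y, s))).tendsto
          (g y)).mono_left nhdsWithin_le_nhds
      exact mem_closure_of_tendsto hlim (by
        filter_upwards [Ioc_mem_nhdsGT h3] with s hs using hmem s hs)
    · have := (hiff _ (hmemO _ (hdist (g y) ⟨le_rfl, h3.le⟩))).1 h
      rw [apply_chartPoint] at this
      exact lt_irrefl _ this

variable {F : Type*} [NormedAddCommGroup F] [NormedSpace ℝ F] [CompleteSpace F]

lemma enorm_sub_chartPoint_sq_le {φ : EuclideanSpace ℝ (Fin n) → F} (hφ : ContDiff ℝ ∞ φ)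
    (y : EuclideanSpace ℝ (Fin (n - 1))) {a b : ℝ} (hab : a ≤ b) :
    ‖φ (chartPoint T (y, b)) - φ (chartPoint T (y, a))‖ₑ ^ 2 ≤
      ENNReal.ofReal (b - a) * ∫⁻ s in Set.Ioc a b, ‖fderiv ℝ φ (chartPoint T (y, s))‖ₑ ^ 2 := by
  have hcf : Continuous (fderiv ℝ φ) := hφ.continuous_fderiv (by simp)
  have hct : Continuous fun s : ℝ => chartPoint T (y, s) :=
    (continuous_chartPoint T).comp (by fun_prop)
  have h1 : ∀ t : ℝ, HasDerivAt (fun t : ℝ => φ (chartPoint T (y, t)))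
      (fderiv ℝ φ (chartPoint T (y, t)) (vertical T)) t := by
    intro t
    have h2 : HasDerivAt (fun t : ℝ => chartPoint T (y, t)) (vertical T) t := by
      have h3 : (fun t : ℝ => chartPoint T (y, t)) =
          fun t => chartPoint T (y, 0) + t • vertical T := by
        funext t
        rw [chartPoint_eq_add T y 0 t, sub_zero]
      rw [h3]
      simpa using ((hasDerivAt_id t).smul_const (vertical T)).const_add (chartPoint T (y, 0))
    exact (hφ.differentiable (by simp) _).hasFDerivAt.comp_hasDerivAt t h2
  refine (enorm_sub_sq_le h1 ((hcf.comp hct).clm_apply continuous_const) hab).trans ?_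
  refine mul_le_mul_right (lintegral_mono fun s => pow_le_pow_left' ?_ 2) _
  refine (ContinuousLinearMap.le_opENorm _ _).trans_eq ?_
  rw [← ofReal_norm (vertical T), norm_vertical, ENNReal.ofReal_one, mul_one]

lemma enorm_sq_le_two_mul {F : Type*} [NormedAddCommGroup F] (a b : F) : ‖a‖ₑ ^ 2 ≤ 2 * (‖b‖ₑ ^ 2 + ‖a - b‖ₑ ^ 2) := by
  have h1 : ‖a‖ ^ 2 ≤ 2 * (‖b‖ ^ 2 + ‖a - b‖ ^ 2) := by
    have h2 : ‖a‖ ≤ ‖b‖ + ‖a - b‖ := by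
      simpa using norm_add_le b (a - b)
    have h3 := pow_le_pow_left₀ (norm_nonneg a) h2 2
    nlinarith [sq_nonneg (‖b‖ - ‖a - b‖)]
  have h4 := ENNReal.ofReal_le_ofReal h1
  rw [ENNReal.ofReal_mul zero_le_two, ENNReal.ofReal_add (sq_nonneg _) (sq_nonneg _),
    ofReal_norm_sq, ofReal_norm_sq, ofReal_norm_sq] at h4
  simpa using h4

/-- The proportionality factor between the Lebesgue measure and the Hausdorff measure. -/
noncomputable def hausdorffFactor (n : ℕ) : ℝ≥0 :=
  Measure.addHaarScalarFactor (volume : Measure (EuclideanSpace ℝ (Fin (n - 1))))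
    (Measure.hausdorffMeasure ((n - 1 : ℕ) : ℝ))

lemma volume_eq_smul_hausdorffMeasure (hn : 1 ≤ n) :
    (volume : Measure (EuclideanSpace ℝ (Fin (n - 1)))) =
      hausdorffFactor n • Measure.hausdorffMeasure ((n : ℝ) - 1) := by
  have h : ((n : ℝ) - 1) = ((n - 1 : ℕ) : ℝ) := by rw [Nat.cast_sub hn, Nat.cast_one]
  rw [h]
  exact Measure.isAddLeftInvariant_eq_smul _ _

/-- The graph of a Lipschitz function projects to Lebesgue measure with bounded density. -/
lemma map_graph_le (hn : 1 ≤ n) {Ω : TopologicalSpace.Opens (EuclideanSpace ℝ (Fin n))}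
    {g : EuclideanSpace ℝ (Fin (n - 1)) → ℝ} (hg : Continuous g) :
    Measure.map (fun y => chartPoint T (y, g y))
        (volume.restrict {y | chartPoint T (y, g y) ∈
          frontier (Ω : Set (EuclideanSpace ℝ (Fin n)))}) ≤
      hausdorffFactor n • surfaceMeasure Ω := by
  have hp : Continuous fun y => chartPoint T (y, g y) :=
    (continuous_chartPoint T).comp (by fun_prop)
  refine Measure.le_iff.2 fun s hs => ?_
  rw [Measure.map_apply hp.measurable hs, Measure.restrict_apply (hp.measurable hs),
    volume_eq_smul_hausdorffMeasure hn, Measure.smul_apply, Measure.smul_apply, surfaceMeasure,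
    Measure.restrict_apply hs]
  -- The projection along the vertical direction is 1-Lipschitz and does not increase Hausdorff
  -- measure. Only this inequality is needed, so no area formula enters.
  refine smul_le_smul_of_nonneg_left ?_ zero_le
  have hlip : LipschitzWith 1 fun x : EuclideanSpace ℝ (Fin n) => (T x).fst :=
    LipschitzWith.mk_one fun x z => dist_fst_le T x z
  have hd : (0 : ℝ) ≤ (n : ℝ) - 1 := by
    have : (1 : ℝ) ≤ n := by exact_mod_cast hn
    linarith
  calc Measure.hausdorffMeasure ((n : ℝ) - 1) ((fun y => chartPoint T (y, g y)) ⁻¹' s ∩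
        {y | chartPoint T (y, g y) ∈ frontier (Ω : Set (EuclideanSpace ℝ (Fin n)))})
      ≤ Measure.hausdorffMeasure ((n : ℝ) - 1) ((fun x => (T x).fst) ''
          (s ∩ frontier (Ω : Set (EuclideanSpace ℝ (Fin n))))) := by
        refine measure_mono fun y hy => ⟨chartPoint T (y, g y), hy, ?_⟩
        simp only [apply_chartPoint]
        rfl
    _ ≤ _ := by
        refine (hlip.hausdorffMeasure_image_le hd _).trans_eq ?_
        simp

/-- In chart coordinates, φ at a point of the strip is its value at the foot of the vertical segment
plus the integral of a derivative. The resulting bound is independent of the height, so integrating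
over heights contributes one factor (1 + K)δ and Cauchy–Schwarz contributes the second one in the
gradient term. -/
lemma lintegral_localStrip_le (hn : 1 ≤ n) {Ω : TopologicalSpace.Opens (EuclideanSpace ℝ (Fin n))}
    {O : Set (EuclideanSpace ℝ (Fin n))}
    {g : EuclideanSpace ℝ (Fin (n - 1)) → ℝ} {K : ℝ≥0} (hg : LipschitzWith K g)
    (hO : O ∩ Ω = O ∩ {x | g (T x).fst < (T x).snd}) {ρ δ : ℝ} (hρ : (2 + K) * δ ≤ ρ)
    {φ : EuclideanSpace ℝ (Fin n) → F} (hφ : ContDiff ℝ ∞ φ) :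
    ∫⁻ x in localStrip Ω O ρ δ, ‖φ x‖ₑ ^ 2 ≤ ENNReal.ofReal ((1 + K) * δ) *
      (2 * (hausdorffFactor n * ∫⁻ x, ‖φ x‖ₑ ^ 2 ∂(surfaceMeasure Ω) +
        ENNReal.ofReal ((1 + K) * δ) *
          ∫⁻ x in strip Ω ((2 + K) * δ), ‖fderiv ℝ φ x‖ₑ ^ 2)) := by
  have hp : Continuous fun y => chartPoint T (y, g y) :=
    (continuous_chartPoint T).comp (by have := hg.continuous; fun_prop)
  have hcf : Continuous (fderiv ℝ φ) := hφ.continuous_fderiv (by simp)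
  have hmφ : Measurable fun x => ‖φ x‖ₑ ^ 2 := hφ.continuous.enorm.measurable.pow_const 2
  have hmd : Measurable fun x => ‖fderiv ℝ φ x‖ₑ ^ 2 := hcf.enorm.measurable.pow_const 2
  let M : ℝ := (1 + K) * δ
  let B : Set (EuclideanSpace ℝ (Fin (n - 1))) := {y | chartPoint T (y, g y) ∈
    frontier (Ω : Set (EuclideanSpace ℝ (Fin n)))}
  have hB : MeasurableSet B := (isClosed_frontier.preimage hp).measurableSet
  let b : EuclideanSpace ℝ (Fin (n - 1)) → ℝ≥0∞ := B.indicator fun y =>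
    ‖φ (chartPoint T (y, g y))‖ₑ ^ 2
  let d : EuclideanSpace ℝ (Fin n) → ℝ≥0∞ :=
    (strip Ω ((2 + K) * δ)).indicator fun x => ‖fderiv ℝ φ x‖ₑ ^ 2
  have hmeasd : Measurable d := hmd.indicator (measurableSet_strip Ω.isOpen _)
  have hmeasdT : Measurable fun p => d (chartPoint T p) :=
    hmeasd.comp (continuous_chartPoint T).measurable
  have hmeasb : Measurable b := (hmφ.comp hp.measurable).indicator hB
  let I : EuclideanSpace ℝ (Fin (n - 1)) → ℝ≥0∞ := fun y => ∫⁻ s, d (chartPoint T (y, s))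
  have hmeasI : Measurable I := hmeasdT.lintegral_prod_right'
  have hpt : ∀ y t, (localStrip (Ω : Set (EuclideanSpace ℝ (Fin n))) O ρ δ).indicator
      (fun x => ‖φ x‖ₑ ^ 2) (chartPoint T (y, t)) ≤
        (Set.Ioc (g y) (g y + M)).indicator
          (fun _ => 2 * (b y + ENNReal.ofReal M * I y)) t := by
    intro y t
    by_cases hx : chartPoint T (y, t) ∈ localStrip (Ω : Set (EuclideanSpace ℝ (Fin n))) O ρ δ
    · obtain ⟨h1, h2, h3, h4⟩ := mem_localStrip_chart Ω.isOpen hg hO hρ hx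
      have hmem : t ∈ Set.Ioc (g y) (g y + M) := ⟨h1, h2.le⟩
      rw [Set.indicator_of_mem hx, Set.indicator_of_mem hmem]
      refine (enorm_sq_le_two_mul _ (φ (chartPoint T (y, g y)))).trans ?_
      have hb : b y = ‖φ (chartPoint T (y, g y))‖ₑ ^ 2 := 
        Set.indicator_of_mem (s := B) h4 _
      rw [hb]
      gcongr
      refine (enorm_sub_chartPoint_sq_le hφ y h1.le).trans ?_
      gcongr
      · change t - g y ≤ (1 + K) * δ
        linarith
      · rw [← lintegral_indicator measurableSet_Ioc]
        refine lintegral_mono fun s => ?_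
        by_cases hs : s ∈ Set.Ioc (g y) t
        · rw [Set.indicator_of_mem hs]
          exact (Set.indicator_of_mem (h3 s hs) (fun x => ‖fderiv ℝ φ x‖ₑ ^ 2)).ge
        · rw [Set.indicator_of_notMem hs]
          exact zero_le
    · rw [Set.indicator_of_notMem hx]
      exact zero_le
  have hmeasl : Measurable ((localStrip (Ω : Set (EuclideanSpace ℝ (Fin n))) O ρ δ).indicator
      fun x => ‖φ x‖ₑ ^ 2) := hmφ.indicator (measurableSet_localStrip Ω.isOpen _ _)
  have hbint : ∫⁻ y, b y ≤ hausdorffFactor n * ∫⁻ x, ‖φ x‖ₑ ^ 2 ∂(surfaceMeasure Ω) := by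
    rw [lintegral_indicator hB, ← lintegral_map (f := fun x => ‖φ x‖ₑ ^ 2) hmφ hp.measurable]
    refine (lintegral_mono' (map_graph_le hn hg.continuous) le_rfl).trans_eq ?_
    rw [lintegral_smul_measure]
    rfl
  have hIint : ∫⁻ y, I y = ∫⁻ x in strip Ω ((2 + K) * δ), ‖fderiv ℝ φ x‖ₑ ^ 2 := by
    rw [← lintegral_indicator (measurableSet_strip Ω.isOpen _),
      ← (measurePreserving_chartPoint T).lintegral_comp hmeasd,
      lintegral_prod _ hmeasdT.aemeasurable]
  calc ∫⁻ x in localStrip Ω O ρ δ, ‖φ x‖ₑ ^ 2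
      = ∫⁻ y, ∫⁻ t, (localStrip (Ω : Set (EuclideanSpace ℝ (Fin n))) O ρ δ).indicator
          (fun x => ‖φ x‖ₑ ^ 2) (chartPoint T (y, t)) := by
        rw [← lintegral_indicator (measurableSet_localStrip Ω.isOpen _ _),
          ← (measurePreserving_chartPoint T).lintegral_comp hmeasl, lintegral_prod]
        exact (hmeasl.comp (continuous_chartPoint T).measurable).aemeasurable
    _ ≤ ∫⁻ y, ∫⁻ t, (Set.Ioc (g y) (g y + M)).indicator
          (fun _ => 2 * (b y + ENNReal.ofReal M * I y)) t :=
        lintegral_mono fun y => lintegral_mono fun t => hpt y t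
    _ = ∫⁻ y, ENNReal.ofReal M * (2 * (b y + ENNReal.ofReal M * I y)) := by
        refine lintegral_congr fun y => ?_
        rw [lintegral_indicator measurableSet_Ioc, setLIntegral_const, Real.volume_Ioc,
          add_sub_cancel_left, mul_comm]
    _ = ENNReal.ofReal M * (2 * ((∫⁻ y, b y) + ENNReal.ofReal M * ∫⁻ y, I y)) := by
        rw [lintegral_const_mul' _ _ ENNReal.ofReal_ne_top, lintegral_const_mul' _ _ (by simp),
          lintegral_add_left hmeasb, lintegral_const_mul' _ _ ENNReal.ofReal_ne_top]
    _ ≤ _ := by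
        rw [hIint]
        gcongr

/-- Compactness of the boundary reduces the estimate to finitely many charts with common constants,
so C, C₁ and ρ do not depend on δ or φ. -/
lemma exists_lintegral_strip_le (hn : 1 ≤ n)
    {Ω : TopologicalSpace.Opens (EuclideanSpace ℝ (Fin n))}
    (hΩ : IsBoundedLipschitzDomain (Ω : Set (EuclideanSpace ℝ (Fin n)))) :
    ∃ (C : ℝ≥0) (C₁ ρ : ℝ), 1 ≤ C₁ ∧ 0 < ρ ∧ ∀ δ, δ ≤ ρ →
      ∀ φ : EuclideanSpace ℝ (Fin n) → F, ContDiff ℝ ∞ φ →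
        ∫⁻ x in strip Ω δ, ‖φ x‖ₑ ^ 2 ≤
          C * (ENNReal.ofReal δ * ∫⁻ x, ‖φ x‖ₑ ^ 2 ∂(surfaceMeasure Ω) +
            ENNReal.ofReal δ ^ 2 * ∫⁻ x in strip Ω (C₁ * δ), ‖fderiv ℝ φ x‖ₑ ^ 2) := by
  have : Nonempty (Fin n) := ⟨⟨0, hn⟩⟩
  have hne : (Ω : Set (EuclideanSpace ℝ (Fin n))) ≠ Set.univ := fun h =>
    NormedSpace.unbounded_univ ℝ (EuclideanSpace ℝ (Fin n)) (h ▸ hΩ.isBounded)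
  obtain ⟨N, O, hO, hcover, hch⟩ := hΩ.exists_charts
  choose T g K' hK' hgraph using hch
  -- The sum serves as one Lipschitz constant for all charts.
  let K : ℝ≥0 := ∑ i, K' i
  have hK : ∀ i, LipschitzWith K (g i) := fun i =>
    (hK' i).weaken (Finset.single_le_sum (fun _ _ => zero_le) (Finset.mem_univ i))
  have hcompact : IsCompact (frontier (Ω : Set (EuclideanSpace ℝ (Fin n)))) :=
    Metric.isCompact_of_isClosed_isBounded isClosed_frontier
      (hΩ.isBounded.closure.subset frontier_subset_closure)
  -- A Lebesgue number puts the ball of radius ρ about each boundary point inside a single chart.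
  obtain ⟨ρ, hρ, hleb⟩ := lebesgue_number_lemma_of_metric hcompact hO hcover
  have hK2 : (0 : ℝ) < 2 + K := by positivity
  refine ⟨N * (2 * (1 + K) * hausdorffFactor n + 2 * (1 + K) ^ 2), 2 + K, ρ / (2 + K),
    by linarith [K.coe_nonneg], by positivity, fun δ hδ φ hφ => ?_⟩
  rw [le_div_iff₀ hK2, mul_comm] at hδ
  have hsub : strip (Ω : Set (EuclideanSpace ℝ (Fin n))) δ ⊆
      ⋃ i, localStrip (Ω : Set (EuclideanSpace ℝ (Fin n))) (O i) ρ δ := by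
    rintro x ⟨hx, hxδ⟩
    obtain ⟨z, hz, hxz⟩ := exists_mem_frontier_infDist_compl_eq_dist hx hne
    obtain ⟨i, hi⟩ := hleb z hz
    refine Set.mem_iUnion.2 ⟨i, hx, Set.mem_iUnion₂.2 ⟨z, ⟨hz, hi⟩, ?_⟩⟩
    rw [Metric.mem_ball, ← hxz]
    exact hxδ
  have hM : ENNReal.ofReal ((1 + K) * δ) = ((1 + K : ℝ≥0) : ℝ≥0∞) * ENNReal.ofReal δ := by
    rw [ENNReal.ofReal_mul (by positivity)]
    congr 1
    exact ENNReal.ofReal_coe_nnreal (p := 1 + K)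
  set S := ∫⁻ x, ‖φ x‖ₑ ^ 2 ∂(surfaceMeasure Ω)
  set D := ∫⁻ x in strip Ω ((2 + K) * δ), ‖fderiv ℝ φ x‖ₑ ^ 2
  calc ∫⁻ x in strip Ω δ, ‖φ x‖ₑ ^ 2
      ≤ ∫⁻ x in ⋃ i, localStrip Ω (O i) ρ δ, ‖φ x‖ₑ ^ 2 := lintegral_mono_set hsub
    _ ≤ ∑' i, ∫⁻ x in localStrip Ω (O i) ρ δ, ‖φ x‖ₑ ^ 2 := lintegral_iUnion_le _ _
    _ = ∑ i, ∫⁻ x in localStrip Ω (O i) ρ δ, ‖φ x‖ₑ ^ 2 := tsum_fintype _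
    _ ≤ ∑ _i : Fin N, ENNReal.ofReal ((1 + K) * δ) *
        (2 * (hausdorffFactor n * S + ENNReal.ofReal ((1 + K) * δ) * D)) :=
        Finset.sum_le_sum fun i _ => lintegral_localStrip_le hn (hK i) (hgraph i) hδ hφ
    _ = N * (2 * (1 + K : ℝ≥0) * hausdorffFactor n * (ENNReal.ofReal δ * S) +
          2 * (1 + K : ℝ≥0) ^ 2 * (ENNReal.ofReal δ ^ 2 * D)) := by
        rw [Finset.sum_const, Finset.card_univ, Fintype.card_fin, nsmul_eq_mul, hM]
        ring
    _ ≤ N * ((2 * (1 + K : ℝ≥0) * hausdorffFactor n + 2 * (1 + K : ℝ≥0) ^ 2) *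
          (ENNReal.ofReal δ * S) +
          (2 * (1 + K : ℝ≥0) * hausdorffFactor n + 2 * (1 + K : ℝ≥0) ^ 2) *
          (ENNReal.ofReal δ ^ 2 * D)) := by
        gcongr
        · exact le_self_add
        · exact le_add_self
    _ = _ := by
        push_cast
        ring

end StripEstimate

/-! ### Cutoff functions with gradient of order 1/δ. -/

section Cutoff

/-- The derivative is bounded on [0, 1] by compactness and vanishes outside, where the function
attains its minimum or maximum. -/
lemma exists_lipschitzWith_smoothTransition : ∃ C : ℝ≥0, LipschitzWith C Real.smoothTransition := by
  have hc : Continuous (deriv Real.smoothTransition) :=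
    (Real.smoothTransition.contDiff (n := 1)).continuous_deriv le_rfl
  obtain ⟨C, hC⟩ := (isCompact_Icc (a := (0 : ℝ)) (b := 1)).exists_bound_of_continuousOn
    hc.continuousOn
  have hC0 : 0 ≤ C := (norm_nonneg _).trans (hC 0 ⟨le_rfl, zero_le_one⟩)
  refine ⟨C.toNNReal, lipschitzWith_of_nnnorm_deriv_le
    ((Real.smoothTransition.contDiff (n := 1)).differentiable one_ne_zero) fun x => ?_⟩
  rw [← NNReal.coe_le_coe, coe_nnnorm, Real.coe_toNNReal C hC0]
  rcases lt_or_ge x 0 with h0 | h0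
  · have : IsLocalMin Real.smoothTransition x := .of_forall fun y => by
      rw [Real.smoothTransition.zero_of_nonpos h0.le]
      exact Real.smoothTransition.nonneg y
    rw [this.deriv_eq_zero, norm_zero]
    exact hC0
  rcases lt_or_ge 1 x with h1 | h1
  · have : IsLocalMax Real.smoothTransition x := .of_forall fun y => by
      rw [Real.smoothTransition.one_of_one_le h1.le]
      exact Real.smoothTransition.le_one y
    rw [this.deriv_eq_zero, norm_zero]
    exact hC0
  · exact hC x ⟨h0, h1⟩

variable {E : Type*} [NormedAddCommGroup E] [NormedSpace ℝ E] [FiniteDimensional ℝ E]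

/-- Smooth approximation of `1`-Lipschitz functions. -/
lemma exists_contDiff_lipschitzWith_dist_le {d : E → ℝ} (hd : LipschitzWith 1 d) {ε : ℝ}
    (hε : 0 < ε) : ∃ f : E → ℝ, ContDiff ℝ ∞ f ∧ LipschitzWith 1 f ∧ ∀ x, dist (f x) (d x) ≤ ε := by
  borelize E
  let μ : Measure E := Measure.addHaar
  let φ : ContDiffBump (0 : E) := ⟨ε / 2, ε, by positivity, by linarith⟩
  have hcφ : HasCompactSupport (φ.normed μ) := φ.hasCompactSupport_normed
  have hex : ConvolutionExists (φ.normed μ) d (ContinuousLinearMap.lsmul ℝ ℝ) μ :=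
    hcφ.convolutionExists_left _ φ.continuous_normed hd.continuous.locallyIntegrable
  -- Mollification averages translates of d, which preserves the Lipschitz constant; a kernel
  -- supported within radius ε moves values by at most ε.
  refine ⟨convolution (φ.normed μ) d (ContinuousLinearMap.lsmul ℝ ℝ) μ,
    hcφ.contDiff_convolution_left _ φ.contDiff_normed hd.continuous.locallyIntegrable,
    LipschitzWith.of_dist_le_mul fun x y => ?_,
    fun x => φ.dist_normed_convolution_le hd.continuous.aestronglyMeasurable fun y hy => ?_⟩
  · rw [convolution_def, convolution_def, dist_eq_norm, ← integral_sub (hex x) (hex y)]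
    have h1 : ∫ t, φ.normed μ t * dist x y ∂μ = dist x y := by
      rw [integral_mul_const, φ.integral_normed, one_mul]
    rw [NNReal.coe_one, one_mul, ← h1]
    refine norm_integral_le_of_norm_le ((φ.continuous_normed.integrable_of_hasCompactSupport
      hcφ).mul_const _) (.of_forall fun t => ?_)
    simp only [ContinuousLinearMap.lsmul_apply, smul_eq_mul]
    rw [← mul_sub, norm_mul, Real.norm_of_nonneg (φ.nonneg_normed t), ← dist_eq_norm]
    refine mul_le_mul_of_nonneg_left ?_ (φ.nonneg_normed t)
    simpa using hd.dist_le_mul (x - t) (y - t)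
  · have h1 := hd.dist_le_mul y x
    rw [NNReal.coe_one, one_mul] at h1
    exact h1.trans (Metric.mem_ball.1 hy).le

/-- The cutoff is a smooth step function of the smoothed distance to the complement, so its gradient
is of order 1/δ with a constant independent of Ω and δ. -/
lemma exists_cutoff : ∃ C : ℝ, 0 ≤ C ∧ ∀ Ω : Set E, IsOpen Ω → Bornology.IsBounded Ω → Ωᶜ.Nonempty →
    ∀ δ > 0, ∃ χ : E → ℝ, ContDiff ℝ ∞ χ ∧ HasCompactSupport χ ∧ tsupport χ ⊆ Ω ∧
      (∀ x, χ x ∈ Set.Icc (0 : ℝ) 1) ∧ (∀ x, δ ≤ Metric.infDist x Ωᶜ → χ x = 1) ∧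
      ∀ x, ‖fderiv ℝ χ x‖ ≤ C / δ := by
  obtain ⟨C, hC⟩ := exists_lipschitzWith_smoothTransition
  refine ⟨4 * C, by positivity, fun Ω hΩ hb hne δ hδ => ?_⟩
  -- With error δ/8, distance at most δ/8 gives f ≤ δ/4 and distance at least δ gives f ≥ δ/2. The
  -- affine map 4f/δ - 1 sends these ranges to (-∞, 0] and [1, ∞).
  obtain ⟨f, hf, hfl, hfd⟩ := exists_contDiff_lipschitzWith_dist_le
    (Metric.lipschitz_infDist_pt Ωᶜ) (by positivity : 0 < δ / 8)
  have hzero : ∀ x, Metric.infDist x Ωᶜ ≤ δ / 8 →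
      Real.smoothTransition (4 / δ * f x - 1) = 0 := fun x hx => by
    refine Real.smoothTransition.zero_of_nonpos ?_
    have h1 := (abs_le.1 (hfd x)).2
    have h2 : 4 / δ * f x ≤ 4 / δ * (δ / 4) := by
      gcongr
      linarith
    have h3 : 4 / δ * (δ / 4) = 1 := by field_simp
    linarith
  have hsupp : tsupport (fun x => Real.smoothTransition (4 / δ * f x - 1)) ⊆
      {x | δ / 8 ≤ Metric.infDist x Ωᶜ} := by
    refine closure_minimal (fun x hx => ?_)
      (isClosed_le continuous_const (Metric.continuous_infDist_pt _))
    by_contra h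
    exact hx (hzero x (not_le.1 h).le)
  have hsub : {x | δ / 8 ≤ Metric.infDist x Ωᶜ} ⊆ Ω := fun x hx => by
    by_contra h
    have h1 : Metric.infDist x Ωᶜ = 0 := Metric.infDist_zero_of_mem h
    have h2 : δ / 8 ≤ Metric.infDist x Ωᶜ := hx
    linarith
  refine ⟨fun x => Real.smoothTransition (4 / δ * f x - 1),
    Real.smoothTransition.contDiff.comp ((contDiff_const.mul hf).sub contDiff_const),
    Metric.isCompact_of_isClosed_isBounded (isClosed_tsupport _)
      (hb.subset (hsupp.trans hsub)), hsupp.trans hsub,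
    fun x => ⟨Real.smoothTransition.nonneg _, Real.smoothTransition.le_one _⟩,
    fun x hx => Real.smoothTransition.one_of_one_le ?_, fun x => ?_⟩
  · have h1 := (abs_le.1 (hfd x)).1
    have h2 : 4 / δ * (δ / 2) ≤ 4 / δ * f x := by
      gcongr
      linarith
    have h3 : 4 / δ * (δ / 2) = 2 := by field_simp; norm_num
    linarith
  · have h1 : LipschitzWith (C * (4 / δ).toNNReal)
        fun x => Real.smoothTransition (4 / δ * f x - 1) := by
      refine LipschitzWith.of_dist_le_mul fun x y => (hC.dist_le_mul _ _).trans ?_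
      rw [NNReal.coe_mul, mul_assoc, Real.coe_toNNReal _ (by positivity)]
      refine mul_le_mul_of_nonneg_left ?_ C.2
      have h2 := hfl.dist_le_mul x y
      rw [NNReal.coe_one, one_mul] at h2
      rw [dist_sub_right, Real.dist_eq, ← mul_sub, abs_mul, ← Real.dist_eq,
        abs_of_pos (by positivity : 0 < 4 / δ)]
      exact mul_le_mul_of_nonneg_left h2 (by positivity)
    refine (norm_fderiv_le_of_lipschitz ℝ h1).trans_eq ?_
    rw [NNReal.coe_mul, Real.coe_toNNReal _ (by positivity)]
    ring

end Cutoff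

/-! ### The kernel of the Dirichlet trace. -/

section Trace

variable {n m : ℕ} {Ω : TopologicalSpace.Opens (EuclideanSpace ℝ (Fin n))}

/-- A function together with its classical partial derivatives. -/
noncomputable def jet {F : Type*} [NormedAddCommGroup F] [NormedSpace ℝ F]
    (φ : EuclideanSpace ℝ (Fin n) → F) : Option (Fin n) → EuclideanSpace ℝ (Fin n) → F
  | none => φ
  | some j => pderiv j φ

/-- An element of `H¹(Ω)ᵐ` together with its weak partial derivatives. -/
noncomputable def weakJet (u : VecL2 m Ω) : Option (Fin n) → VecL2 m Ω
  | none => u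
  | some j => weakGrad u j

/-- The square of the distance in `H¹(Ω)ᵐ` between a smooth function and an element. -/
noncomputable def h1DistSq (φ : EuclideanSpace ℝ (Fin n) → EuclideanSpace ℂ (Fin m))
    (u : VecL2 m Ω) : ℝ≥0∞ :=
  ∑ i, ∫⁻ x in (Ω : Set (EuclideanSpace ℝ (Fin n))), ‖jet φ i x - weakJet u i x‖ₑ ^ 2

lemma continuous_jet {F : Type*} [NormedAddCommGroup F] [NormedSpace ℝ F]
    {φ : EuclideanSpace ℝ (Fin n) → F} (hφ : ContDiff ℝ ∞ φ) (i : Option (Fin n)) :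
    Continuous (jet φ i) := by
  cases i with
  | none => exact hφ.continuous
  | some j => exact continuous_pderiv_of_contDiff hφ j

lemma tendsto_sq_zero_iff {a : ℕ → ℝ≥0∞} :
    Tendsto (fun k => a k ^ 2) atTop (𝓝 0) ↔ Tendsto a atTop (𝓝 0) := by
  constructor
  · intro h
    have h1 := ((ENNReal.continuous_rpow_const (y := 1 / 2)).tendsto 0).comp h
    rw [ENNReal.zero_rpow_of_pos (by norm_num)] at h1
    refine h1.congr fun k => ?_
    rw [Function.comp_apply, ← ENNReal.rpow_natCast, ← ENNReal.rpow_mul]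
    norm_num
  · intro h
    have h1 := ((ENNReal.continuous_pow 2).tendsto 0).comp h
    rwa [zero_pow two_ne_zero] at h1

lemma h1Tendsto_iff_h1DistSq {φ : ℕ → EuclideanSpace ℝ (Fin n) → EuclideanSpace ℂ (Fin m)}
    {u : VecL2 m Ω} : H1Tendsto φ u ↔ Tendsto (fun k => h1DistSq (φ k) u) atTop (𝓝 0) := by
  have h1 : H1Tendsto φ u ↔ ∀ i, Tendsto (fun k =>
      ∫⁻ x in (Ω : Set (EuclideanSpace ℝ (Fin n))), ‖jet (φ k) i x - weakJet u i x‖ₑ ^ 2)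
      atTop (𝓝 0) := by
    simp_rw [← eLpNorm_two_sq, tendsto_sq_zero_iff]
    rw [Option.forall]
    rfl
  rw [h1]
  constructor
  · intro h
    have h2 := tendsto_finsetSum Finset.univ fun i (_ : i ∈ Finset.univ) => h i
    rwa [Finset.sum_const_zero] at h2
  · exact fun h i => tendsto_of_tendsto_of_tendsto_of_le_of_le tendsto_const_nhds h
      (fun _ => zero_le) fun k => Finset.single_le_sum (f := fun i =>
        ∫⁻ x in (Ω : Set (EuclideanSpace ℝ (Fin n))), ‖jet (φ k) i x - weakJet u i x‖ₑ ^ 2)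
        (fun _ _ => zero_le) (Finset.mem_univ i)

lemma mem_H10_of_forall_exists {u : VecL2 m Ω} (hu : u ∈ H1 m Ω)
    (h : ∀ ε : ℝ≥0∞, 0 < ε → ∃ ψ : 𝓓(Ω, EuclideanSpace ℂ (Fin m)), h1DistSq ψ u ≤ ε) :
    u ∈ H10 m Ω := by
  choose ψ hψ using fun k : ℕ => h ((k : ℝ≥0∞)⁻¹) (by simp)
  exact ⟨hu, ψ, h1Tendsto_iff_h1DistSq.2 (tendsto_of_tendsto_of_tendsto_of_le_of_le
    tendsto_const_nhds ENNReal.tendsto_inv_nat_nhds_zero (fun _ => zero_le) hψ)⟩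

/-- The product of a cutoff function and a smooth function, as a test function. -/
noncomputable def cutoffTest (χ : EuclideanSpace ℝ (Fin n) → ℝ)
    (φ : EuclideanSpace ℝ (Fin n) → EuclideanSpace ℂ (Fin m)) (hχ : ContDiff ℝ ∞ χ)
    (hc : HasCompactSupport χ) (hs : tsupport χ ⊆ Ω) (hφ : ContDiff ℝ ∞ φ) :
    𝓓(Ω, EuclideanSpace ℂ (Fin m)) where
  toFun x := χ x • φ x
  contDiff' := hχ.smul hφ
  hasCompactSupport' := hc.smul_right
  tsupport_subset' := (tsupport_smul_subset_left _ _).trans hs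

lemma enorm_add_sq_le_two_mul {F : Type*} [NormedAddCommGroup F] (a b : F) :
    ‖a + b‖ₑ ^ 2 ≤ 2 * (‖a‖ₑ ^ 2 + ‖b‖ₑ ^ 2) := by
  simpa using enorm_sq_le_two_mul (a + b) a

lemma enorm_jet_cutoff_sub_sq_le {F : Type*} [NormedAddCommGroup F] [NormedSpace ℝ F]
    {χ : EuclideanSpace ℝ (Fin n) → ℝ} {φ : EuclideanSpace ℝ (Fin n) → F}
    (hχ : ContDiff ℝ ∞ χ) (hφ : ContDiff ℝ ∞ φ) (h01 : ∀ x, χ x ∈ Set.Icc (0 : ℝ) 1) {B : ℝ}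
    (hB : ∀ x, ‖fderiv ℝ χ x‖ ≤ B) (i : Option (Fin n)) (x : EuclideanSpace ℝ (Fin n)) :
    ‖jet (fun x => χ x • φ x) i x - jet φ i x‖ₑ ^ 2 ≤
      2 * (‖jet φ i x‖ₑ ^ 2 + ENNReal.ofReal B ^ 2 * ‖φ x‖ₑ ^ 2) := by
  have h1 : ‖χ x - 1‖ₑ ≤ 1 := by
    rw [← ofReal_norm, Real.norm_eq_abs, ENNReal.ofReal_le_one, abs_le]
    exact ⟨by linarith [(h01 x).1], by linarith [(h01 x).2]⟩
  have h2 : ∀ v : F, ‖(χ x - 1) • v‖ₑ ^ 2 ≤ ‖v‖ₑ ^ 2 := fun v => by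
    rw [enorm_smul]
    exact pow_le_pow_left' (mul_le_of_le_one_left zero_le h1) 2
  cases i with
  | none =>
    have h3 : χ x • φ x - φ x = (χ x - 1) • φ x := by rw [sub_smul, one_smul]
    refine (h3 ▸ h2 (φ x) : ‖χ x • φ x - φ x‖ₑ ^ 2 ≤ ‖φ x‖ₑ ^ 2).trans ?_
    rw [two_mul]
    exact le_self_add.trans le_self_add
  | some j =>
    have h3 : pderiv j (fun x => χ x • φ x) x - pderiv j φ x =
        (χ x - 1) • pderiv j φ x + pderiv j χ x • φ x := by
      simp only [pderiv]
      rw [fderiv_fun_smul (hχ.differentiable (by simp) x) (hφ.differentiable (by simp) x)]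
      simp [sub_smul]
      abel
    change ‖pderiv j (fun x => χ x • φ x) x - pderiv j φ x‖ₑ ^ 2 ≤ _
    rw [h3]
    refine (enorm_add_sq_le_two_mul _ _).trans ?_
    refine mul_le_mul_right (add_le_add (h2 _) ?_) _
    rw [enorm_smul, mul_pow]
    gcongr
    rw [← ofReal_norm]
    refine ENNReal.ofReal_le_ofReal (((fderiv ℝ χ x).le_opNorm _).trans ?_)
    simpa using hB x

lemma fderiv_eq_zero_of_eq_one {χ : EuclideanSpace ℝ (Fin n) → ℝ}
    (h01 : ∀ x, χ x ∈ Set.Icc (0 : ℝ) 1) {x : EuclideanSpace ℝ (Fin n)} (hx : χ x = 1) :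
    fderiv ℝ χ x = 0 :=
  IsLocalMax.fderiv_eq_zero (.of_forall fun y => hx ▸ (h01 y).2)

lemma jet_cutoff_sub_eq_zero {F : Type*} [NormedAddCommGroup F] [NormedSpace ℝ F]
    {χ : EuclideanSpace ℝ (Fin n) → ℝ} {φ : EuclideanSpace ℝ (Fin n) → F}
    (hχ : ContDiff ℝ ∞ χ) (hφ : ContDiff ℝ ∞ φ) (h01 : ∀ x, χ x ∈ Set.Icc (0 : ℝ) 1)
    (i : Option (Fin n)) {x : EuclideanSpace ℝ (Fin n)} (hx : χ x = 1) :
    jet (fun x => χ x • φ x) i x - jet φ i x = 0 := by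
  cases i with
  | none => simp [jet, hx]
  | some j =>
    simp only [jet, pderiv]
    rw [fderiv_fun_smul (hχ.differentiable (by simp) x) (hφ.differentiable (by simp) x),
      fderiv_eq_zero_of_eq_one h01 hx, hx]
    simp

lemma lintegral_enorm_fderiv_sq_le_jet {F : Type*} [NormedAddCommGroup F] [NormedSpace ℝ F]
    {φ : EuclideanSpace ℝ (Fin n) → F} (hφ : ContDiff ℝ ∞ φ)
    (μ : Measure (EuclideanSpace ℝ (Fin n))) :
    ∫⁻ x, ‖fderiv ℝ φ x‖ₑ ^ 2 ∂μ ≤ ∑ i, ∫⁻ x, ‖jet φ i x‖ₑ ^ 2 ∂μ := by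
  refine (lintegral_mono fun x => enorm_fderiv_sq_le φ x).trans ?_
  rw [lintegral_finsetSum _ fun j _ =>
    (continuous_pderiv_of_contDiff hφ j).enorm.measurable.pow_const 2, Fintype.sum_option]
  exact le_add_self

lemma strip_mono {Ω : Set (EuclideanSpace ℝ (Fin n))} {δ δ' : ℝ} (h : δ ≤ δ') :
    strip Ω δ ⊆ strip Ω δ' :=
  Set.inter_subset_inter_right _ fun _ hx => lt_of_lt_of_le hx h

lemma compl_nonempty_of_isBounded (hn : 1 ≤ n)
    (hb : Bornology.IsBounded (Ω : Set (EuclideanSpace ℝ (Fin n)))) :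
    (Ω : Set (EuclideanSpace ℝ (Fin n)))ᶜ.Nonempty := by
  have : Nonempty (Fin n) := ⟨⟨0, hn⟩⟩
  rw [Set.nonempty_compl]
  exact fun h => NormedSpace.unbounded_univ ℝ (EuclideanSpace ℝ (Fin n)) (h ▸ hb)

/-- A smooth function can be cut off near the boundary with an error that is controlled by its
norm near and on the boundary. -/
lemma exists_test_sub_le (hn : 1 ≤ n)
    (hΩ : IsBoundedLipschitzDomain (Ω : Set (EuclideanSpace ℝ (Fin n)))) :
    ∃ (C : ℝ≥0) (C₁ ρ : ℝ), 0 < C₁ ∧ 0 < ρ ∧ ∀ δ, 0 < δ → δ ≤ ρ →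
      ∀ φ : EuclideanSpace ℝ (Fin n) → EuclideanSpace ℂ (Fin m), ContDiff ℝ ∞ φ →
      ∃ ψ : 𝓓(Ω, EuclideanSpace ℂ (Fin m)),
        ∑ i, ∫⁻ x in (Ω : Set (EuclideanSpace ℝ (Fin n))), ‖jet ψ i x - jet φ i x‖ₑ ^ 2 ≤
          C * (∑ i, (∫⁻ x in strip Ω (C₁ * δ), ‖jet φ i x‖ₑ ^ 2) +
            (ENNReal.ofReal δ)⁻¹ * ∫⁻ x, ‖φ x‖ₑ ^ 2 ∂(surfaceMeasure Ω)) := by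
  obtain ⟨C, C₁, ρ, hC₁, hρ, hstrip⟩ :=
    exists_lintegral_strip_le (F := EuclideanSpace ℂ (Fin m)) hn hΩ
  obtain ⟨B, hB, hcut⟩ := exists_cutoff (E := EuclideanSpace ℝ (Fin n))
  let D : ℝ≥0 := 2 * (n + 1) * (B.toNNReal ^ 2 * C)
  refine ⟨2 + D, C₁, ρ, by linarith, hρ, fun δ hδ hδρ φ hφ => ?_⟩
  obtain ⟨χ, hχ, hχc, hχs, h01, hχ1, hχB⟩ :=
    hcut Ω Ω.isOpen hΩ.isBounded (compl_nonempty_of_isBounded hn hΩ.isBounded) δ hδ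
  refine ⟨cutoffTest χ φ hχ hχc hχs hφ, ?_⟩
  have hmeas : ∀ i, Measurable fun x => ‖jet φ i x‖ₑ ^ 2 := fun i =>
    (continuous_jet hφ i).enorm.measurable.pow_const 2
  have hδ0 : ENNReal.ofReal δ ≠ 0 := by simpa using hδ
  set S := ∫⁻ x, ‖φ x‖ₑ ^ 2 ∂(surfaceMeasure Ω)
  set J := ∑ i, ∫⁻ x in strip Ω (C₁ * δ), ‖jet φ i x‖ₑ ^ 2
  have hJ : ∑ i, ∫⁻ x in strip Ω δ, ‖jet φ i x‖ₑ ^ 2 ≤ J :=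
    Finset.sum_le_sum fun i _ => lintegral_mono_set (strip_mono (by nlinarith))
  -- The cutoff changes φ and its derivatives only in the strip of width δ: elsewhere χ equals its
  -- maximum 1 and its gradient vanishes.
  have h1 : ∀ i, ∫⁻ x in (Ω : Set (EuclideanSpace ℝ (Fin n))),
      ‖jet (fun x => χ x • φ x) i x - jet φ i x‖ₑ ^ 2 ≤
        2 * (∫⁻ x in strip Ω δ, ‖jet φ i x‖ₑ ^ 2) +
          2 * (ENNReal.ofReal (B / δ) ^ 2 * ∫⁻ x in strip Ω δ, ‖φ x‖ₑ ^ 2) := by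
    intro i
    have e1 : ∫⁻ x in (Ω : Set (EuclideanSpace ℝ (Fin n))),
        ‖jet (fun x => χ x • φ x) i x - jet φ i x‖ₑ ^ 2 =
        ∫⁻ x in strip Ω δ, ‖jet (fun x => χ x • φ x) i x - jet φ i x‖ₑ ^ 2 := by
      rw [← lintegral_indicator Ω.isOpen.measurableSet,
        ← lintegral_indicator (measurableSet_strip Ω.isOpen δ)]
      refine lintegral_congr fun x => ?_
      by_cases hx : x ∈ (Ω : Set (EuclideanSpace ℝ (Fin n)))
      · by_cases hxδ : Metric.infDist x (Ω : Set (EuclideanSpace ℝ (Fin n)))ᶜ < δ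
        · rw [Set.indicator_of_mem hx, Set.indicator_of_mem (s := strip _ δ) ⟨hx, hxδ⟩]
        · rw [Set.indicator_of_mem hx, Set.indicator_of_notMem fun h => hxδ h.2,
            jet_cutoff_sub_eq_zero hχ hφ h01 i (hχ1 x (not_lt.1 hxδ))]
          simp
      · rw [Set.indicator_of_notMem hx, Set.indicator_of_notMem fun h => hx h.1]
    rw [e1]
    refine (lintegral_mono fun x => enorm_jet_cutoff_sub_sq_le hχ hφ h01 hχB i x).trans_eq ?_
    rw [lintegral_const_mul' _ _ (by simp), lintegral_add_left (hmeas i),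
      lintegral_const_mul' _ _ (by simp), mul_add]
  -- The singular factor (B/δ)² meets the strip bound C (δ S + δ² J), which leaves the finite
  -- multiple B² C of J + S/δ.
  have h2 : ENNReal.ofReal (B / δ) ^ 2 * ∫⁻ x in strip Ω δ, ‖φ x‖ₑ ^ 2 ≤
      ((B.toNNReal ^ 2 * C : ℝ≥0) : ℝ≥0∞) * (J + (ENNReal.ofReal δ)⁻¹ * S) := by
    have e1 := hstrip δ hδρ φ hφ
    have e2 := lintegral_enorm_fderiv_sq_le_jet hφ (volume.restrict (strip Ω (C₁ * δ)))
    have e3 : (ENNReal.ofReal δ)⁻¹ * ENNReal.ofReal δ = 1 :=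
      ENNReal.inv_mul_cancel hδ0 ENNReal.ofReal_ne_top
    rw [ENNReal.ofReal_div_of_pos hδ, div_eq_mul_inv]
    calc (ENNReal.ofReal B * (ENNReal.ofReal δ)⁻¹) ^ 2 * ∫⁻ x in strip Ω δ, ‖φ x‖ₑ ^ 2
        ≤ (ENNReal.ofReal B * (ENNReal.ofReal δ)⁻¹) ^ 2 *
          (C * (ENNReal.ofReal δ * S + ENNReal.ofReal δ ^ 2 * J)) := by
          gcongr
          exact e1.trans (by gcongr)
      _ = ENNReal.ofReal B ^ 2 * C * (((ENNReal.ofReal δ)⁻¹ * ENNReal.ofReal δ) ^ 2 * J +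
          ((ENNReal.ofReal δ)⁻¹ * ENNReal.ofReal δ) * ((ENNReal.ofReal δ)⁻¹ * S)) := by ring
      _ = _ := by
          rw [e3, one_pow, one_mul, one_mul, ENNReal.coe_mul, ENNReal.coe_pow]
          rfl
  calc ∑ i, ∫⁻ x in (Ω : Set (EuclideanSpace ℝ (Fin n))),
        ‖jet (fun x => χ x • φ x) i x - jet φ i x‖ₑ ^ 2
      ≤ ∑ i : Option (Fin n), (2 * (∫⁻ x in strip Ω δ, ‖jet φ i x‖ₑ ^ 2) +
          2 * (((B.toNNReal ^ 2 * C : ℝ≥0) : ℝ≥0∞) * (J + (ENNReal.ofReal δ)⁻¹ * S))) :=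
        Finset.sum_le_sum fun i _ => (h1 i).trans (by gcongr)
    _ = 2 * ∑ i, (∫⁻ x in strip Ω δ, ‖jet φ i x‖ₑ ^ 2) + D * (J + (ENNReal.ofReal δ)⁻¹ * S) := by
        rw [Finset.sum_add_distrib, ← Finset.mul_sum, Finset.sum_const, Finset.card_univ,
          Fintype.card_option, Fintype.card_fin, nsmul_eq_mul]
        simp only [D]
        push_cast
        ring
    _ ≤ 2 * (J + (ENNReal.ofReal δ)⁻¹ * S) + D * (J + (ENNReal.ofReal δ)⁻¹ * S) := by
        gcongr
        exact hJ.trans le_self_add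
    _ = _ := by
        push_cast
        ring

/-- The strips decrease to the empty set inside a set of finite measure, so absolute continuity of
the integral applies. -/
lemma tendsto_lintegral_strip (hne : (Ω : Set (EuclideanSpace ℝ (Fin n)))ᶜ.Nonempty)
    (hb : Bornology.IsBounded (Ω : Set (EuclideanSpace ℝ (Fin n)))) (w : VecL2 m Ω) :
    Tendsto (fun r => ∫⁻ x in strip Ω r, ‖w x‖ₑ ^ 2) (𝓝[>] 0) (𝓝 0) := by
  have h0 : ⋂ r > (0 : ℝ), strip (Ω : Set (EuclideanSpace ℝ (Fin n))) r = ∅ := by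
    refine Set.eq_empty_of_forall_notMem fun x hx => ?_
    rw [Set.mem_iInter₂] at hx
    have hxΩ := (hx 1 one_pos).1
    have h1 : 0 < Metric.infDist x (Ω : Set (EuclideanSpace ℝ (Fin n)))ᶜ :=
      (Ω.isOpen.isClosed_compl.notMem_iff_infDist_pos hne).1 fun h => h hxΩ
    have h2 : Metric.infDist x (Ω : Set (EuclideanSpace ℝ (Fin n)))ᶜ < Metric.infDist x _ :=
      (hx _ h1).2
    exact lt_irrefl _ h2
  have h1 := tendsto_measure_biInter_gt
    (μ := volume.restrict (Ω : Set (EuclideanSpace ℝ (Fin n)))) (a := (0 : ℝ))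
    (fun r _ => (measurableSet_strip Ω.isOpen r).nullMeasurableSet)
    (fun _ _ _ h => strip_mono h)
    ⟨1, one_pos, ((measure_mono (Set.subset_univ _)).trans_lt (by
      rw [Measure.restrict_apply_univ]
      exact hb.measure_lt_top)).ne⟩
  rw [h0, measure_empty] at h1
  have h2 := tendsto_setLIntegral_zero (f := fun x => ‖w x‖ₑ ^ 2)
    (by rw [← enorm_sq_eq_lintegral]; simp) h1
  refine h2.congr fun r => ?_
  have h3 : strip (Ω : Set (EuclideanSpace ℝ (Fin n))) r ∩ Ω = strip Ω r :=
    Set.inter_eq_left.2 Set.inter_subset_left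
  rw [Measure.restrict_restrict (measurableSet_strip Ω.isOpen r), h3]

/-- Cutting off the smooth approximants costs their H¹ mass near the boundary plus δ⁻¹ times their
boundary mass. The order of choices matters: δ first, making the mass of u in the strip small, then
the index k, whose boundary and H¹ errors may depend on δ. -/
lemma mem_H10_of_hasTrace_zero (hn : 1 ≤ n)
    (hΩ : IsBoundedLipschitzDomain (Ω : Set (EuclideanSpace ℝ (Fin n)))) {u : VecL2 m Ω}
    (hu : HasTrace u 0) : u ∈ H10 m Ω := by
  obtain ⟨hu1, φ, hφ, hφu, htr⟩ := hu
  rw [h1Tendsto_iff_h1DistSq] at hφu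
  obtain ⟨C, C₁, ρ, hC₁, hρ, htest⟩ := exists_test_sub_le (m := m) hn hΩ
  have hS : Tendsto (fun k => ∫⁻ x, ‖φ k x‖ₑ ^ 2 ∂(surfaceMeasure Ω)) atTop (𝓝 0) := by
    refine (tendsto_sq_zero_iff.2 htr).congr fun k => ?_
    rw [eLpNorm_two_sq]
    refine lintegral_congr_ae ?_
    filter_upwards [Lp.coeFn_zero (EuclideanSpace ℂ (Fin m)) 2 (surfaceMeasure Ω)] with x hx
    rw [hx, Pi.zero_apply, sub_zero]
  -- The factor 4C comes from using |a + b|² ≤ 2(|a|² + |b|²) twice, with the constant C of the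
  -- cutoff estimate in between.
  have hstrip : Tendsto (fun δ => (4 * C : ℝ≥0∞) *
      ∑ i, ∫⁻ x in strip Ω (C₁ * δ), ‖weakJet u i x‖ₑ ^ 2) (𝓝[>] 0) (𝓝 0) := by
    have h1 : Tendsto (fun δ : ℝ => C₁ * δ) (𝓝[>] 0) (𝓝[>] 0) := by
      refine tendsto_nhdsWithin_iff.2 ⟨?_, ?_⟩
      · have : Tendsto (fun δ : ℝ => C₁ * δ) (𝓝 0) (𝓝 (C₁ * 0)) :=
          (continuous_const.mul continuous_id).tendsto 0
        rw [mul_zero] at this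
        exact this.mono_left nhdsWithin_le_nhds
      · filter_upwards [self_mem_nhdsWithin] with δ hδ
        exact mul_pos hC₁ hδ
    have h2 := tendsto_finsetSum Finset.univ fun i (_ : i ∈ Finset.univ) =>
      (tendsto_lintegral_strip (compl_nonempty_of_isBounded hn hΩ.isBounded) hΩ.isBounded
        (weakJet u i)).comp h1
    have h3 := ENNReal.Tendsto.const_mul (a := (4 * C : ℝ≥0∞)) h2
      (Or.inr (ENNReal.mul_ne_top (by simp) ENNReal.coe_ne_top))
    simpa using h3
  refine mem_H10_of_forall_exists hu1 fun ε hε => ?_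
  have hε2 : 0 < ε / 2 := ENNReal.half_pos hε.ne'
  obtain ⟨δ, hδ1, hδ, hδρ⟩ := ((hstrip.eventually (Iic_mem_nhds hε2)).and
    (Ioc_mem_nhdsGT hρ)).exists
  have hlim : Tendsto (fun k => (4 * C + 2 : ℝ≥0∞) * h1DistSq (φ k) u +
      (2 * C * (ENNReal.ofReal δ)⁻¹ : ℝ≥0∞) * ∫⁻ x, ‖φ k x‖ₑ ^ 2 ∂(surfaceMeasure Ω))
      atTop (𝓝 0) := by
    have hδ0 : (ENNReal.ofReal δ)⁻¹ ≠ ⊤ := by simpa using hδ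
    have h1 := (ENNReal.Tendsto.const_mul (a := (4 * C + 2 : ℝ≥0∞)) hφu
      (Or.inr (by finiteness))).add (ENNReal.Tendsto.const_mul
        (a := (2 * C * (ENNReal.ofReal δ)⁻¹ : ℝ≥0∞)) hS (Or.inr (by finiteness)))
    simpa using h1
  obtain ⟨k, hk⟩ := (hlim.eventually (Iic_mem_nhds hε2)).exists
  obtain ⟨ψ, hψ⟩ := htest δ hδ hδρ (φ k) (hφ k).1
  have hcj : ∀ i, Measurable (jet (φ k) i) := fun i => (continuous_jet (hφ k).1 i).measurable
  have hcψ : ∀ i, Measurable (jet ψ i) := fun i => (continuous_jet ψ.contDiff i).measurable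
  have h1 : h1DistSq ψ u ≤ 2 * (∑ i, (∫⁻ x in (Ω : Set (EuclideanSpace ℝ (Fin n))),
      ‖jet ψ i x - jet (φ k) i x‖ₑ ^ 2) + h1DistSq (φ k) u) := by
    rw [h1DistSq, h1DistSq, ← Finset.sum_add_distrib, Finset.mul_sum]
    refine Finset.sum_le_sum fun i _ => ?_
    rw [← lintegral_add_left (f := fun x => ‖jet ψ i x - jet (φ k) i x‖ₑ ^ 2)
      (((hcψ i).sub (hcj i)).enorm.pow_const 2),
      ← lintegral_const_mul' _ _ (by simp)]
    refine lintegral_mono fun x => ?_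
    have := enorm_add_sq_le_two_mul (jet ψ i x - jet (φ k) i x) (jet (φ k) i x - weakJet u i x)
    rwa [sub_add_sub_cancel] at this
  have hmu : ∀ i, AEStronglyMeasurable (weakJet u i) (volume.restrict (strip Ω (C₁ * δ))) :=
    fun i => (Lp.aestronglyMeasurable (weakJet u i)).mono_measure
      (Measure.restrict_mono Set.inter_subset_left le_rfl)
  have h2 : ∑ i, ∫⁻ x in strip Ω (C₁ * δ), ‖jet (φ k) i x‖ₑ ^ 2 ≤
      2 * (∑ i, (∫⁻ x in strip Ω (C₁ * δ), ‖weakJet u i x‖ₑ ^ 2) + h1DistSq (φ k) u) := by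
    rw [h1DistSq, ← Finset.sum_add_distrib, Finset.mul_sum]
    refine Finset.sum_le_sum fun i _ => ?_
    calc ∫⁻ x in strip Ω (C₁ * δ), ‖jet (φ k) i x‖ₑ ^ 2
        ≤ ∫⁻ x in strip Ω (C₁ * δ), 2 * (‖weakJet u i x‖ₑ ^ 2 +
          ‖jet (φ k) i x - weakJet u i x‖ₑ ^ 2) :=
          lintegral_mono fun x => enorm_sq_le_two_mul _ _
      _ = 2 * ((∫⁻ x in strip Ω (C₁ * δ), ‖weakJet u i x‖ₑ ^ 2) +
          ∫⁻ x in strip Ω (C₁ * δ), ‖jet (φ k) i x - weakJet u i x‖ₑ ^ 2) := by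
          rw [lintegral_const_mul' _ _ (by simp), lintegral_add_left'
            ((hmu i).enorm.pow_const 2)]
      _ ≤ _ := by
          gcongr
          exact Set.inter_subset_left
  refine ⟨ψ, ?_⟩
  calc h1DistSq ψ u
      ≤ 2 * (C * (2 * (∑ i, (∫⁻ x in strip Ω (C₁ * δ), ‖weakJet u i x‖ₑ ^ 2) +
          h1DistSq (φ k) u) + (ENNReal.ofReal δ)⁻¹ * ∫⁻ x, ‖φ k x‖ₑ ^ 2 ∂(surfaceMeasure Ω)) +
          h1DistSq (φ k) u) := h1.trans (by gcongr; exact hψ.trans (by gcongr))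
    _ = (4 * C : ℝ≥0∞) * ∑ i, (∫⁻ x in strip Ω (C₁ * δ), ‖weakJet u i x‖ₑ ^ 2) +
        ((4 * C + 2 : ℝ≥0∞) * h1DistSq (φ k) u +
      (2 * C * (ENNReal.ofReal δ)⁻¹ : ℝ≥0∞) * ∫⁻ x, ‖φ k x‖ₑ ^ 2 ∂(surfaceMeasure Ω)) := by ring
    _ ≤ ε / 2 + ε / 2 := add_le_add hδ1 hk
    _ = ε := ENNReal.add_halves ε

/-- Test functions vanish on the boundary because their supports lie in the open set Ω. -/
lemma hasTrace_zero_of_mem_H10 {u : VecL2 m Ω} (hu : u ∈ H10 m Ω) : HasTrace u 0 := by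
  obtain ⟨hu1, φ, hφ⟩ := hu
  refine ⟨hu1, fun k => φ k, fun k => ⟨(φ k).contDiff, (φ k).hasCompactSupport⟩, hφ, ?_⟩
  refine tendsto_const_nhds.congr fun k => (eLpNorm_eq_zero_of_ae_zero ?_).symm
  filter_upwards [Lp.coeFn_zero (EuclideanSpace ℂ (Fin m)) 2 (surfaceMeasure Ω),
    ae_restrict_mem isClosed_frontier.measurableSet] with x hx hxΩ
  rw [frontier, Ω.isOpen.interior_eq] at hxΩ
  rw [hx, image_eq_zero_of_notMem_tsupport fun h => hxΩ.2 ((φ k).tsupport_subset h)]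
  simp

/-- The kernel of the Dirichlet trace is `H¹₀`. -/
lemma hasTrace_zero_iff (hn : 1 ≤ n)
    (hΩ : IsBoundedLipschitzDomain (Ω : Set (EuclideanSpace ℝ (Fin n)))) {u : VecL2 m Ω} :
    HasTrace u 0 ↔ u ∈ H10 m Ω :=
  ⟨mem_H10_of_hasTrace_zero hn hΩ, hasTrace_zero_of_mem_H10⟩

end Trace

end DivForm

/-! ### The Dirichlet realization on a bounded Lipschitz domain. -/

theorem mainTheorem11 (n m : ℕ) (hn : 2 ≤ n) (hm : 1 ≤ m)
    (Ω : TopologicalSpace.Opens (EuclideanSpace ℝ (Fin n)))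
    (hΩ : DivForm.IsBoundedLipschitzDomain (Ω : Set (EuclideanSpace ℝ (Fin n))))
    (A : DivForm.Coeff m Ω) (a₀ : ℝ) (ha₀ : 0 < a₀)
    (hell : DivForm.StrongLegendre A a₀) (hsymm : DivForm.SymmetricCoeff A) :
    -- the two descriptions of the domain, and the action of the operator
    ((DivForm.dirichletRealization A).domain : Set (DivForm.VecL2 m Ω)) =
        {u | u ∈ DivForm.H1 m Ω ∧ (∃ f, DivForm.IsDivForm A u f) ∧ DivForm.HasTrace u 0} ∧
    ((DivForm.dirichletRealization A).domain : Set (DivForm.VecL2 m Ω)) =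
        {u | u ∈ DivForm.H10 m Ω ∧ ∃ f, DivForm.IsDivForm A u f} ∧
    (∀ u : (DivForm.dirichletRealization A).domain,
        DivForm.IsDivForm A (u : DivForm.VecL2 m Ω) (DivForm.dirichletRealization A u)) ∧
    -- self-adjointness and strict positivity
    Dense ((DivForm.dirichletRealization A).domain : Set (DivForm.VecL2 m Ω)) ∧
    IsSelfAdjoint (DivForm.dirichletRealization A) ∧
    DivForm.IsStrictlyPositive (DivForm.dirichletRealization A) ∧
    -- the domain of the square root
    (∃! S, DivForm.IsSqrt S (DivForm.dirichletRealization A)) ∧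
    (∀ S, DivForm.IsSqrt S (DivForm.dirichletRealization A) → S.domain = DivForm.H10 m Ω) ∧
    -- the spectrum
    DivForm.spectrum (DivForm.dirichletRealization A) ⊆ {z : ℂ | 0 < z.re ∧ z.im = 0} ∧
    DivForm.essentialSpectrum (DivForm.dirichletRealization A) = ∅ ∧
    -- the associated form
    (∃ c : ℝ, DivForm.IsClosedFormBddBelow (DivForm.H10 m Ω) (DivForm.dirichletForm A) c ∧
      ∀ u ∈ DivForm.H10 m Ω, ∀ ε > 0, ∃ v ∈ (DivForm.dirichletRealization A).domain,
        DivForm.formNormSq (DivForm.dirichletForm A) c (u - v) < ε) ∧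
    (∀ T : DivForm.VecL2 m Ω →ₗ.[ℂ] DivForm.VecL2 m Ω,
      DivForm.IsAssociatedOperator (DivForm.H10 m Ω) (DivForm.dirichletForm A) T ↔
        T = DivForm.dirichletRealization A) := by
  have hT := DivForm.isAssociatedOperator_dirichletRealization A
  have hb := hΩ.isBounded
  have hform := DivForm.isClosedFormBddBelow_dirichletForm ha₀ hell hsymm
  obtain ⟨C, hC, hpoinc⟩ := DivForm.poincare_inequality (m := m) (by omega : n ≠ 0) hb
  let F : DivForm.CoerciveForm (DivForm.VecL2 m Ω) :=
    { dom := DivForm.H10 m Ω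
      form := DivForm.dirichletForm A
      -- Ellipticity gives a₀ ‖∇u‖² and Poincaré gives ‖u‖² ≤ C ‖∇u‖².
      const := a₀ / C
      closed := hform
      const_pos := div_pos ha₀ hC
      coercive := fun u hu => by
        refine le_trans ?_ (DivForm.dirichletForm_coercive hell u)
        rw [div_mul_eq_mul_div, div_le_iff₀ hC, mul_assoc]
        refine mul_le_mul_of_nonneg_left ((hpoinc u hu).trans_eq (mul_comm _ _)) ha₀.le }
  have hF : DivForm.IsAssociatedOperator F.dom F.form (DivForm.dirichletRealization A) := hT
  -- The norm of the form space controls the gradient by ellipticity, which is the bound required by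
  -- Rellich.
  have hcomp : IsCompactOperator F.embed :=
    DivForm.isCompactOperator_of_gradNormSq_le hb F.embed F.incl_mem ha₀ fun u => by
      rw [F.norm_sq_eq]
      exact DivForm.dirichletForm_coercive hell _
  have hdom : ((DivForm.dirichletRealization A).domain : Set (DivForm.VecL2 m Ω)) =
      {u | u ∈ DivForm.H10 m Ω ∧ ∃ f, DivForm.IsDivForm A u f} := by
    ext u
    simp only [SetLike.mem_coe, LinearPMap.mem_domain_iff,
      DivForm.mem_graph_dirichletRealization, exists_and_left, Set.mem_ofPred_eq]
  refine ⟨?_, hdom, fun u => ?_, (F.isSelfAdjoint hF).dense_domain, F.isSelfAdjoint hF,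
    F.isStrictlyPositive hF, F.existsUnique_isSqrt hF, fun S hS => F.domain_sqrt hF hS,
    F.spectrum_subset hF hcomp, F.essentialSpectrum_eq_empty hF hcomp,
    ⟨0, hform, fun u hu ε hε => F.dense_domain_formNorm hF hu hε⟩, fun T => ⟨fun h => h.unique hT,
    fun h => h ▸ hT⟩⟩
  · rw [hdom]
    ext u
    simp only [Set.mem_ofPred_eq, DivForm.hasTrace_zero_iff (by omega : 1 ≤ n) hΩ]
    exact ⟨fun h => ⟨h.1.1, h.2, h.1⟩, fun h => ⟨h.2.2, h.2.1⟩⟩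
  · exact ((DivForm.mem_graph_dirichletRealization A _ _).1
      ((DivForm.dirichletRealization A).mem_graph u)).2
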